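/- Work with functions and distributions that are $1$-periodic in both variables $x=(x_1,x_2)\in\mathbb R^2$. Let $d(x,y)=|x_1-y_1|+|x_2-y_2|^{2/3}$. For a periodic function $g$ put $[g]_\alpha=\sup_{x\ne y}\frac{|g(y)-g(x)|}{d(y,x)^\alpha}$ if $\alpha\in(0,1]$. For a periodic distribution $f$ and $\beta\in(-\frac32,-1]$ put $$[f]_\beta=\inf\{|c|+[g]_{\beta+2}+[h]_{\beta+\frac32}\,:\,f=c+\partial_1^2g+\partial_2h,\ c\in\mathbb R,\ g,h\text{ periodic functions}\}\in[0,\infty].$$ Let $\phi$ be a real Schwartz function on $\mathbb R^2$ with $\phi(-x)=\phi(x)$ and $\int_{\mathbb R^2}\phi\,dx=1$, let $\phi_\ell(x)=\ell^{-5/2}\phi(x_1/\ell,x_2/\ell^{3/2})$ for $\ell>0$. Let $P$ be the $L^2$-orthogonal projection onto the functions of vanishing average in $x_1$, extended by duality to periodic distributions. Let $\xi$ be white noise on the torus $[0,1)^2$ under the expectation $\langle\cdot\rangle$, that is, a random periodic distribution such that $\xi(u)$ is centered Gaussian with variance $\int_{[0,1)^2}u^2\,dx$ for every smooth periodic $u$;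 write $\xi_\ell=\phi_\ell*\xi$. Then for all $1\le p<\infty$ and $0<\varepsilon<\frac14$ there is a constant $C<\infty$, depending only on $p$, $\varepsilon$ and $\phi$, such that $$\Big\langle\sup_{0<\ell\le1}[P\xi_\ell]_{-\frac54-\varepsilon}^p\Big\rangle\le C$$ and, for all $0<\ell_0\le1$, $$\Big\langle\sup_{0<\ell\le\ell_0}[\xi_\ell-\xi]_{-\frac54-\varepsilon}^p\Big\rangle^{1/p}\le C\,\ell_0^{\varepsilon/2}.$$ -/

import Mathlib

open MeasureTheory Set
open scoped ENNReal NNReal ContDiff SchwartzMap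

noncomputable section

namespace WhiteNoiseTorus

/-! ### Periodic functions and test functions -/

/-- `f` is periodic with period `1` in both variables. -/
def IsPeriodic {F : Type*} (f : ℝ × ℝ → F) : Prop :=
  Function.Periodic f (1, 0) ∧ Function.Periodic f (0, 1)

/-- The fundamental cell `[0,1)²`. -/
def unitCell : Set (ℝ × ℝ) := Ico 0 1 ×ˢ Ico 0 1

lemma IsPeriodic.exists_bound {F : Type*} [NormedAddCommGroup F] {f : ℝ × ℝ → F}
    (hf : IsPeriodic f) (hc : Continuous f) : ∃ B : ℝ, ∀ x, ‖f x‖ ≤ B := by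
  obtain ⟨B, hB⟩ := (isCompact_Icc.prod isCompact_Icc :
    IsCompact (Icc (0 : ℝ) 1 ×ˢ Icc (0 : ℝ) 1)).exists_bound_of_continuousOn hc.continuousOn
  refine ⟨B, fun x => ?_⟩
  have h1 := hf.1.sub_zsmul_eq (x := x) ⌊x.1⌋
  have h2 := hf.2.sub_zsmul_eq (x := x - ⌊x.1⌋ • ((1 : ℝ), (0 : ℝ))) ⌊x.2⌋
  rw [← h1, ← h2]
  apply hB
  have e : x - ⌊x.1⌋ • ((1 : ℝ), (0 : ℝ)) - ⌊x.2⌋ • ((0 : ℝ), (1 : ℝ))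
      = (Int.fract x.1, Int.fract x.2) := by
    ext <;> simp [-zsmul_eq_mul]
  rw [e]
  exact ⟨⟨Int.fract_nonneg _, (Int.fract_lt_one _).le⟩,
    ⟨Int.fract_nonneg _, (Int.fract_lt_one _).le⟩⟩

lemma IsPeriodic.fderiv {F : Type*} [NormedAddCommGroup F] [NormedSpace ℝ F] {f : ℝ × ℝ → F}
    (hf : IsPeriodic f) : IsPeriodic (fderiv ℝ f) := by
  constructor
  · intro x
    have h : (fun y => f (y + (1, 0))) = f := funext hf.1
    rw [← fderiv_comp_add_right, h]
  · intro x
    have h : (fun y => f (y + (0, 1))) = f := funext hf.2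
    rw [← fderiv_comp_add_right, h]

/-- The space `C^∞(𝕋²)` of smooth real functions that are `1`-periodic in both variables. -/
def TestFun : Submodule ℝ (ℝ × ℝ → ℝ) where
  carrier := {u | ContDiff ℝ ∞ u ∧ IsPeriodic u}
  zero_mem' := ⟨contDiff_const, fun _ => rfl, fun _ => rfl⟩
  add_mem' := fun hu hv => ⟨hu.1.add hv.1, hu.2.1.add hv.2.1, hu.2.2.add hv.2.2⟩
  smul_mem' := fun c _ hu => ⟨contDiff_const.mul hu.1,
    fun x => congrArg (c * ·) (hu.2.1 x), fun x => congrArg (c * ·) (hu.2.2 x)⟩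

lemma differentiable_testFun (u : TestFun) : Differentiable ℝ (u : ℝ × ℝ → ℝ) :=
  u.2.1.differentiable (by simp)

/-- The derivative of a test function in the fixed direction `e`. -/
def dirDeriv (e : ℝ × ℝ) : TestFun →ₗ[ℝ] TestFun where
  toFun u := ⟨fun x => fderiv ℝ (u : ℝ × ℝ → ℝ) x e,
    (u.2.1.fderiv_right (m := ∞) (by simp)).clm_apply contDiff_const,
    fun x => by simp only [u.2.2.fderiv.1 x], fun x => by simp only [u.2.2.fderiv.2 x]⟩
  map_add' u v := by
    ext x
    simp [fderiv_add (differentiable_testFun u x) (differentiable_testFun v x)]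
  map_smul' c u := by
    ext x
    simp [fderiv_const_smul (differentiable_testFun u x) c]

/-- The partial derivative `∂₁` on test functions. -/
def pd1 : TestFun →ₗ[ℝ] TestFun := dirDeriv (1, 0)

/-- The partial derivative `∂₂` on test functions. -/
def pd2 : TestFun →ₗ[ℝ] TestFun := dirDeriv (0, 1)

/-! ### Periodic distributions -/

/-- The space of periodic distributions: the linear functionals on `C^∞(𝕋²)` that are continuous
for the family of seminorms `sup |∂₁ʲ ∂₂ˡ u|`. -/
def PeriodicDistribution : Submodule ℝ (Module.Dual ℝ TestFun) where
  carrier := {f | ∃ (C : ℝ) (N : ℕ), ∀ (u : TestFun) (B : ℝ),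
    (∀ j l : ℕ, j + l ≤ N → ∀ x : ℝ × ℝ, |(pd1^[j] (pd2^[l] u) : ℝ × ℝ → ℝ) x| ≤ B) →
      |f u| ≤ C * B}
  zero_mem' := ⟨0, 0, fun u B _ => by simp⟩
  add_mem' := by
    rintro f g ⟨C, N, hf⟩ ⟨D, M, hg⟩
    refine ⟨C + D, max N M, fun u B h => ?_⟩
    have h1 := hf u B fun j l hjl => h j l (hjl.trans (le_max_left _ _))
    have h2 := hg u B fun j l hjl => h j l (hjl.trans (le_max_right _ _))
    calc |(f + g) u| ≤ |f u| + |g u| := abs_add_le _ _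
      _ ≤ (C + D) * B := by linarith
  smul_mem' := by
    rintro c f ⟨C, N, hf⟩
    refine ⟨|c| * C, N, fun u B h => ?_⟩
    have h1 := hf u B h
    calc |(c • f) u| = |c| * |f u| := by simp [abs_mul]
      _ ≤ |c| * (C * B) := by gcongr
      _ = |c| * C * B := by ring

/-! ### Averages of translates: convolution and the projection `P` -/

section Averages

variable {Y : Type} [MeasurableSpace Y] {ν : Measure Y} {w : Y → ℝ} {τ : Y → ℝ × ℝ}

lemma integrable_translates (hw : Integrable w ν)
    {F : Type} [NormedAddCommGroup F] [NormedSpace ℝ F] {u : ℝ × ℝ → F}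
    (hc : Continuous u) (hu : IsPeriodic u) (hs : StronglyMeasurable (fun y => τ y))
    (x : ℝ × ℝ) : Integrable (fun y => w y • u (x + τ y)) ν := by
  obtain ⟨B, hB⟩ := hu.exists_bound hc
  refine Integrable.mono' (g := fun y => ‖w y‖ * B) (hw.norm.mul_const B) ?_ ?_
  · exact hw.1.smul (hc.comp_stronglyMeasurable
      (stronglyMeasurable_const.add hs)).aestronglyMeasurable
  · refine Filter.Eventually.of_forall fun y => ?_
    rw [norm_smul (w y)]
    exact mul_le_mul_of_nonneg_left (hB _) (norm_nonneg _)

lemma hasFDerivAt_translates (hw : Integrable w ν) (hτ : Measurable τ)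
    {F : Type} [NormedAddCommGroup F] [NormedSpace ℝ F] [CompleteSpace F] {u : ℝ × ℝ → F}
    (hc : ContDiff ℝ ∞ u) (hu : IsPeriodic u) (x : ℝ × ℝ) :
    HasFDerivAt (fun x => ∫ y, w y • u (x + τ y) ∂ν) (∫ y, w y • fderiv ℝ u (x + τ y) ∂ν) x := by
  have hs := hτ.stronglyMeasurable
  have hc' : Continuous (fderiv ℝ u) := hc.continuous_fderiv (by simp)
  obtain ⟨B, hB⟩ := hu.fderiv.exists_bound hc'
  refine hasFDerivAt_integral_of_dominated_of_fderiv_le (𝕜 := ℝ) (s := univ)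
    (F := fun x y => w y • u (x + τ y)) (F' := fun x y => w y • fderiv ℝ u (x + τ y))
    (bound := fun y => ‖w y‖ * B) Filter.univ_mem ?_ ?_ ?_ ?_ ?_ ?_
  · exact Filter.Eventually.of_forall fun z =>
      (integrable_translates hw hc.continuous hu hs z).1
  · exact integrable_translates hw hc.continuous hu hs x
  · exact (integrable_translates hw hc' hu.fderiv hs x).1
  · refine Filter.Eventually.of_forall fun y z _ => ?_
    rw [norm_smul (w y)]
    exact mul_le_mul_of_nonneg_left (hB _) (norm_nonneg _)
  · exact hw.norm.mul_const B
  · refine Filter.Eventually.of_forall fun y z _ => ?_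
    have hd : HasFDerivAt u (fderiv ℝ u (z + τ y)) (z + τ y) :=
      (hc.differentiable (by simp) _).hasFDerivAt
    exact ((hasFDerivAt_comp_add_right (τ y)).2 hd).const_smul (w y)

lemma isPeriodic_translates {F : Type} [NormedAddCommGroup F] [NormedSpace ℝ F] {u : ℝ × ℝ → F}
    (hu : IsPeriodic u) : IsPeriodic (fun x => ∫ y, w y • u (x + τ y) ∂ν) := by
  constructor
  · intro x
    refine integral_congr_ae (Filter.Eventually.of_forall fun y => ?_)
    simp only [add_right_comm x (1, 0) (τ y), hu.1 (x + τ y)]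
  · intro x
    refine integral_congr_ae (Filter.Eventually.of_forall fun y => ?_)
    simp only [add_right_comm x (0, 1) (τ y), hu.2 (x + τ y)]

lemma contDiff_translates (hw : Integrable w ν) (hτ : Measurable τ) (n : ℕ) :
    ∀ {F : Type} [NormedAddCommGroup F] [NormedSpace ℝ F] [CompleteSpace F] {u : ℝ × ℝ → F},
    ContDiff ℝ ∞ u → IsPeriodic u → ContDiff ℝ n (fun x => ∫ y, w y • u (x + τ y) ∂ν) := by
  induction n with
  | zero =>
    intro F _ _ _ u hc hu
    have h : Differentiable ℝ (fun x => ∫ y, w y • u (x + τ y) ∂ν) :=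
      fun x => (hasFDerivAt_translates hw hτ hc hu x).differentiableAt
    exact contDiff_zero.2 h.continuous
  | succ n ih =>
    intro F _ _ _ u hc hu
    push_cast
    rw [contDiff_succ_iff_fderiv]
    refine ⟨fun x => (hasFDerivAt_translates hw hτ hc hu x).differentiableAt, by simp, ?_⟩
    have h : fderiv ℝ (fun x => ∫ y, w y • u (x + τ y) ∂ν)
        = fun x => ∫ y, w y • fderiv ℝ u (x + τ y) ∂ν :=
      funext fun x => (hasFDerivAt_translates hw hτ hc hu x).fderiv
    rw [h]
    exact ih (hc.fderiv_right (by simp)) hu.fderiv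

end Averages

/-- For integrable `w`, the linear map `u ↦ (x ↦ ∫ w(y) u(x + y) dy)` on test functions. It is the
transpose of the convolution with `w`. -/
def corr (w : ℝ × ℝ → ℝ) (hw : Integrable w) : TestFun →ₗ[ℝ] TestFun where
  toFun u := ⟨fun x => ∫ y, w y • (u : ℝ × ℝ → ℝ) (x + y),
    contDiff_infty.2 fun n => contDiff_translates hw measurable_id n u.2.1 u.2.2,
    isPeriodic_translates (τ := fun y => y) u.2.2⟩
  map_add' u v := by
    ext x
    simp only [Submodule.coe_add, Pi.add_apply, smul_add]
    exact integral_add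
      (integrable_translates hw (τ := fun y => y) u.2.1.continuous u.2.2 stronglyMeasurable_id x)
      (integrable_translates hw (τ := fun y => y) v.2.1.continuous v.2.2 stronglyMeasurable_id x)
  map_smul' c u := by
    ext x
    simp only [Submodule.coe_smul, Pi.smul_apply, RingHom.id_apply]
    rw [← integral_smul]
    simp only [smul_eq_mul, mul_left_comm]

lemma corr_dirDeriv (w : ℝ × ℝ → ℝ) (hw : Integrable w) (e : ℝ × ℝ) (u : TestFun) :
    dirDeriv e (corr w hw u) = corr w hw (dirDeriv e u) := by
  ext x
  change fderiv ℝ (fun x => ∫ y, w y • (u : ℝ × ℝ → ℝ) (x + y)) x e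
    = ∫ y, w y • fderiv ℝ (u : ℝ × ℝ → ℝ) (x + y) e
  rw [(hasFDerivAt_translates (τ := fun y => y) hw measurable_id u.2.1 u.2.2 x).fderiv,
    ContinuousLinearMap.integral_apply (integrable_translates hw (τ := fun y => y)
      (u.2.1.continuous_fderiv (by simp)) u.2.2.fderiv stronglyMeasurable_id x)]
  rfl

lemma abs_corr_le (w : ℝ × ℝ → ℝ) (hw : Integrable w) (u : TestFun) (B : ℝ)
    (h : ∀ x, |(u : ℝ × ℝ → ℝ) x| ≤ B) (x : ℝ × ℝ) :
    |(corr w hw u : ℝ × ℝ → ℝ) x| ≤ (∫ y, ‖w y‖) * B := by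
  rw [← integral_mul_const]
  refine norm_integral_le_of_norm_le (f := fun y => w y • (u : ℝ × ℝ → ℝ) (x + y))
    (hw.norm.mul_const B) (Filter.Eventually.of_forall fun y => ?_)
  rw [norm_smul (w y)]
  exact mul_le_mul_of_nonneg_left (h _) (norm_nonneg _)

/-- The convolution `w * f` of a periodic distribution with an integrable function on `ℝ²`,
`(w * f)(u) = f(x ↦ ∫ w(y) u(x + y) dy)`. -/
def conv (w : ℝ × ℝ → ℝ) (hw : Integrable w) (f : PeriodicDistribution) :
    PeriodicDistribution :=
  ⟨(f : Module.Dual ℝ TestFun).comp (corr w hw), by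
    obtain ⟨f, C, N, hf⟩ := f
    refine ⟨C * ∫ y, ‖w y‖, N, fun u B h => ?_⟩
    rw [mul_assoc]
    refine hf _ _ fun j l hjl => ?_
    have h2 : pd2^[l] (corr w hw u) = corr w hw (pd2^[l] u) :=
      (Function.Semiconj.iterate_right (f := corr w hw)
        (fun v => (corr_dirDeriv w hw (0, 1) v).symm) l u).symm
    have h1 : pd1^[j] (corr w hw (pd2^[l] u)) = corr w hw (pd1^[j] (pd2^[l] u)) :=
      (Function.Semiconj.iterate_right (f := corr w hw)
        (fun v => (corr_dirDeriv w hw (1, 0) v).symm) j _).symm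
    rw [h2, h1]
    exact abs_corr_le w hw _ B (h j l hjl)⟩

/-- The anisotropically rescaled kernel `φ_ℓ(x₁,x₂) = ℓ^{-5/2} φ(x₁/ℓ, x₂/ℓ^{3/2})`. -/
def rescale (φ : 𝓢(ℝ × ℝ, ℝ)) (ℓ : ℝ) (x : ℝ × ℝ) : ℝ :=
  1 / ℓ ^ (5 / 2 : ℝ) * φ (x.1 / ℓ, x.2 / ℓ ^ (3 / 2 : ℝ))

lemma integrable_rescale (φ : 𝓢(ℝ × ℝ, ℝ)) {ℓ : ℝ} (hℓ : 0 < ℓ) : Integrable (rescale φ ℓ) := by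
  have h1 : ℓ⁻¹ ≠ 0 := inv_ne_zero hℓ.ne'
  have h2 : (ℓ ^ (3 / 2 : ℝ))⁻¹ ≠ 0 := inv_ne_zero (Real.rpow_pos_of_pos hℓ _).ne'
  let L : (ℝ × ℝ) ≃L[ℝ] (ℝ × ℝ) :=
    (ContinuousLinearEquiv.unitsEquivAut ℝ (Units.mk0 _ h1)).prodCongr
      (ContinuousLinearEquiv.unitsEquivAut ℝ (Units.mk0 _ h2))
  have h := (SchwartzMap.compCLMOfContinuousLinearEquiv ℝ L φ).integrable (μ := volume)
  exact h.const_mul _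

/-- The mollification `f_ℓ = φ_ℓ * f`. -/
def mollify (φ : 𝓢(ℝ × ℝ, ℝ)) (ℓ : ℝ) (hℓ : 0 < ℓ) (f : PeriodicDistribution) :
    PeriodicDistribution :=
  conv (rescale φ ℓ) (integrable_rescale φ hℓ) f

/-- The average in `x₁` of a test function, as a function of `x` that does not depend on `x₁`. -/
def avg1 : TestFun →ₗ[ℝ] TestFun where
  toFun u := ⟨fun x => ∫ s in Ico (0 : ℝ) 1, (u : ℝ × ℝ → ℝ) (s, x.2), by
    have hw : Integrable (fun _ : ℝ => (1 : ℝ)) (volume.restrict (Ico (0 : ℝ) 1)) :=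
      integrable_const _
    have hτ : Measurable (fun s : ℝ => (s, (0 : ℝ))) := by fun_prop
    have h : ContDiff ℝ ∞ (fun x => ∫ s in Ico (0 : ℝ) 1,
        (1 : ℝ) • (u : ℝ × ℝ → ℝ) (x + (s, 0))) :=
      contDiff_infty.2 fun n => contDiff_translates hw hτ n u.2.1 u.2.2
    have h' : ContDiff ℝ ∞ (fun x : ℝ × ℝ => ((0 : ℝ), x.2)) := by fun_prop
    simpa [Function.comp_def] using h.comp h',
    fun x => by simp, fun x => by
      refine integral_congr_ae (Filter.Eventually.of_forall fun s => ?_)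
      simpa using u.2.2.2 (s, x.2)⟩
  map_add' u v := by
    have hi : ∀ (u : TestFun) (t : ℝ),
        IntegrableOn (fun s => (u : ℝ × ℝ → ℝ) (s, t)) (Ico 0 1) := fun u t =>
      ((u.2.1.continuous.comp (by fun_prop : Continuous fun s : ℝ => (s, t))).continuousOn
        |>.integrableOn_compact isCompact_Icc).mono_set Ico_subset_Icc_self
    ext x
    exact integral_add (hi u x.2) (hi v x.2)
  map_smul' c u := by
    ext x
    exact integral_const_mul c _

/-- The projection `P` onto the functions of vanishing average in `x₁`, on test functions. -/
def projTest : TestFun →ₗ[ℝ] TestFun := LinearMap.id - avg1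

lemma abs_avg1_le (u : TestFun) (B : ℝ) (h : ∀ x, |(u : ℝ × ℝ → ℝ) x| ≤ B) (x : ℝ × ℝ) :
    |(avg1 u : ℝ × ℝ → ℝ) x| ≤ B := by
  have := norm_setIntegral_le_of_norm_le_const (μ := (volume : Measure ℝ)) (s := Ico (0 : ℝ) 1)
    (f := fun s => (u : ℝ × ℝ → ℝ) (s, x.2)) (C := B) (by simp) (fun s _ => h _)
  simp only [measureReal_def, Real.volume_Ico, sub_zero, ENNReal.ofReal_one, ENNReal.toReal_one,
    mul_one] at this
  exact this

lemma hasFDerivAt_avg1 (u : TestFun) (x e : ℝ × ℝ) :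
    (dirDeriv e (avg1 u) : ℝ × ℝ → ℝ) x
      = (avg1 (dirDeriv (0, e.2) u) : ℝ × ℝ → ℝ) x := by
  have hw : Integrable (fun _ : ℝ => (1 : ℝ)) (volume.restrict (Ico (0 : ℝ) 1)) :=
    integrable_const _
  have hτ : Measurable (fun s : ℝ => (s, (0 : ℝ))) := by fun_prop
  let L : (ℝ × ℝ) →L[ℝ] (ℝ × ℝ) := (0 : (ℝ × ℝ) →L[ℝ] ℝ).prod (ContinuousLinearMap.snd ℝ ℝ ℝ)
  have h := (hasFDerivAt_translates hw hτ u.2.1 u.2.2 (L x)).comp x L.hasFDerivAt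
  have hfun : (fun x => ∫ s in Ico (0 : ℝ) 1, (u : ℝ × ℝ → ℝ) (s, x.2))
      = (fun x => ∫ s in Ico (0 : ℝ) 1, (1 : ℝ) • (u : ℝ × ℝ → ℝ) (x + (s, 0))) ∘ L := by
    funext x
    simp [L]
  change fderiv ℝ (fun x => ∫ s in Ico (0 : ℝ) 1, (u : ℝ × ℝ → ℝ) (s, x.2)) x e
    = ∫ s in Ico (0 : ℝ) 1, fderiv ℝ (u : ℝ × ℝ → ℝ) (s, x.2) (0, e.2)
  rw [hfun, h.fderiv, ContinuousLinearMap.comp_apply,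
    ContinuousLinearMap.integral_apply (integrable_translates hw
      (u.2.1.continuous_fderiv (by simp)) u.2.2.fderiv hτ.stronglyMeasurable (L x))]
  simp [L]

lemma pd1_avg1 (u : TestFun) : pd1 (avg1 u) = 0 := by
  rw [← map_zero avg1]
  ext x
  have h := hasFDerivAt_avg1 u x (1, 0)
  have h0 : dirDeriv (0, 0) u = 0 := by
    ext y
    exact map_zero (fderiv ℝ (u : ℝ × ℝ → ℝ) y)
  rw [h0] at h
  exact h

lemma pd2_avg1 (u : TestFun) : pd2 (avg1 u) = avg1 (pd2 u) := by
  ext x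
  exact hasFDerivAt_avg1 u x (0, 1)

/-- The projection `P` on periodic distributions, extended by duality: `(P f)(u) = f(P u)`. -/
def proj (f : PeriodicDistribution) : PeriodicDistribution :=
  ⟨(f : Module.Dual ℝ TestFun).comp projTest, by
    obtain ⟨f, C, N, hf⟩ := f
    refine ⟨C * 2, N, fun u B h => ?_⟩
    rw [mul_assoc]
    refine hf _ _ fun j l hjl x => ?_
    have hB : 0 ≤ B := (abs_nonneg _).trans (h 0 0 (by simp) x)
    have h2 : pd2^[l] (avg1 u) = avg1 (pd2^[l] u) :=
      (Function.Semiconj.iterate_right (f := avg1) (fun v => (pd2_avg1 v).symm) l u).symm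
    have h1 : ∀ v : TestFun, (∀ x, |(v : ℝ × ℝ → ℝ) x| ≤ B) →
        |(pd1^[j] (avg1 v) : ℝ × ℝ → ℝ) x| ≤ B := by
      intro v hv
      cases j with
      | zero => exact abs_avg1_le v B hv x
      | succ j =>
        rw [Function.iterate_succ_apply, pd1_avg1, iterate_map_zero pd1 j]
        simpa using hB
    have h3 : (pd1^[j] (pd2^[l] (projTest u)) : TestFun)
        = pd1^[j] (pd2^[l] u) - pd1^[j] (avg1 (pd2^[l] u)) := by
      rw [← h2, projTest, LinearMap.sub_apply, LinearMap.id_apply, iterate_map_sub,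
        iterate_map_sub]
    rw [h3]
    have h4 := h1 (pd2^[l] u) (h 0 l (by omega))
    have h5 := h j l hjl x
    calc |((pd1^[j] (pd2^[l] u) - pd1^[j] (avg1 (pd2^[l] u)) : TestFun) : ℝ × ℝ → ℝ) x|
        ≤ |(pd1^[j] (pd2^[l] u) : ℝ × ℝ → ℝ) x|
          + |(pd1^[j] (avg1 (pd2^[l] u)) : ℝ × ℝ → ℝ) x| := abs_sub _ _
      _ ≤ 2 * B := by linarith⟩

/-! ### Anisotropic Hölder seminorms -/

/-- The anisotropic distance `d(x,y) = |x₁ - y₁| + |x₂ - y₂|^{2/3}`. -/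
def anisoDist (x y : ℝ × ℝ) : ℝ := |x.1 - y.1| + |x.2 - y.2| ^ (2 / 3 : ℝ)

/-- The Hölder seminorm `[f]_α` of a periodic function, for `α ∈ (0, 3/2)`. In the case `α > 1` a
finite value forces `f` to be differentiable in `x₁`, so that the default value of `deriv` at
points of non-differentiability plays no role. -/
def holderPos (α : ℝ) (f : ℝ × ℝ → ℝ) : ℝ≥0∞ :=
  if α ≤ 1 then
    ⨆ (x : ℝ × ℝ) (y : ℝ × ℝ) (_ : x ≠ y),
      ENNReal.ofReal (|f y - f x| / anisoDist y x ^ α)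
  else
    ⨆ (x : ℝ × ℝ) (y : ℝ × ℝ) (_ : x ≠ y),
      ENNReal.ofReal (|f y - f x - deriv (fun s => f (s, x.2)) x.1 * (y.1 - x.1)|
        / anisoDist y x ^ α)

/-- The seminorm `[f]_β` of a periodic distribution, for `β ∈ (-3/2, 0)`: the infimum of
`|c| + [g]_{β+1} + [h]_{β+3/2}` over the representations `f = c + ∂₁ g + ∂₂ h` if `β > -1`, and of
`|c| + [g]_{β+2} + [h]_{β+3/2}` over the representations `f = c + ∂₁² g + ∂₂ h` if `β ≤ -1`, with
periodic functions `g`, `h` and a constant `c`; it is `∞` if there is none. Functions of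
finite Hölder seminorm are continuous, so that the integrals that test the distributional
identity make sense for every representation that contributes to the infimum. -/
def holderNeg (β : ℝ) (f : PeriodicDistribution) : ℝ≥0∞ :=
  if -1 < β then
    ⨅ (c : ℝ) (g : ℝ × ℝ → ℝ) (h : ℝ × ℝ → ℝ) (_ : IsPeriodic g) (_ : IsPeriodic h)
      (_ : ∀ u : TestFun, f.1 u = c * (∫ x in unitCell, (u : ℝ × ℝ → ℝ) x)
        - (∫ x in unitCell, g x * (pd1 u : ℝ × ℝ → ℝ) x)
        - (∫ x in unitCell, h x * (pd2 u : ℝ × ℝ → ℝ) x)),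
      ENNReal.ofReal |c| + holderPos (β + 1) g + holderPos (β + 3 / 2) h
  else
    ⨅ (c : ℝ) (g : ℝ × ℝ → ℝ) (h : ℝ × ℝ → ℝ) (_ : IsPeriodic g) (_ : IsPeriodic h)
      (_ : ∀ u : TestFun, f.1 u = c * (∫ x in unitCell, (u : ℝ × ℝ → ℝ) x)
        + (∫ x in unitCell, g x * (pd1 (pd1 u) : ℝ × ℝ → ℝ) x)
        - (∫ x in unitCell, h x * (pd2 u : ℝ × ℝ → ℝ) x)),
      ENNReal.ofReal |c| + holderPos (β + 2) g + holderPos (β + 3 / 2) h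

/-! ### White noise and expectation -/

/-- `ξ` is a (real, periodic) white noise: a random periodic distribution such that `ξ(u)` is
centered Gaussian with variance `∫_{[0,1)²} u²` for every test function `u`. Since `ξ` is linear in
`u`, the family `(ξ(u))_u` is then jointly Gaussian with covariance
`⟨ξ(u) ξ(v)⟩ = ∫_{[0,1)²} u v`. -/
def IsWhiteNoise {Ω : Type*} [MeasurableSpace Ω] (μ : Measure Ω)
    (ξ : Ω → PeriodicDistribution) : Prop :=
  ∀ u : TestFun, ProbabilityTheory.HasLaw (fun θ => (ξ θ).1 u)
    (ProbabilityTheory.gaussianReal 0 (∫ x in unitCell, (u : ℝ × ℝ → ℝ) x ^ 2).toNNReal) μ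

/-- The expectation `⟨F⟩ ∈ [0,∞]` of `F ≥ 0`, as an upper integral, so that no measurability of a
supremum over uncountably many random variables is presupposed. -/
def expect {Ω : Type*} [MeasurableSpace Ω] (μ : Measure Ω) (F : Ω → ℝ≥0∞) : ℝ≥0∞ :=
  ⨅ (M : Ω → ℝ≥0∞) (_ : Measurable M) (_ : ∀ᵐ θ ∂μ, F θ ≤ M θ), ∫⁻ θ, M θ ∂μ

/-- The upper integral dominates the Lebesgue integral and agrees with it on (a.e.) measurable
functions. -/
lemma lintegral_le_expect {Ω : Type*} [MeasurableSpace Ω] (μ : Measure Ω) (F : Ω → ℝ≥0∞) :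
    ∫⁻ θ, F θ ∂μ ≤ expect μ F :=
  le_iInf fun _ => le_iInf fun _ => le_iInf fun h => lintegral_mono_ae h

lemma expect_eq_lintegral {Ω : Type*} [MeasurableSpace Ω] (μ : Measure Ω) (F : Ω → ℝ≥0∞)
    (hF : AEMeasurable F μ) : expect μ F = ∫⁻ θ, F θ ∂μ := by
  refine le_antisymm ?_ (lintegral_le_expect μ F)
  rw [lintegral_congr_ae hF.ae_eq_mk]
  exact iInf_le_of_le (hF.mk F) (iInf_le_of_le hF.measurable_mk
    (iInf_le_of_le hF.ae_eq_mk.le le_rfl))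

end WhiteNoiseTorus

end

namespace WhiteNoiseTorus

/-! ### Integrals of periodic functions over the unit cell -/

/-! All randomness is put into one number per realisation. Almost surely `ξ = c + ∂₁²g + ∂₂h`, where
`|c|` and the Hölder seminorms of `g`, `h` (exponents `3/4 - ε` and `1/4 - ε`) are at most a
constant times `S^(1/P)`, with `⟨S⟩ ≤ K` (`exists_moment_bound`). Everything else is deterministic,
so the suprema over the uncountably many `ℓ` cost nothing.

Construction of `g` and `h`. The nonzero frequencies are cut into parabolic shells with `|k₁|` up to
`4^(j+1)` and `|k₂|` up to `8^(j+1)`. A frequency of the shell `j` has `|k₁| ≥ 4^j` or `|k₂| ≥ 8^j`.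
In the first case its mode goes to `g`, divided by the symbol of `∂₁²` at the cost `16^(-j)`.
Otherwise it goes to `h`, divided by the symbol of `∂₂` at the cost `8^(-j)` (`coef_identity`). A
shell contains of the order of `32^j` modes, so a normalised block of white noise has standard
deviation of the order of `32^(j/2) = 4^(5j/4)`. If the suprema of the blocks and of their
normalised derivatives are at most `4^((5/4 + ε/2) j)` up to a constant, the blocks of `g` and `h`
decay like `4^(-(3/4 - ε/2) j)` and `4^(-(1/4 - ε/2) j)`. Summing the interpolated bounds gives the
stated Hölder exponents, with `ε/2` left over for a geometric series (`abs_sub_le_of_block`,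
`holderBound_tsum_of_block`, `hasRep_of_bounds`).

Probability. `S` is a sum of `P`-th powers of countably many Gaussians divided by weights: the
Fourier coefficients, and the blocks on grids. For large `P` the weights beat the number of terms.
The grids are so fine that polynomial growth of the Fourier coefficients controls a block between
grid points (`abs_field_le_of_grid`).

Deterministic consequences. Projection and convolution act on the representation itself
(`HasRep.proj`, `HasRep.conv`), and the `L¹` norm of `φ_ℓ` does not depend on `ℓ`. Hence the first
estimate. For the second, start from a representation with `ε/2` in place of `ε` and trade the spare
`ε/2` of regularity for the factor `ℓ^(ε/2)` (`HasRep.mollify_sub`). The identity `f = c + ∂₁²g +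
∂₂h` need only be checked on trigonometric functions, because these determine a periodic
distribution (`eq_zero_of_trig`). -/

lemma volume_unitCell : volume unitCell = 1 := by
  simp [unitCell, Measure.volume_eq_prod, Measure.prod_prod]

instance isProbabilityMeasure_restrict_unitCell :
    IsProbabilityMeasure ((volume : Measure (ℝ × ℝ)).restrict unitCell) :=
  ⟨by simp [volume_unitCell]⟩

lemma integrableOn_Ico_prod {F : Type*} [NormedAddCommGroup F] {G : ℝ × ℝ → F}
    (hG : Continuous G) (a b c d : ℝ) : IntegrableOn G (Ico a b ×ˢ Ico c d) :=
  (hG.continuousOn.integrableOn_compact (isCompact_Icc.prod isCompact_Icc)).mono_set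
    (prod_mono Ico_subset_Icc_self Ico_subset_Icc_self)

lemma integrableOn_unitCell {F : Type*} [NormedAddCommGroup F] {G : ℝ × ℝ → F}
    (hG : Continuous G) : IntegrableOn G unitCell :=
  integrableOn_Ico_prod hG 0 1 0 1

lemma setIntegral_Ico_prod {G : ℝ × ℝ → ℝ} (hG : Continuous G) (a b : ℝ) :
    ∫ z in Ico a (a + 1) ×ˢ Ico b (b + 1), G z = ∫ s in a..a + 1, ∫ t in b..b + 1, G (s, t) := by
  rw [Measure.volume_eq_prod, setIntegral_prod _ (integrableOn_Ico_prod hG _ _ _ _),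
    intervalIntegral.integral_of_le (by linarith), integral_Ico_eq_integral_Ioc]
  refine integral_congr_ae (Filter.Eventually.of_forall fun s => ?_)
  simp only
  rw [intervalIntegral.integral_of_le (by linarith), integral_Ico_eq_integral_Ioc]

lemma setIntegral_unitCell {G : ℝ × ℝ → ℝ} (hG : Continuous G) :
    ∫ z in unitCell, G z = ∫ s in (0 : ℝ)..1, ∫ t in (0 : ℝ)..1, G (s, t) := by
  have := setIntegral_Ico_prod hG 0 0
  simpa [unitCell] using this

lemma IsPeriodic.periodic_fst {F : Type*} {G : ℝ × ℝ → F} (hG : IsPeriodic G) (t : ℝ) :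
    Function.Periodic (fun s => G (s, t)) 1 := fun s => by simpa using hG.1 (s, t)

lemma IsPeriodic.periodic_snd {F : Type*} {G : ℝ × ℝ → F} (hG : IsPeriodic G) (s : ℝ) :
    Function.Periodic (fun t => G (s, t)) 1 := fun t => by simpa using hG.2 (s, t)

lemma IsPeriodic.setIntegral_Ico_prod_eq {G : ℝ × ℝ → ℝ} (hp : IsPeriodic G) (hG : Continuous G)
    (a b : ℝ) : ∫ z in Ico a (a + 1) ×ˢ Ico b (b + 1), G z = ∫ z in unitCell, G z := by
  rw [setIntegral_Ico_prod hG, setIntegral_unitCell hG]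
  have h1 : ∀ s, ∫ t in b..b + 1, G (s, t) = ∫ t in (0 : ℝ)..1, G (s, t) := fun s => by
    simpa using (hp.periodic_snd s).intervalIntegral_add_eq b 0
  simp only [h1]
  have h2 : Function.Periodic (fun s => ∫ t in (0 : ℝ)..1, G (s, t)) 1 := fun s => by
    refine intervalIntegral.integral_congr fun t _ => ?_
    exact hp.periodic_fst t s
  simpa using h2.intervalIntegral_add_eq a 0

/-- Translation invariance of the integral over the torus. It yields the vanishing of nonzero modes
and the transposition of convolutions. -/
lemma IsPeriodic.setIntegral_add {G : ℝ × ℝ → ℝ} (hp : IsPeriodic G) (hG : Continuous G)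
    (a : ℝ × ℝ) : ∫ x in unitCell, G (x + a) = ∫ x in unitCell, G x := by
  rw [← hp.setIntegral_Ico_prod_eq hG a.1 a.2, setIntegral_Ico_prod hG, setIntegral_unitCell
    (G := fun x => G (x + a)) (hG.comp (continuous_add_const a))]
  have h1 : ∀ s, ∫ t in (0 : ℝ)..1, G ((s, t) + a) = ∫ t in a.2..a.2 + 1, G (s + a.1, t) := by
    intro s
    have := intervalIntegral.integral_comp_add_right (a := 0) (b := 1)
      (fun t => G (s + a.1, t)) a.2
    simp only [zero_add, add_comm (1 : ℝ)] at this
    rw [← this]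
    rfl
  simp only [h1]
  have := intervalIntegral.integral_comp_add_right (a := 0) (b := 1)
    (fun s => ∫ t in a.2..a.2 + 1, G (s, t)) a.1
  simp only [zero_add, add_comm (1 : ℝ)] at this
  exact this

lemma IsPeriodic.comp_add {F : Type*} {G : ℝ × ℝ → F} (hp : IsPeriodic G) (a : ℝ × ℝ) :
    IsPeriodic (fun x => G (x + a)) :=
  ⟨fun x => by simpa only [add_right_comm x] using hp.1 (x + a),
    fun x => by simpa only [add_right_comm x] using hp.2 (x + a)⟩

lemma IsPeriodic.mul {G H : ℝ × ℝ → ℝ} (hG : IsPeriodic G) (hH : IsPeriodic H) :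
    IsPeriodic (fun x => G x * H x) :=
  ⟨fun x => by simp only [hG.1 x, hH.1 x], fun x => by simp only [hG.2 x, hH.2 x]⟩

lemma testFun_continuous (u : TestFun) : Continuous (u : ℝ × ℝ → ℝ) := u.2.1.continuous

lemma testFun_periodic (u : TestFun) : IsPeriodic (u : ℝ × ℝ → ℝ) := u.2.2

/-! ### Trigonometric test functions -/

/-- The phase `2π k·x`. -/
noncomputable def phase (k : ℤ × ℤ) (x : ℝ × ℝ) : ℝ := 2 * Real.pi * (k.1 * x.1 + k.2 * x.2)

lemma contDiff_phase (k : ℤ × ℤ) : ContDiff ℝ ∞ (phase k) := by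
  unfold phase
  fun_prop

lemma phase_add (k : ℤ × ℤ) (x y : ℝ × ℝ) : phase k (x + y) = phase k x + phase k y := by
  simp [phase]
  ring

lemma phase_add_left (k l : ℤ × ℤ) (x : ℝ × ℝ) : phase (k + l) x = phase k x + phase l x := by
  simp [phase]
  ring

lemma phase_sub_left (k l : ℤ × ℤ) (x : ℝ × ℝ) : phase (k - l) x = phase k x - phase l x := by
  simp [phase]
  ring

lemma phase_zero_left (x : ℝ × ℝ) : phase 0 x = 0 := by simp [phase]

lemma phase_neg_left (k : ℤ × ℤ) (x : ℝ × ℝ) : phase (-k) x = -phase k x := by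
  simp [phase]
  ring

lemma isPeriodic_cos_phase (k : ℤ × ℤ) (φ : ℝ) : IsPeriodic (fun x => Real.cos (phase k x + φ)) := by
  constructor
  · intro x
    have : phase k (x + (1, 0)) + φ = phase k x + φ + k.1 * (2 * Real.pi) := by
      simp [phase]; ring
    simp only [this, Real.cos_add_int_mul_two_pi]
  · intro x
    have : phase k (x + (0, 1)) + φ = phase k x + φ + k.2 * (2 * Real.pi) := by
      simp [phase]; ring
    simp only [this, Real.cos_add_int_mul_two_pi]

/-- The test function `cos (2π k·x + φ)`. -/
noncomputable def trig (k : ℤ × ℤ) (φ : ℝ) : TestFun :=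
  ⟨fun x => Real.cos (phase k x + φ),
    Real.contDiff_cos.comp ((contDiff_phase k).add contDiff_const), isPeriodic_cos_phase k φ⟩

lemma trig_apply (k : ℤ × ℤ) (φ : ℝ) (x : ℝ × ℝ) :
    (trig k φ : ℝ × ℝ → ℝ) x = Real.cos (phase k x + φ) := rfl

/-- The two phases `0` and `π/2` span all others, so each frequency contributes only two real
coefficients. -/
lemma trig_eq (k : ℤ × ℤ) (φ : ℝ) :
    trig k φ = Real.cos φ • trig k 0 + Real.sin φ • trig k (Real.pi / 2) := by
  ext x
  simp only [Submodule.coe_add, Submodule.coe_smul, Pi.add_apply, Pi.smul_apply, trig_apply,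
    smul_eq_mul, add_zero, Real.cos_add_pi_div_two, Real.cos_add (phase k x) φ]
  ring

lemma trig_neg (k : ℤ × ℤ) (φ : ℝ) : trig (-k) φ = trig k (-φ) := by
  ext x
  simp only [trig_apply, phase_neg_left]
  rw [← Real.cos_neg]
  congr 1
  ring

lemma trig_add_pi (k : ℤ × ℤ) (φ : ℝ) : trig k (φ + Real.pi) = -trig k φ := by
  ext x
  simp only [trig_apply, ← add_assoc, Real.cos_add_pi]
  rfl

/-- Differentiation is a multiplier together with a phase shift by `π/2`. Carrying the phase along
keeps the whole Fourier calculus real. -/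
lemma dirDeriv_trig (e : ℝ × ℝ) (k : ℤ × ℤ) (φ : ℝ) :
    dirDeriv e (trig k φ) = phase k e • trig k (φ + Real.pi / 2) := by
  ext x
  change fderiv ℝ (fun x => Real.cos (phase k x + φ)) x e = _
  have h1 : HasFDerivAt (phase k)
      ((2 * Real.pi) • ((k.1 : ℝ) • ContinuousLinearMap.fst ℝ ℝ ℝ +
        (k.2 : ℝ) • ContinuousLinearMap.snd ℝ ℝ ℝ)) x :=
    ((hasFDerivAt_fst.const_mul (k.1 : ℝ)).add (hasFDerivAt_snd.const_mul (k.2 : ℝ))).const_mul _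
  have h := (h1.add_const φ).cos
  rw [h.fderiv]
  simp only [Submodule.coe_smul, Pi.smul_apply, trig_apply, smul_eq_mul, ← add_assoc,
    Real.cos_add_pi_div_two, phase]
  simp
  ring

lemma pd1_trig (k : ℤ × ℤ) (φ : ℝ) :
    pd1 (trig k φ) = (2 * Real.pi * k.1) • trig k (φ + Real.pi / 2) := by
  simp [pd1, dirDeriv_trig, phase]

lemma pd2_trig (k : ℤ × ℤ) (φ : ℝ) :
    pd2 (trig k φ) = (2 * Real.pi * k.2) • trig k (φ + Real.pi / 2) := by
  simp [pd2, dirDeriv_trig, phase]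

lemma pd1_pd1_trig (k : ℤ × ℤ) (φ : ℝ) :
    pd1 (pd1 (trig k φ)) = (-(2 * Real.pi * k.1) ^ 2) • trig k φ := by
  rw [pd1_trig, map_smul, pd1_trig, smul_smul, add_assoc, add_halves, trig_add_pi, smul_neg,
    ← neg_smul]
  congr 1
  ring

lemma integral_cos_phase (k : ℤ × ℤ) (φ : ℝ) :
    ∫ x in unitCell, Real.cos (phase k x + φ) = if k = 0 then Real.cos φ else 0 := by
  split_ifs with hk
  · subst hk
    simp [phase_zero_left, measureReal_def]
  -- Translation by a vector that shifts the phase by `π` flips the sign of the cosine but preserves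
  -- its integral, which is therefore zero.
  · obtain ⟨a, ha⟩ : ∃ a, phase k a = Real.pi := by
      by_cases h1 : k.1 = 0
      · have h2 : (k.2 : ℝ) ≠ 0 := fun h => hk (Prod.ext h1 (by exact_mod_cast h))
        exact ⟨(0, 1 / (2 * k.2)), by simp [phase, h1]; field_simp⟩
      · have h2 : (k.1 : ℝ) ≠ 0 := by exact_mod_cast h1
        exact ⟨(1 / (2 * k.1), 0), by simp [phase]; field_simp⟩
    have h := (isPeriodic_cos_phase k φ).setIntegral_add (testFun_continuous (trig k φ)) a
    have h2 : ∀ x, Real.cos (phase k (x + a) + φ) = -Real.cos (phase k x + φ) := fun x => by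
      rw [phase_add, ha, add_right_comm, Real.cos_add_pi]
    simp only [h2, integral_neg] at h
    linarith

lemma cos_phase_mul (k l : ℤ × ℤ) (φ ψ : ℝ) (x : ℝ × ℝ) :
    Real.cos (phase k x + φ) * Real.cos (phase l x + ψ)
      = 1 / 2 * Real.cos (phase (k - l) x + (φ - ψ))
        + 1 / 2 * Real.cos (phase (k + l) x + (φ + ψ)) := by
  rw [phase_add_left, phase_sub_left,
    show phase k x - phase l x + (φ - ψ) = (phase k x + φ) - (phase l x + ψ) by ring,
    show phase k x + phase l x + (φ + ψ) = (phase k x + φ) + (phase l x + ψ) by ring,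
    Real.cos_sub, Real.cos_add (phase k x + φ) (phase l x + ψ)]
  ring

lemma continuous_cos_phase (k : ℤ × ℤ) (φ : ℝ) :
    Continuous (fun x => Real.cos (phase k x + φ)) := testFun_continuous (trig k φ)

/-- Real modes at `k` and `-k` span the same space, hence the two resonances; both occur when `k = l
= 0`. -/
lemma integral_cos_phase_mul (k l : ℤ × ℤ) (φ ψ : ℝ) :
    ∫ x in unitCell, Real.cos (phase k x + φ) * Real.cos (phase l x + ψ)
      = (if k = l then Real.cos (φ - ψ) / 2 else 0)
        + (if k = -l then Real.cos (φ + ψ) / 2 else 0) := by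
  simp only [cos_phase_mul]
  rw [integral_add ((integrableOn_unitCell (continuous_cos_phase _ _)).const_mul _)
    ((integrableOn_unitCell (continuous_cos_phase _ _)).const_mul _), integral_const_mul,
    integral_const_mul, integral_cos_phase, integral_cos_phase]
  simp only [sub_eq_zero, add_eq_zero_iff_eq_neg]
  split_ifs <;> ring

/-! ### Density of trigonometric polynomials -/

/-- The trigonometric polynomials as functions. -/
noncomputable def trigPoly : Submodule ℝ (ℝ × ℝ → ℝ) :=
  Submodule.span ℝ (range fun q : (ℤ × ℤ) × ℝ => fun x => Real.cos (phase q.1 x + q.2))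

lemma cos_phase_mem_trigPoly (k : ℤ × ℤ) (φ : ℝ) :
    (fun x => Real.cos (phase k x + φ)) ∈ trigPoly :=
  Submodule.subset_span ⟨(k, φ), rfl⟩

lemma one_mem_trigPoly : (1 : ℝ × ℝ → ℝ) ∈ trigPoly := by
  convert cos_phase_mem_trigPoly 0 0 using 1
  ext x
  simp [phase_zero_left]

lemma mul_mem_trigPoly {v w : ℝ × ℝ → ℝ} (hv : v ∈ trigPoly) (hw : w ∈ trigPoly) :
    v * w ∈ trigPoly := by
  have h : trigPoly * trigPoly ≤ trigPoly := by
    unfold trigPoly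
    rw [Submodule.span_mul_span, Submodule.span_le]
    rintro _ ⟨_, ⟨⟨k, φ⟩, rfl⟩, _, ⟨⟨l, ψ⟩, rfl⟩, rfl⟩
    have e : (fun x => Real.cos (phase k x + φ)) * (fun x => Real.cos (phase l x + ψ))
      = (1 / 2 : ℝ) • (fun x => Real.cos (phase (k - l) x + (φ - ψ)))
        + (1 / 2 : ℝ) • (fun x => Real.cos (phase (k + l) x + (φ + ψ))) := by
      ext x
      exact cos_phase_mul k l φ ψ x
    simp only [SetLike.mem_coe]
    rw [e]
    exact Submodule.add_mem _ (Submodule.smul_mem _ _ (cos_phase_mem_trigPoly _ _))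
      (Submodule.smul_mem _ _ (cos_phase_mem_trigPoly _ _))
  exact h (Submodule.mul_mem_mul hv hw)

lemma pow_mem_trigPoly {v : ℝ × ℝ → ℝ} (hv : v ∈ trigPoly) (n : ℕ) : v ^ n ∈ trigPoly := by
  induction n with
  | zero => simpa using one_mem_trigPoly
  | succ n ih => rw [pow_succ]; exact mul_mem_trigPoly ih hv

lemma trigPoly_props {w : ℝ × ℝ → ℝ} (hw : w ∈ trigPoly) : Continuous w ∧ IsPeriodic w := by
  induction hw using Submodule.span_induction with
  | mem w h =>
    obtain ⟨⟨k, φ⟩, rfl⟩ := h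
    exact ⟨continuous_cos_phase k φ, isPeriodic_cos_phase k φ⟩
  | zero => exact ⟨continuous_const, fun _ => rfl, fun _ => rfl⟩
  | add v w _ _ hv hw =>
    exact ⟨hv.1.add hw.1, fun x => by simp only [Pi.add_apply, hv.2.1 x, hw.2.1 x],
      fun x => by simp only [Pi.add_apply, hv.2.2 x, hw.2.2 x]⟩
  | smul c w _ hw =>
    exact ⟨hw.1.const_smul c, fun x => by simp only [Pi.smul_apply, hw.2.1 x],
      fun x => by simp only [Pi.smul_apply, hw.2.2 x]⟩

/-- The span of the trigonometric functions in the space of test functions. -/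
noncomputable def trigSpan : Submodule ℝ TestFun :=
  Submodule.span ℝ (range fun q : (ℤ × ℤ) × ℝ => trig q.1 q.2)

/-- By the addition theorem `cos (k·(y - x) + φ)` separates into products of a function of `y` and a
trigonometric function of `x`. Integrating in `y` only produces coefficients. -/
lemma exists_trigSpan_convolution {w : ℝ × ℝ → ℝ} (hw : w ∈ trigPoly) (u : TestFun) :
    ∃ v ∈ trigSpan, ∀ x, (v : ℝ × ℝ → ℝ) x
      = ∫ y in unitCell, w (y - x) * (u : ℝ × ℝ → ℝ) y := by
  have hu := testFun_continuous u
  have hint : ∀ {w : ℝ × ℝ → ℝ}, w ∈ trigPoly → ∀ x,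
      IntegrableOn (fun y => w (y - x) * (u : ℝ × ℝ → ℝ) y) unitCell := fun h x =>
    integrableOn_unitCell (((trigPoly_props h).1.comp (by fun_prop)).mul hu)
  induction hw using Submodule.span_induction with
  | mem w h =>
    obtain ⟨⟨k, φ⟩, rfl⟩ := h
    refine ⟨(∫ y in unitCell, Real.cos (phase k y + φ) * (u : ℝ × ℝ → ℝ) y) • trig k 0
      + (∫ y in unitCell, Real.cos (phase k y + (φ - Real.pi / 2)) * (u : ℝ × ℝ → ℝ) y) •
        trig k (-(Real.pi / 2)), ?_, fun x => ?_⟩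
    · exact Submodule.add_mem _ (Submodule.smul_mem _ _ (Submodule.subset_span ⟨(k, _), rfl⟩))
        (Submodule.smul_mem _ _ (Submodule.subset_span ⟨(k, _), rfl⟩))
    · simp only [Submodule.coe_add, Submodule.coe_smul, Pi.add_apply, Pi.smul_apply, trig_apply,
        smul_eq_mul]
      rw [← integral_mul_const, ← integral_mul_const, ← integral_add]
      · refine integral_congr_ae (Filter.Eventually.of_forall fun y => ?_)
        have h1 : phase k (y - x) = phase k y - phase k x := by simp [phase]; ring
        simp only [h1]
        rw [show phase k y - phase k x + φ = (phase k y + φ) - phase k x by ring,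
          ← add_sub_assoc, ← sub_eq_add_neg, Real.cos_sub_pi_div_two, Real.cos_sub_pi_div_two,
          Real.cos_sub, add_zero]
        ring
      · exact integrableOn_unitCell (((continuous_cos_phase _ _).mul hu).mul continuous_const)
      · exact integrableOn_unitCell (((continuous_cos_phase _ _).mul hu).mul continuous_const)
  | zero => exact ⟨0, Submodule.zero_mem _, fun x => by simp⟩
  | add w w' hw hw' h h' =>
    obtain ⟨v, hv, e⟩ := h
    obtain ⟨v', hv', e'⟩ := h'
    refine ⟨v + v', Submodule.add_mem _ hv hv', fun x => ?_⟩
    simp only [Submodule.coe_add, Pi.add_apply, e, e', add_mul]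
    rw [integral_add (hint hw x) (hint hw' x)]
  | smul c w hw h =>
    obtain ⟨v, hv, e⟩ := h
    refine ⟨c • v, Submodule.smul_mem _ _ hv, fun x => ?_⟩
    simp only [Submodule.coe_smul, Pi.smul_apply, e, smul_eq_mul, mul_assoc]
    rw [integral_const_mul]

/-- A nonnegative trigonometric polynomial with a unique maximum in the cell centred at `0`. -/
noncomputable def peak (y : ℝ × ℝ) : ℝ :=
  (1 / 2 + 1 / 2 * Real.cos (phase (1, 0) y + 0)) * (1 / 2 + 1 / 2 * Real.cos (phase (0, 1) y + 0))

lemma peak_mem_trigPoly : peak ∈ trigPoly := by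
  have h : ∀ k, (fun y => 1 / 2 + 1 / 2 * Real.cos (phase k y + 0)) ∈ trigPoly := fun k => by
    have e : (fun y => 1 / 2 + 1 / 2 * Real.cos (phase k y + 0))
        = (1 / 2 : ℝ) • (1 : ℝ × ℝ → ℝ) + (1 / 2 : ℝ) • (fun y => Real.cos (phase k y + 0)) := by
      ext x
      simp
    rw [e]
    exact Submodule.add_mem _ (Submodule.smul_mem _ _ one_mem_trigPoly)
      (Submodule.smul_mem _ _ (cos_phase_mem_trigPoly _ _))
  exact mul_mem_trigPoly (h (1, 0)) (h (0, 1))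

/-- The closed cell centred at `0`. -/
def centredCell : Set (ℝ × ℝ) := Icc (-(1 / 2)) (1 / 2) ×ˢ Icc (-(1 / 2)) (1 / 2)

lemma isCompact_centredCell : IsCompact centredCell := isCompact_Icc.prod isCompact_Icc

lemma IsPeriodic.setIntegral_centredCell {G : ℝ × ℝ → ℝ} (hp : IsPeriodic G)
    (hG : Continuous G) : ∫ z in centredCell, G z = ∫ z in unitCell, G z := by
  rw [← hp.setIntegral_Ico_prod_eq hG (-(1 / 2)) (-(1 / 2))]
  refine setIntegral_congr_set ?_
  have h : (-(1 / 2) + 1 : ℝ) = 1 / 2 := by norm_num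
  rw [h]
  exact (Measure.set_prod_ae_eq Ico_ae_eq_Icc Ico_ae_eq_Icc).symm

lemma cos_two_pi_lt_one {s : ℝ} (hs : s ∈ Icc (-(1 / 2) : ℝ) (1 / 2)) (h0 : s ≠ 0) :
    Real.cos (2 * Real.pi * s) < 1 := by
  refine lt_of_le_of_ne (Real.cos_le_one _) fun h => h0 ?_
  have hpi := Real.pi_pos
  rw [Real.cos_eq_one_iff_of_lt_of_lt] at h
  · simpa [hpi.ne'] using h
  · nlinarith [hs.1]
  · nlinarith [hs.2]

lemma peak_nonneg (y : ℝ × ℝ) : 0 ≤ peak y :=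
  mul_nonneg (by linarith [Real.neg_one_le_cos (phase (1, 0) y + 0)])
    (by linarith [Real.neg_one_le_cos (phase (0, 1) y + 0)])

lemma peak_zero : peak 0 = 1 := by
  norm_num [peak, phase]

lemma peak_lt {y : ℝ × ℝ} (hy : y ∈ centredCell) (h0 : y ≠ 0) : peak y < 1 := by
  have e1 : phase (1, 0) y + 0 = 2 * Real.pi * y.1 := by simp [phase]
  have e2 : phase (0, 1) y + 0 = 2 * Real.pi * y.2 := by simp [phase]
  unfold peak
  rw [e1, e2]
  have a1 := Real.cos_le_one (2 * Real.pi * y.1)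
  have a2 := Real.cos_le_one (2 * Real.pi * y.2)
  have b1 := Real.neg_one_le_cos (2 * Real.pi * y.1)
  have b2 := Real.neg_one_le_cos (2 * Real.pi * y.2)
  by_cases h1 : y.1 = 0
  · have h2 : y.2 ≠ 0 := fun h => h0 (Prod.ext h1 h)
    have := cos_two_pi_lt_one hy.2 h2
    nlinarith
  · have := cos_two_pi_lt_one hy.1 h1
    nlinarith

/-- High powers of `peak` concentrate at its unique maximum. The first moment is the quantity that
bounds the error of convolving a Lipschitz function. -/
lemma tendsto_peak_moment : Filter.Tendsto (fun n : ℕ => (∫ y in centredCell, peak y ^ n)⁻¹ •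
    ∫ y in centredCell, peak y ^ n • ‖y‖) Filter.atTop (nhds 0) := by
  have h := tendsto_setIntegral_pow_smul_of_unique_maximum_of_isCompact_of_continuousOn
    (μ := (volume : Measure (ℝ × ℝ))) (x₀ := 0) (c := peak) (g := fun y : ℝ × ℝ => ‖y‖)
    isCompact_centredCell (trigPoly_props peak_mem_trigPoly).1.continuousOn
    (fun y hy h0 => by rw [peak_zero]; exact peak_lt hy h0) (fun y _ => peak_nonneg y)
    (by rw [peak_zero]; exact one_pos)
    (by
      refine subset_closure ?_
      rw [centredCell, interior_prod_eq, interior_Icc]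
      simp)
    continuous_norm.continuousOn
  simpa using h

lemma setIntegral_peak_pow_pos (n : ℕ) : 0 < ∫ y in centredCell, peak y ^ n := by
  have hc : Continuous fun y => peak y ^ n := (trigPoly_props peak_mem_trigPoly).1.pow n
  refine (setIntegral_pos_iff_support_of_nonneg_ae
    (Filter.Eventually.of_forall fun y => pow_nonneg (peak_nonneg y) n)
    (hc.continuousOn.integrableOn_compact isCompact_centredCell)).2 ?_
  have hi : (0 : ℝ × ℝ) ∈ interior centredCell := by
    rw [centredCell, interior_prod_eq, interior_Icc]
    simp
  have ho : IsOpen (Function.support (fun y => peak y ^ n) ∩ interior centredCell) :=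
    hc.isOpen_support.inter isOpen_interior
  refine lt_of_lt_of_le (ho.measure_pos volume ⟨0, ?_, hi⟩)
    (measure_mono (inter_subset_inter_right _ interior_subset))
  simp [peak_zero]

/-- The normalised peak kernels, an approximate identity. -/
noncomputable def peakKernel (n : ℕ) : ℝ × ℝ → ℝ :=
  centredCell.indicator fun y => (∫ y in centredCell, peak y ^ n)⁻¹ * peak y ^ n

lemma measurableSet_centredCell : MeasurableSet centredCell :=
  isCompact_centredCell.measurableSet

lemma integrable_peakKernel (n : ℕ) : Integrable (peakKernel n) := by
  have hc : Continuous fun y => peak y ^ n := (trigPoly_props peak_mem_trigPoly).1.pow n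
  exact (((continuous_const.mul hc).continuousOn).integrableOn_compact
    isCompact_centredCell).integrable_indicator measurableSet_centredCell

lemma integral_peakKernel_mul (n : ℕ) (F : ℝ × ℝ → ℝ) : ∫ y, peakKernel n y * F y
    = (∫ y in centredCell, peak y ^ n)⁻¹ * ∫ y in centredCell, peak y ^ n * F y := by
  rw [← integral_const_mul, ← integral_indicator measurableSet_centredCell]
  refine integral_congr_ae (Filter.Eventually.of_forall fun y => ?_)
  by_cases hy : y ∈ centredCell <;> simp [peakKernel, hy, mul_assoc]

/-- The kernel lives on one cell of `ℝ²`, but against a periodic function that cell can be replaced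
by any other. The result is thus a convolution on the torus with a trigonometric polynomial. -/
lemma corr_peakKernel_mem_trigSpan (n : ℕ) (u : TestFun) :
    corr (peakKernel n) (integrable_peakKernel n) u ∈ trigSpan := by
  have hw := Submodule.smul_mem _ (∫ y in centredCell, peak y ^ n)⁻¹
    (pow_mem_trigPoly peak_mem_trigPoly n)
  have hp := trigPoly_props (pow_mem_trigPoly peak_mem_trigPoly n)
  obtain ⟨v, hv, e⟩ := exists_trigSpan_convolution hw u
  convert hv
  ext x
  rw [e]
  change ∫ y, peakKernel n y * (u : ℝ × ℝ → ℝ) (x + y) = _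
  rw [integral_peakKernel_mul]
  have hP : IsPeriodic fun y => peak y ^ n * (u : ℝ × ℝ → ℝ) (y + x) :=
    IsPeriodic.mul (G := fun y => peak y ^ n) hp.2 ((testFun_periodic u).comp_add x)
  have hC : Continuous fun y => peak y ^ n * (u : ℝ × ℝ → ℝ) (y + x) :=
    Continuous.mul (f := fun y => peak y ^ n) hp.1 ((testFun_continuous u).comp (by fun_prop))
  simp only [add_comm x]
  rw [hP.setIntegral_centredCell hC, ← hP.setIntegral_add hC (-x)]
  simp only [Pi.smul_apply, smul_eq_mul, mul_assoc, Pi.pow_apply]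
  rw [integral_const_mul]
  simp [sub_eq_add_neg]

lemma exists_lipschitz_testFun (u : TestFun) :
    ∃ L : ℝ, 0 ≤ L ∧ ∀ x y, |(u : ℝ × ℝ → ℝ) (x + y) - (u : ℝ × ℝ → ℝ) x| ≤ L * ‖y‖ := by
  obtain ⟨L, hL⟩ := (testFun_periodic u).fderiv.exists_bound
    (u.2.1.continuous_fderiv (by simp))
  refine ⟨L, (norm_nonneg _).trans (hL 0), fun x y => ?_⟩
  have := convex_univ.norm_image_sub_le_of_norm_fderiv_le (𝕜 := ℝ) (f := (u : ℝ × ℝ → ℝ))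
    (fun z _ => differentiable_testFun u z) (fun z _ => hL z) (mem_univ x) (mem_univ (x + y))
  simpa using this

lemma abs_corr_peakKernel_sub_le (n : ℕ) (u : TestFun) {L : ℝ}
    (hL : ∀ x y, |(u : ℝ × ℝ → ℝ) (x + y) - (u : ℝ × ℝ → ℝ) x| ≤ L * ‖y‖) (x : ℝ × ℝ) :
    |((corr (peakKernel n) (integrable_peakKernel n) u - u : TestFun) : ℝ × ℝ → ℝ) x|
      ≤ L * ((∫ y in centredCell, peak y ^ n)⁻¹ • ∫ y in centredCell, peak y ^ n • ‖y‖) := by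
  have h0 : ∫ y, peakKernel n y = 1 := by
    have := integral_peakKernel_mul n 1
    simp only [Pi.one_apply, mul_one] at this
    rw [this, inv_mul_cancel₀ (setIntegral_peak_pow_pos n).ne']
  have hint := integrable_translates (integrable_peakKernel n) (τ := fun y => y)
    (testFun_continuous u) (testFun_periodic u) stronglyMeasurable_id x
  have hnn : ∀ y, 0 ≤ peakKernel n y := fun y =>
    indicator_nonneg (fun y _ => mul_nonneg (inv_nonneg.2 (setIntegral_peak_pow_pos n).le)
      (pow_nonneg (peak_nonneg y) n)) y
  have e : ((corr (peakKernel n) (integrable_peakKernel n) u - u : TestFun) : ℝ × ℝ → ℝ) x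
      = ∫ y, peakKernel n y * ((u : ℝ × ℝ → ℝ) (x + y) - (u : ℝ × ℝ → ℝ) x) := by
    simp only [mul_sub]
    simp only [smul_eq_mul] at hint
    rw [integral_sub hint ((integrable_peakKernel n).mul_const _), integral_mul_const, h0, one_mul]
    rfl
  have e2 : L * ((∫ y in centredCell, peak y ^ n)⁻¹ • ∫ y in centredCell, peak y ^ n • ‖y‖)
      = ∫ y, peakKernel n y * (L * ‖y‖) := by
    simp only [mul_left_comm (peakKernel n _) L]
    rw [integral_const_mul, integral_peakKernel_mul]
    rfl
  rw [e, e2]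
  refine norm_integral_le_of_norm_le (f := fun y => peakKernel n y *
    ((u : ℝ × ℝ → ℝ) (x + y) - (u : ℝ × ℝ → ℝ) x)) ?_ (Filter.Eventually.of_forall fun y => ?_)
  · have hc : Continuous fun y : ℝ × ℝ => (∫ y in centredCell, peak y ^ n)⁻¹ * peak y ^ n *
        (L * ‖y‖) := by
      have := (trigPoly_props peak_mem_trigPoly).1
      fun_prop
    refine ((hc.continuousOn.integrableOn_compact isCompact_centredCell).integrable_indicator
      measurableSet_centredCell).congr (Filter.Eventually.of_forall fun y => ?_)
    by_cases hy : y ∈ centredCell <;> simp [peakKernel, hy]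
  · rw [norm_mul, Real.norm_of_nonneg (hnn y)]
    exact mul_le_mul_of_nonneg_left (hL x y) (hnn y)

/-! ### Uniqueness from Fourier coefficients. -/

lemma iterate_pd_corr (w : ℝ × ℝ → ℝ) (hw : Integrable w) (j l : ℕ) (u : TestFun) :
    pd1^[j] (pd2^[l] (corr w hw u)) = corr w hw (pd1^[j] (pd2^[l] u)) := by
  have h2 : pd2^[l] (corr w hw u) = corr w hw (pd2^[l] u) :=
    (Function.Semiconj.iterate_right (f := corr w hw)
      (fun v => (corr_dirDeriv w hw (0, 1) v).symm) l u).symm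
  have h1 : pd1^[j] (corr w hw (pd2^[l] u)) = corr w hw (pd1^[j] (pd2^[l] u)) :=
    (Function.Semiconj.iterate_right (f := corr w hw)
      (fun v => (corr_dirDeriv w hw (1, 0) v).symm) j _).symm
  rw [h2, h1]

/-- A periodic distribution is determined by its values on the trigonometric functions. -/
lemma eq_zero_of_trig (f : PeriodicDistribution) (hf : ∀ k φ, f.1 (trig k φ) = 0) (u : TestFun) :
    f.1 u = 0 := by
  have hspan : ∀ v ∈ trigSpan, f.1 v = 0 := by
    intro v hv
    have : trigSpan ≤ LinearMap.ker f.1 := by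
      rw [trigSpan, Submodule.span_le]
      rintro _ ⟨⟨k, φ⟩, rfl⟩
      exact hf k φ
    exact this hv
  obtain ⟨C, N, hC⟩ := f.2
  choose L hL0 hL using exists_lipschitz_testFun
  -- A common Lipschitz constant for the finitely many derivatives that enter the seminorm
  -- controlling `f`. As the convolution commutes with derivatives, all of them converge at the same
  -- rate, which gives convergence in that seminorm.
  let L' : ℝ := ∑ j ∈ Finset.range (N + 1), ∑ l ∈ Finset.range (N + 1), L (pd1^[j] (pd2^[l] u))
  have hL' : ∀ j l, j + l ≤ N → L (pd1^[j] (pd2^[l] u)) ≤ L' := by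
    intro j l hjl
    refine le_trans ?_ (Finset.single_le_sum (f := fun j => ∑ l ∈ Finset.range (N + 1),
      L (pd1^[j] (pd2^[l] u))) (fun j _ => Finset.sum_nonneg fun l _ => hL0 _)
      (Finset.mem_range.2 (by omega : j < N + 1)))
    exact Finset.single_le_sum (f := fun l => L (pd1^[j] (pd2^[l] u))) (fun l _ => hL0 _)
      (Finset.mem_range.2 (by omega : l < N + 1))
  have hb : ∀ n : ℕ, |f.1 u| ≤ C * (L' * ((∫ y in centredCell, peak y ^ n)⁻¹ •
      ∫ y in centredCell, peak y ^ n • ‖y‖)) := by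
    intro n
    have h1 : f.1 (corr (peakKernel n) (integrable_peakKernel n) u - u) = -f.1 u := by
      rw [map_sub, hspan _ (corr_peakKernel_mem_trigSpan n u), zero_sub]
    rw [← abs_neg, ← h1]
    refine hC _ _ fun j l hjl x => ?_
    rw [iterate_map_sub, iterate_map_sub, iterate_pd_corr]
    refine abs_corr_peakKernel_sub_le n _ (fun x y => (hL _ x y).trans ?_) x
    exact mul_le_mul_of_nonneg_right (hL' j l hjl) (norm_nonneg _)
  have hlim := (tendsto_peak_moment.const_mul L').const_mul C
  simp only [mul_zero] at hlim
  exact abs_nonpos_iff.1 (ge_of_tendsto' hlim hb)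

lemma continuous_mul_testFun {h : ℝ × ℝ → ℝ} (hc : Continuous h) (u : TestFun) :
    Continuous fun x => h x * (u : ℝ × ℝ → ℝ) x := hc.mul (testFun_continuous u)

lemma integrableOn_mul_testFun {h : ℝ × ℝ → ℝ} (hc : Continuous h) (u : TestFun) :
    IntegrableOn (fun x => h x * (u : ℝ × ℝ → ℝ) x) unitCell :=
  integrableOn_unitCell (continuous_mul_testFun hc u)

/-! ### Hölder bounds -/

lemma anisoDist_nonneg (x y : ℝ × ℝ) : 0 ≤ anisoDist x y :=
  add_nonneg (abs_nonneg _) (Real.rpow_nonneg (abs_nonneg _) _)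

lemma anisoDist_self (x : ℝ × ℝ) : anisoDist x x = 0 := by simp [anisoDist]

lemma continuous_anisoDist : Continuous fun z : (ℝ × ℝ) × (ℝ × ℝ) => anisoDist z.1 z.2 := by
  unfold anisoDist
  refine Continuous.add (by fun_prop) (Continuous.rpow_const (by fun_prop) fun _ => ?_)
  right
  norm_num

lemma anisoDist_pos {x y : ℝ × ℝ} (h : x ≠ y) : 0 < anisoDist x y := by
  unfold anisoDist
  by_cases h1 : x.1 = y.1
  · have h2 : x.2 ≠ y.2 := fun h2 => h (Prod.ext h1 h2)
    exact add_pos_of_nonneg_of_pos (abs_nonneg _)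
      (Real.rpow_pos_of_pos (abs_pos.2 (sub_ne_zero.2 h2)) _)
  · exact add_pos_of_pos_of_nonneg (abs_pos.2 (sub_ne_zero.2 h1))
      (Real.rpow_nonneg (abs_nonneg _) _)

lemma anisoDist_sub_right (x y z : ℝ × ℝ) : anisoDist (x - z) (y - z) = anisoDist x y := by
  simp [anisoDist]

/-- `g` is a periodic function with Hölder seminorm `[g]_α ≤ B`. -/
structure HolderBound (α B : ℝ) (g : ℝ × ℝ → ℝ) : Prop where
  periodic : IsPeriodic g
  le : ∀ x y, |g y - g x| ≤ B * anisoDist y x ^ α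

lemma HolderBound.continuous {α B : ℝ} {g : ℝ × ℝ → ℝ} (hg : HolderBound α B g) (hα : 0 < α) :
    Continuous g := by
  refine continuous_iff_continuousAt.2 fun x => ?_
  have hd : Continuous fun y => B * anisoDist y x ^ α :=
    continuous_const.mul (Continuous.rpow_const
      (continuous_anisoDist.comp (continuous_id.prodMk continuous_const)) fun _ => Or.inr hα.le)
  have h0 := hd.tendsto x
  rw [anisoDist_self, Real.zero_rpow hα.ne', mul_zero] at h0
  rw [ContinuousAt, tendsto_iff_dist_tendsto_zero]
  exact squeeze_zero (fun _ => dist_nonneg) (fun y => hg.le x y) h0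

lemma HolderBound.mono {α B B' : ℝ} {g : ℝ × ℝ → ℝ} (hg : HolderBound α B g) (h : B ≤ B') :
    HolderBound α B' g :=
  ⟨hg.periodic, fun x y => (hg.le x y).trans
    (mul_le_mul_of_nonneg_right h (Real.rpow_nonneg (anisoDist_nonneg _ _) _))⟩

lemma HolderBound.holderPos_le {α B : ℝ} {g : ℝ × ℝ → ℝ} (hg : HolderBound α B g) (hα : α ≤ 1) :
    holderPos α g ≤ ENNReal.ofReal B := by
  rw [holderPos, if_pos hα]
  refine iSup_le fun x => iSup_le fun y => iSup_le fun h => ENNReal.ofReal_le_ofReal ?_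
  rw [div_le_iff₀ (Real.rpow_pos_of_pos (anisoDist_pos h.symm) _)]
  exact hg.le x y

/-- The distributional identity `f = c + ∂₁² g + ∂₂ h`. -/
def Represents (c : ℝ) (g h : ℝ × ℝ → ℝ) (f : PeriodicDistribution) : Prop :=
  ∀ u : TestFun, f.1 u = c * (∫ x in unitCell, (u : ℝ × ℝ → ℝ) x)
        + (∫ x in unitCell, g x * (pd1 (pd1 u) : ℝ × ℝ → ℝ) x)
        - (∫ x in unitCell, h x * (pd2 u : ℝ × ℝ → ℝ) x)

/-- `f = c + ∂₁² g + ∂₂ h` for some `c`, `g`, `h` with `|c|`, `[g]_α`, `[h]_β` at most `B`. -/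
def HasRep (α β B : ℝ) (f : PeriodicDistribution) : Prop :=
  ∃ c g h, |c| ≤ B ∧ HolderBound α B g ∧ HolderBound β B h ∧ Represents c g h f

/-- Since `-5/4 - ε < -1`, the seminorm is the one defined with `∂₁²`, and its exponents are `-5/4 -
ε + 2` and `-5/4 - ε + 3/2`. The factor `3` counts the three summands. -/
lemma HasRep.holderNeg_le {ε B : ℝ} (hε : 0 < ε) (hB : 0 ≤ B) {f : PeriodicDistribution}
    (hf : HasRep (3 / 4 - ε) (1 / 4 - ε) B f) :
    holderNeg (-(5 / 4) - ε) f ≤ ENNReal.ofReal (3 * B) := by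
  obtain ⟨c, g, h, hc, hg, hh, hr⟩ := hf
  rw [holderNeg, if_neg (by linarith)]
  refine iInf_le_of_le c <| iInf_le_of_le g <| iInf_le_of_le h <| iInf_le_of_le hg.periodic <|
    iInf_le_of_le hh.periodic <| iInf_le_of_le hr ?_
  rw [show -(5 / 4) - ε + 2 = 3 / 4 - ε by ring, show -(5 / 4) - ε + 3 / 2 = 1 / 4 - ε by ring,
    show 3 * B = B + B + B by ring, ENNReal.ofReal_add (by positivity) hB,
    ENNReal.ofReal_add hB hB]
  exact add_le_add (add_le_add (ENNReal.ofReal_le_ofReal hc) (hg.holderPos_le (by linarith)))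
    (hh.holderPos_le (by linarith))

/-! ### The projection of a representation -/

lemma setIntegral_unitCell_symm {G : ℝ × ℝ → ℝ} (hG : Continuous G) :
    ∫ z in unitCell, G z = ∫ t in Ico (0 : ℝ) 1, ∫ s in Ico (0 : ℝ) 1, G (s, t) := by
  have h := integrableOn_unitCell hG
  rw [IntegrableOn, unitCell, Measure.volume_eq_prod, ← Measure.prod_restrict] at h
  rw [unitCell, Measure.volume_eq_prod, ← Measure.prod_restrict, integral_prod_symm _ h]

/-- The average of `h` in the first variable. -/
noncomputable def avgFst (h : ℝ × ℝ → ℝ) (x : ℝ × ℝ) : ℝ := ∫ s in Ico (0 : ℝ) 1, h (s, x.2)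

lemma integral_mul_avg1 {h : ℝ × ℝ → ℝ} (hc : Continuous h) (ha : Continuous (avgFst h))
    (v : TestFun) :
    ∫ x in unitCell, h x * (avg1 v : ℝ × ℝ → ℝ) x
      = ∫ x in unitCell, avgFst h x * (v : ℝ × ℝ → ℝ) x := by
  rw [setIntegral_unitCell_symm (continuous_mul_testFun hc _),
    setIntegral_unitCell_symm (continuous_mul_testFun ha _)]
  refine integral_congr_ae (Filter.Eventually.of_forall fun t => ?_)
  have e1 : ∀ s, (avg1 v : ℝ × ℝ → ℝ) (s, t) = ∫ s in Ico (0 : ℝ) 1, (v : ℝ × ℝ → ℝ) (s, t) :=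
    fun s => rfl
  simp only [e1, avgFst]
  rw [integral_mul_const, integral_const_mul]

lemma integrableOn_slice {h : ℝ × ℝ → ℝ} (hc : Continuous h) (t : ℝ) :
    IntegrableOn (fun s => h (s, t)) (Ico 0 1) :=
  ((hc.comp (by fun_prop : Continuous fun s : ℝ => (s, t))).continuousOn.integrableOn_compact
    isCompact_Icc).mono_set Ico_subset_Icc_self

/-- Both averages are compared at the same first coordinate, which only shortens the anisotropic
distance. -/
lemma HolderBound.avgFst {α B : ℝ} {h : ℝ × ℝ → ℝ} (hh : HolderBound α B h) (hB : 0 ≤ B)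
    (hα : 0 < α) : HolderBound α B (avgFst h) := by
  have hc := hh.continuous hα
  refine ⟨⟨fun x => by simp [WhiteNoiseTorus.avgFst], fun x => ?_⟩, fun x y => ?_⟩
  · refine integral_congr_ae (Filter.Eventually.of_forall fun s => ?_)
    simpa using hh.periodic.2 (s, x.2)
  · unfold WhiteNoiseTorus.avgFst
    rw [← integral_sub (integrableOn_slice hc _) (integrableOn_slice hc _)]
    have := norm_setIntegral_le_of_norm_le_const (μ := (volume : Measure ℝ)) (s := Ico (0 : ℝ) 1)
      (f := fun s => h (s, y.2) - h (s, x.2)) (C := B * anisoDist y x ^ α) (by simp) ?_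
    · simpa [measureReal_def] using this
    · intro s _
      refine (hh.le (s, x.2) (s, y.2)).trans (mul_le_mul_of_nonneg_left ?_ hB)
      refine Real.rpow_le_rpow (anisoDist_nonneg _ _) ?_ hα.le
      simp [anisoDist]

lemma HolderBound.sub {α B B' : ℝ} {g h : ℝ × ℝ → ℝ} (hg : HolderBound α B g)
    (hh : HolderBound α B' h) : HolderBound α (B + B') (fun x => g x - h x) := by
  refine ⟨⟨fun x => by simp only [hg.periodic.1 x, hh.periodic.1 x],
    fun x => by simp only [hg.periodic.2 x, hh.periodic.2 x]⟩, fun x y => ?_⟩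
  calc |g y - h y - (g x - h x)| = |(g y - g x) - (h y - h x)| := by ring_nf
    _ ≤ |g y - g x| + |h y - h x| := abs_sub _ _
    _ ≤ (B + B') * anisoDist y x ^ α := by linarith [hg.le x y, hh.le x y]

/-- Averaging in `x₁` commutes with `∂₂` and annihilates `∂₁²g`. So `P` removes the constant, keeps
`g` and subtracts from `h` its average, which at most doubles the bound. -/
lemma HasRep.proj {α β B : ℝ} (hα : 0 < α) (hβ : 0 < β) (hB : 0 ≤ B) {f : PeriodicDistribution}
    (hf : HasRep α β B f) : HasRep α β (2 * B) (proj f) := by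
  obtain ⟨c, g, h, hc, hg, hh, hr⟩ := hf
  have hgc := hg.continuous hα
  have hhc := hh.continuous hβ
  have ha := hh.avgFst hB hβ
  have hac := ha.continuous hβ
  refine ⟨0, g, fun x => h x - WhiteNoiseTorus.avgFst h x, by simpa using hB,
    hg.mono (by linarith), by simpa [two_mul] using hh.sub ha, fun u => ?_⟩
  have e : (WhiteNoiseTorus.proj f).1 u = f.1 (u - avg1 u) := rfl
  have h1 : ∫ x in unitCell, ((u - avg1 u : TestFun) : ℝ × ℝ → ℝ) x = 0 := by
    have h2 := integral_mul_avg1 (h := fun _ => 1) continuous_const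
      (by unfold WhiteNoiseTorus.avgFst; exact continuous_const) u
    simp only [one_mul, WhiteNoiseTorus.avgFst] at h2
    simp only [Submodule.coe_sub, Pi.sub_apply]
    rw [integral_sub (integrableOn_unitCell (testFun_continuous _))
      (integrableOn_unitCell (testFun_continuous _)), h2]
    simp
  have h3 : pd1 (pd1 (u - avg1 u)) = pd1 (pd1 u) := by
    rw [map_sub, pd1_avg1, sub_zero]
  have h4 : ∫ x in unitCell, h x * (pd2 (u - avg1 u) : ℝ × ℝ → ℝ) x
      = ∫ x in unitCell, (h x - WhiteNoiseTorus.avgFst h x) * (pd2 u : ℝ × ℝ → ℝ) x := by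
    rw [map_sub, pd2_avg1]
    simp only [Submodule.coe_sub, Pi.sub_apply, mul_sub, sub_mul]
    rw [integral_sub (integrableOn_mul_testFun hhc _)
      (integrableOn_mul_testFun hhc _),
      integral_sub (integrableOn_mul_testFun hhc _)
      (integrableOn_mul_testFun hac _), integral_mul_avg1 hhc hac]
  rw [e, hr, h1, h3, h4]
  ring

/-! ### Convolution of a representation -/

/-- The convolution `w * g`. -/
noncomputable def smear (w g : ℝ × ℝ → ℝ) (x : ℝ × ℝ) : ℝ := ∫ y, w y * g (x - y)

lemma integrable_smear {w g : ℝ × ℝ → ℝ} (hw : Integrable w) (hg : Continuous g)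
    (hp : IsPeriodic g) (x : ℝ × ℝ) : Integrable fun y => w y * g (x - y) := by
  obtain ⟨b, hb⟩ := hp.exists_bound hg
  exact hw.mul_bdd (hg.comp (by fun_prop)).aestronglyMeasurable
    (Filter.Eventually.of_forall fun y => hb _)

lemma isPeriodic_smear {w g : ℝ × ℝ → ℝ} (hp : IsPeriodic g) : IsPeriodic (smear w g) := by
  constructor
  · intro x
    simp only [smear, add_sub_right_comm x, hp.1 (x - _)]
  · intro x
    simp only [smear, add_sub_right_comm x, hp.2 (x - _)]

/-- Fubini, and for each fixed `y` a translation on the torus. -/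
lemma integral_mul_corr {w g : ℝ × ℝ → ℝ} (hw : Integrable w) (hg : Continuous g)
    (hp : IsPeriodic g) (v : TestFun) :
    ∫ x in unitCell, g x * (corr w hw v : ℝ × ℝ → ℝ) x
      = ∫ x in unitCell, smear w g x * (v : ℝ × ℝ → ℝ) x := by
  have hv := testFun_continuous v
  obtain ⟨b, hb⟩ := hp.exists_bound hg
  obtain ⟨b', hb'⟩ := (testFun_periodic v).exists_bound hv
  have hb0 : 0 ≤ b := (norm_nonneg _).trans (hb 0)
  have hw2 := hw.comp_snd ((volume : Measure (ℝ × ℝ)).restrict unitCell)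
  have i1 : Integrable (Function.uncurry fun x y => w y * (g x * (v : ℝ × ℝ → ℝ) (x + y)))
      (((volume : Measure (ℝ × ℝ)).restrict unitCell).prod volume) := by
    refine hw2.mul_bdd (c := b * b') (Continuous.aestronglyMeasurable (by fun_prop))
      (Filter.Eventually.of_forall fun z => ?_)
    rw [norm_mul]
    exact mul_le_mul (hb _) (hb' _) (norm_nonneg _) hb0
  have i2 : Integrable (Function.uncurry fun x y => w y * (g (x - y) * (v : ℝ × ℝ → ℝ) x))
      (((volume : Measure (ℝ × ℝ)).restrict unitCell).prod volume) := by
    refine hw2.mul_bdd (c := b * b') (Continuous.aestronglyMeasurable (by fun_prop))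
      (Filter.Eventually.of_forall fun z => ?_)
    rw [norm_mul]
    exact mul_le_mul (hb _) (hb' _) (norm_nonneg _) hb0
  have e1 : ∀ x, g x * (corr w hw v : ℝ × ℝ → ℝ) x
      = ∫ y, w y * (g x * (v : ℝ × ℝ → ℝ) (x + y)) := fun x => by
    rw [show (corr w hw v : ℝ × ℝ → ℝ) x = ∫ y, w y * (v : ℝ × ℝ → ℝ) (x + y) from rfl,
      ← integral_const_mul]
    simp only [mul_left_comm (g x)]
  have e2 : ∀ x, smear w g x * (v : ℝ × ℝ → ℝ) x
      = ∫ y, w y * (g (x - y) * (v : ℝ × ℝ → ℝ) x) := fun x => by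
    rw [smear, ← integral_mul_const]
    simp only [mul_assoc]
  simp only [e1, e2]
  rw [integral_integral_swap i1, integral_integral_swap i2]
  refine integral_congr_ae (Filter.Eventually.of_forall fun y => ?_)
  simp only
  rw [integral_const_mul, integral_const_mul]
  congr 1
  have hP : IsPeriodic fun x => g (x + -y) * (v : ℝ × ℝ → ℝ) x :=
    (hp.comp_add (-y)).mul (testFun_periodic v)
  have := hP.setIntegral_add (by fun_prop) y
  simp only [add_neg_cancel_right] at this
  rw [this]
  simp only [sub_eq_add_neg]

lemma integral_corr {w : ℝ × ℝ → ℝ} (hw : Integrable w) (v : TestFun) :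
    ∫ x in unitCell, (corr w hw v : ℝ × ℝ → ℝ) x
      = (∫ y, w y) * ∫ x in unitCell, (v : ℝ × ℝ → ℝ) x := by
  have := integral_mul_corr hw (g := fun _ => 1) continuous_const ⟨fun _ => rfl, fun _ => rfl⟩ v
  simp only [one_mul, smear, mul_one] at this
  rw [this, integral_const_mul]

lemma Represents.conv {c : ℝ} {g h w : ℝ × ℝ → ℝ} {f : PeriodicDistribution}
    (hr : Represents c g h f) (hw : Integrable w) (hg : Continuous g) (hgp : IsPeriodic g)
    (hh : Continuous h) (hhp : IsPeriodic h) :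
    Represents (c * ∫ y, w y) (smear w g) (smear w h) (conv w hw f) := by
  intro u
  have e : (WhiteNoiseTorus.conv w hw f).1 u = f.1 (corr w hw u) := rfl
  have e1 : pd1 (pd1 (corr w hw u)) = corr w hw (pd1 (pd1 u)) := by
    rw [pd1, corr_dirDeriv, corr_dirDeriv]
  have e2 : pd2 (corr w hw u) = corr w hw (pd2 u) := corr_dirDeriv w hw (0, 1) u
  rw [e, hr, e1, e2, integral_mul_corr hw hg hgp, integral_mul_corr hw hh hhp, integral_corr]
  ring

lemma HolderBound.smear {α B : ℝ} {g w : ℝ × ℝ → ℝ} (hg : HolderBound α B g) (hα : 0 < α)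
    (hw : Integrable w) : HolderBound α ((∫ y, |w y|) * B) (smear w g) := by
  have hc := hg.continuous hα
  refine ⟨isPeriodic_smear hg.periodic, fun x y => ?_⟩
  unfold WhiteNoiseTorus.smear
  rw [← integral_sub (integrable_smear hw hc hg.periodic _)
    (integrable_smear hw hc hg.periodic _), mul_assoc, ← integral_mul_const]
  refine norm_integral_le_of_norm_le (f := fun z => w z * g (y - z) - w z * g (x - z))
    (hw.norm.mul_const (B * anisoDist y x ^ α)) (Filter.Eventually.of_forall fun z => ?_)
  rw [← mul_sub, norm_mul]
  refine mul_le_mul_of_nonneg_left ?_ (norm_nonneg _)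
  have := hg.le (x - z) (y - z)
  rwa [anisoDist_sub_right] at this

lemma HasRep.conv {α β B : ℝ} (hα : 0 < α) (hβ : 0 < β) {f : PeriodicDistribution}
    (hf : HasRep α β B f) {w : ℝ × ℝ → ℝ} (hw : Integrable w) :
    HasRep α β ((∫ y, |w y|) * B) (conv w hw f) := by
  obtain ⟨c, g, h, hc, hg, hh, hr⟩ := hf
  refine ⟨_, _, _, ?_, hg.smear hα hw, hh.smear hβ hw, hr.conv hw (hg.continuous hα) hg.periodic
    (hh.continuous hβ) hh.periodic⟩
  rw [abs_mul, mul_comm]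
  exact mul_le_mul (abs_integral_le_integral_abs) hc (abs_nonneg _)
    (integral_nonneg fun _ => abs_nonneg _)

lemma HolderBound.abs_smear_sub_le {α B : ℝ} {g w : ℝ × ℝ → ℝ} (hg : HolderBound α B g)
    (hα : 0 < α) (hw : Integrable w) (h1 : ∫ y, w y = 1)
    (hm : Integrable fun y => |w y| * anisoDist y 0 ^ α) (x : ℝ × ℝ) :
    |WhiteNoiseTorus.smear w g x - g x| ≤ B * ∫ y, |w y| * anisoDist y 0 ^ α := by
  have e : WhiteNoiseTorus.smear w g x - g x = ∫ y, w y * (g (x - y) - g x) := by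
    simp only [mul_sub]
    rw [integral_sub (integrable_smear hw (hg.continuous hα) hg.periodic x) (hw.mul_const _),
      integral_mul_const, h1, one_mul]
    rfl
  rw [e, ← integral_const_mul]
  refine norm_integral_le_of_norm_le (f := fun y => w y * (g (x - y) - g x)) (hm.const_mul B)
    (Filter.Eventually.of_forall fun y => ?_)
  rw [norm_mul, Real.norm_eq_abs, Real.norm_eq_abs, mul_left_comm]
  refine mul_le_mul_of_nonneg_left ?_ (abs_nonneg _)
  have := hg.le x (x - y)
  have e2 : anisoDist (x - y) x = anisoDist y 0 := by simp [anisoDist]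
  rwa [e2] at this

/-- Interpolation at the scale `ℓ`. At distances `d ≤ ℓ` use the Hölder bounds of `g` and of its
mollification with `d^α ≤ ℓ^δ d^(α-δ)`. At distances `d ≥ ℓ` use the uniform error of order `ℓ^α` at
both points with `ℓ^α ≤ ℓ^δ d^(α-δ)`. -/
lemma HolderBound.smear_sub {α δ B ℓ K M : ℝ} {g w : ℝ × ℝ → ℝ} (hg : HolderBound α B g)
    (hB : 0 ≤ B) (hδ : 0 ≤ δ) (hδα : δ < α) (hℓ : 0 < ℓ) (hw : Integrable w)
    (h1 : ∫ y, w y = 1) (hK : ∫ y, |w y| ≤ K)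
    (hm : Integrable fun y => |w y| * anisoDist y 0 ^ α)
    (hM : ∫ y, |w y| * anisoDist y 0 ^ α ≤ ℓ ^ α * M) :
    HolderBound (α - δ) ((K + 1 + 2 * M) * (ℓ ^ δ * B))
      (fun x => WhiteNoiseTorus.smear w g x - g x) := by
  have hα : 0 < α := hδ.trans_lt hδα
  have hK0 : 0 ≤ K := (integral_nonneg fun _ => abs_nonneg _).trans hK
  have hM0 : 0 ≤ M := by
    have : 0 ≤ ℓ ^ α * M := le_trans (integral_nonneg fun y =>
      mul_nonneg (abs_nonneg _) (Real.rpow_nonneg (anisoDist_nonneg _ _) _)) hM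
    exact nonneg_of_mul_nonneg_right this (Real.rpow_pos_of_pos hℓ α)
  have hs := (hg.smear hα hw).sub hg
  refine ⟨hs.periodic, fun x y => ?_⟩
  set d := anisoDist y x with hd
  have hd0 : 0 ≤ d := anisoDist_nonneg _ _
  have hdα := Real.rpow_nonneg hd0 (α - δ)
  have hℓδ := Real.rpow_nonneg hℓ.le δ
  rcases le_total d ℓ with h | h
  · refine (hs.le x y).trans ?_
    rw [← hd]
    have e : d ^ α ≤ ℓ ^ δ * d ^ (α - δ) := by
      rcases hd0.eq_or_lt with h0 | h0
      · rw [← h0, Real.zero_rpow hα.ne']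
        exact mul_nonneg hℓδ (Real.rpow_nonneg le_rfl _)
      · calc d ^ α = d ^ δ * d ^ (α - δ) := by rw [← Real.rpow_add h0]; congr 1; ring
          _ ≤ _ := by gcongr
    calc ((∫ y, |w y|) * B + B) * d ^ α ≤ (K * B + B) * (ℓ ^ δ * d ^ (α - δ)) := by gcongr
      _ = (K + 1) * (ℓ ^ δ * B) * d ^ (α - δ) := by ring
      _ ≤ _ := mul_le_mul_of_nonneg_right (mul_le_mul_of_nonneg_right (by linarith)
          (mul_nonneg hℓδ hB)) hdα
  · have a1 := hg.abs_smear_sub_le hα hw h1 hm x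
    have a2 := hg.abs_smear_sub_le hα hw h1 hm y
    have e : ℓ ^ α ≤ ℓ ^ δ * d ^ (α - δ) := by
      calc ℓ ^ α = ℓ ^ δ * ℓ ^ (α - δ) := by rw [← Real.rpow_add hℓ]; congr 1; ring
        _ ≤ _ := by
          refine mul_le_mul_of_nonneg_left (Real.rpow_le_rpow hℓ.le h (by linarith)) hℓδ
    calc _ ≤ |WhiteNoiseTorus.smear w g y - g y| + |WhiteNoiseTorus.smear w g x - g x| :=
          abs_sub _ _
      _ ≤ 2 * (B * (ℓ ^ δ * d ^ (α - δ) * M)) := by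
          have := mul_le_mul_of_nonneg_left
            (hM.trans (mul_le_mul_of_nonneg_right e hM0)) hB
          linarith
      _ = (2 * M) * (ℓ ^ δ * B) * d ^ (α - δ) := by ring
      _ ≤ _ := mul_le_mul_of_nonneg_right (mul_le_mul_of_nonneg_right (by linarith)
          (mul_nonneg hℓδ hB)) hdα

/-! ### The rescaled kernels -/

lemma integral_comp_scale {F : ℝ × ℝ → ℝ} (hF : Continuous F) {a b : ℝ} (ha : 0 < a) (hb : 0 < b) :
    ∫ x : ℝ × ℝ, F (x.1 / a, x.2 / b) = a * b * ∫ x, F x := by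
  have h := Measure.map_prod_map (volume : Measure ℝ) (volume : Measure ℝ)
    (measurable_const_mul a⁻¹) (measurable_const_mul b⁻¹)
  rw [Real.map_volume_mul_left (inv_ne_zero ha.ne'), Real.map_volume_mul_left
    (inv_ne_zero hb.ne'), Measure.prod_smul_left, Measure.prod_smul_right, inv_inv, inv_inv,
    abs_of_pos ha, abs_of_pos hb, ← Measure.volume_eq_prod] at h
  have h2 := integral_map (μ := (volume : Measure (ℝ × ℝ)))
    (φ := Prod.map (a⁻¹ * ·) (b⁻¹ * ·)) (f := F) (by fun_prop) hF.aestronglyMeasurable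
  rw [← h, integral_smul_measure, integral_smul_measure, ENNReal.toReal_ofReal ha.le,
    ENNReal.toReal_ofReal hb.le] at h2
  simp only [div_eq_inv_mul, mul_assoc]
  exact h2.symm

/-- The anisotropic distance is homogeneous of degree one under the scaling of the kernel, because
`(ℓ^(3/2))^(2/3) = ℓ`. -/
lemma anisoDist_scale {ℓ : ℝ} (hℓ : 0 < ℓ) (y : ℝ × ℝ) :
    anisoDist y 0 = ℓ * anisoDist (y.1 / ℓ, y.2 / ℓ ^ (3 / 2 : ℝ)) 0 := by
  have h : (0 : ℝ) < ℓ ^ (3 / 2 : ℝ) := Real.rpow_pos_of_pos hℓ _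
  simp only [anisoDist, Prod.fst_zero, Prod.snd_zero, sub_zero, abs_div, abs_of_pos hℓ, abs_of_pos h]
  rw [Real.div_rpow (abs_nonneg _) h.le, ← Real.rpow_mul hℓ.le]
  norm_num
  field_simp

lemma rpow_scale_mul {ℓ : ℝ} (hℓ : 0 < ℓ) : ℓ * ℓ ^ (3 / 2 : ℝ) = ℓ ^ (5 / 2 : ℝ) := by
  nth_rw 1 [← Real.rpow_one ℓ]
  rw [← Real.rpow_add hℓ]
  norm_num

lemma integral_rescale (φ : 𝓢(ℝ × ℝ, ℝ)) {ℓ : ℝ} (hℓ : 0 < ℓ) :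
    ∫ x, rescale φ ℓ x = ∫ x, φ x := by
  unfold rescale
  have h : (0 : ℝ) < ℓ ^ (5 / 2 : ℝ) := Real.rpow_pos_of_pos hℓ _
  rw [integral_const_mul, integral_comp_scale φ.continuous hℓ (Real.rpow_pos_of_pos hℓ _),
    rpow_scale_mul hℓ]
  field_simp

lemma integral_abs_rescale_mul (φ : 𝓢(ℝ × ℝ, ℝ)) {ℓ α : ℝ} (hℓ : 0 < ℓ) (hα : 0 ≤ α) :
    ∫ x, |rescale φ ℓ x| * anisoDist x 0 ^ α = ℓ ^ α * ∫ x, |φ x| * anisoDist x 0 ^ α := by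
  have h : (0 : ℝ) < ℓ ^ (5 / 2 : ℝ) := Real.rpow_pos_of_pos hℓ _
  have hd : Continuous fun x : ℝ × ℝ => anisoDist x 0 ^ α :=
    (continuous_anisoDist.comp (continuous_id.prodMk continuous_const)).rpow_const
      fun _ => Or.inr hα
  have e : ∀ x, |rescale φ ℓ x| * anisoDist x 0 ^ α = (1 / ℓ ^ (5 / 2 : ℝ) * ℓ ^ α) *
      (fun z => |φ z| * anisoDist z 0 ^ α) (x.1 / ℓ, x.2 / ℓ ^ (3 / 2 : ℝ)) := fun x => by
    rw [anisoDist_scale hℓ x, Real.mul_rpow hℓ.le (anisoDist_nonneg _ _), rescale, abs_mul,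
      abs_of_pos (by positivity : 0 < 1 / ℓ ^ (5 / 2 : ℝ))]
    ring
  simp only [e]
  rw [integral_const_mul, integral_comp_scale (F := fun z => |φ z| * anisoDist z 0 ^ α)
    (φ.continuous.abs.mul hd) hℓ (Real.rpow_pos_of_pos hℓ _), rpow_scale_mul hℓ]
  field_simp

lemma rpow_le_one_add {s a : ℝ} (hs : 0 ≤ s) (ha : 0 ≤ a) (ha1 : a ≤ 1) : s ^ a ≤ 1 + s := by
  rcases le_total s 1 with h | h
  · exact (Real.rpow_le_one hs h ha).trans (by linarith)
  · exact ((Real.rpow_le_rpow_of_exponent_le h ha1).trans (by rw [Real.rpow_one])).trans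
      (by linarith)

lemma anisoDist_rpow_le {α : ℝ} (hα : 0 ≤ α) (hα1 : α ≤ 1) (x : ℝ × ℝ) :
    anisoDist x 0 ^ α ≤ 2 + 2 * ‖x‖ := by
  have h1 : |x.1| ≤ ‖x‖ := norm_fst_le x
  have h2 : |x.2| ≤ ‖x‖ := norm_snd_le x
  have h3 := rpow_le_one_add (abs_nonneg x.2) (by norm_num : (0 : ℝ) ≤ 2 / 3) (by norm_num)
  refine (rpow_le_one_add (anisoDist_nonneg _ _) hα hα1).trans ?_
  simp only [anisoDist, Prod.fst_zero, Prod.snd_zero, sub_zero]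
  linarith

lemma integrable_moment (φ : 𝓢(ℝ × ℝ, ℝ)) {α : ℝ} (hα : 0 ≤ α) (hα1 : α ≤ 1) :
    Integrable fun x => |φ x| * anisoDist x 0 ^ α := by
  have hd : Continuous fun x : ℝ × ℝ => anisoDist x 0 ^ α :=
    (continuous_anisoDist.comp (continuous_id.prodMk continuous_const)).rpow_const
      fun _ => Or.inr hα
  have i0 := (φ.integrable (μ := volume)).norm.const_mul 2
  have i1 := (φ.integrable_pow_mul volume 1).const_mul 2
  refine (i0.add i1).mono' (φ.continuous.abs.mul hd).aestronglyMeasurable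
    (Filter.Eventually.of_forall fun x => ?_)
  have hn : 0 ≤ anisoDist x 0 ^ α := Real.rpow_nonneg (anisoDist_nonneg _ _) _
  rw [Real.norm_of_nonneg (mul_nonneg (abs_nonneg _) hn)]
  have := mul_le_mul_of_nonneg_left (anisoDist_rpow_le hα hα1 x) (abs_nonneg (φ x))
  simp only [Pi.add_apply, pow_one, Real.norm_eq_abs] at this ⊢
  linarith

lemma integrable_rescale_moment (φ : 𝓢(ℝ × ℝ, ℝ)) {ℓ α : ℝ} (hℓ : 0 < ℓ) (hα : 0 ≤ α)
    (hα1 : α ≤ 1) : Integrable fun x => |rescale φ ℓ x| * anisoDist x 0 ^ α := by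
  have hd : Continuous fun x : ℝ × ℝ => anisoDist x 0 ^ α :=
    (continuous_anisoDist.comp (continuous_id.prodMk continuous_const)).rpow_const
      fun _ => Or.inr hα
  -- The scaling identity for the integrals already implies integrability: a function that is not
  -- integrable has integral `0` by default. This leaves the case of a vanishing moment, in which
  -- the continuous nonnegative integrand is identically zero.
  by_cases h : ∫ x, |φ x| * anisoDist x 0 ^ α = 0
  · have h0 : (fun x => |φ x| * anisoDist x 0 ^ α) = 0 := by
      refine (Continuous.ae_eq_iff_eq volume (φ.continuous.abs.mul hd) continuous_const).1 ?_
      exact (integral_eq_zero_iff_of_nonneg (fun x => mul_nonneg (abs_nonneg _)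
        (Real.rpow_nonneg (anisoDist_nonneg _ _) _)) (integrable_moment φ hα hα1)).1 h
    have e : (fun x => |rescale φ ℓ x| * anisoDist x 0 ^ α) = fun _ => 0 := by
      funext x
      have := congrFun h0 (x.1 / ℓ, x.2 / ℓ ^ (3 / 2 : ℝ))
      simp only [Pi.zero_apply] at this
      rw [anisoDist_scale hℓ x, Real.mul_rpow hℓ.le (anisoDist_nonneg _ _), rescale, abs_mul]
      linear_combination (|1 / ℓ ^ (5 / 2 : ℝ)| * ℓ ^ α) * this
    rw [e]
    exact integrable_zero _ _ _
  · refine not_imp_comm.1 integral_undef ?_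
    rw [integral_abs_rescale_mul φ hℓ hα]
    exact mul_ne_zero (Real.rpow_pos_of_pos hℓ _).ne' h

lemma integral_abs_rescale (φ : 𝓢(ℝ × ℝ, ℝ)) {ℓ : ℝ} (hℓ : 0 < ℓ) :
    ∫ x, |rescale φ ℓ x| = ∫ x, |φ x| := by
  simpa using integral_abs_rescale_mul φ hℓ le_rfl

/-- The bound is uniform in `ℓ`, since the rescaling preserves the `L¹` norm of the kernel. -/
lemma HasRep.proj_mollify {α β B : ℝ} (hα : 0 < α) (hβ : 0 < β) (hB : 0 ≤ B)
    {f : PeriodicDistribution} (hf : HasRep α β B f) (φ : 𝓢(ℝ × ℝ, ℝ)) {ℓ : ℝ} (hℓ : 0 < ℓ) :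
    HasRep α β (2 * ((∫ y, |φ y|) * B)) (WhiteNoiseTorus.proj (mollify φ ℓ hℓ f)) := by
  have := hf.conv hα hβ (integrable_rescale φ hℓ)
  rw [integral_abs_rescale φ hℓ] at this
  exact this.proj hα hβ (mul_nonneg (integral_nonneg fun _ => abs_nonneg _) hB)

/-- The constant in the rate of convergence of mollifications. -/
noncomputable def mollifyConst (φ : 𝓢(ℝ × ℝ, ℝ)) (α β : ℝ) : ℝ :=
  (∫ y, |φ y|) + 1 + 2 * ((∫ y, |φ y| * anisoDist y 0 ^ α) + ∫ y, |φ y| * anisoDist y 0 ^ β)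

lemma integral_moment_nonneg (φ : 𝓢(ℝ × ℝ, ℝ)) (α : ℝ) :
    0 ≤ ∫ y, |φ y| * anisoDist y 0 ^ α :=
  integral_nonneg fun _ => mul_nonneg (abs_nonneg _) (Real.rpow_nonneg (anisoDist_nonneg _ _) _)

lemma mollifyConst_nonneg (φ : 𝓢(ℝ × ℝ, ℝ)) (α β : ℝ) : 0 ≤ mollifyConst φ α β := by
  have h1 := integral_moment_nonneg φ α
  have h2 := integral_moment_nonneg φ β
  have h3 : 0 ≤ ∫ y, |φ y| := integral_nonneg fun _ => abs_nonneg _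
  unfold mollifyConst
  positivity

/-- The constant cancels because the kernel has integral one, and the mollification error falls on
`g` and `h` separately. -/
lemma HasRep.mollify_sub {α β δ B : ℝ} (hδ : 0 ≤ δ) (hα : δ < α) (hα1 : α ≤ 1) (hβ : δ < β)
    (hβ1 : β ≤ 1) (hB : 0 ≤ B) {f : PeriodicDistribution} (hf : HasRep α β B f)
    (φ : 𝓢(ℝ × ℝ, ℝ)) (hφ : ∫ x, φ x = 1) {ℓ : ℝ} (hℓ : 0 < ℓ) :
    HasRep (α - δ) (β - δ) (mollifyConst φ α β * (ℓ ^ δ * B)) (mollify φ ℓ hℓ f - f) := by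
  obtain ⟨c, g, h, hc, hg, hh, hr⟩ := hf
  have hα0 := hδ.trans_lt hα
  have hβ0 := hδ.trans_lt hβ
  have hw := integrable_rescale φ hℓ
  have h1 : ∫ y, rescale φ ℓ y = 1 := by rw [integral_rescale φ hℓ, hφ]
  have hℓδ : 0 ≤ ℓ ^ δ * B := mul_nonneg (Real.rpow_nonneg hℓ.le _) hB
  have mα := integral_moment_nonneg φ α
  have mβ := integral_moment_nonneg φ β
  have hgc := hg.continuous hα0
  have hhc := hh.continuous hβ0
  have rg := hg.smear_sub hB hδ hα hℓ hw h1 (integral_abs_rescale φ hℓ).le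
    (integrable_rescale_moment φ hℓ hα0.le hα1) (integral_abs_rescale_mul φ hℓ hα0.le).le
  have rh := hh.smear_sub hB hδ hβ hℓ hw h1 (integral_abs_rescale φ hℓ).le
    (integrable_rescale_moment φ hℓ hβ0.le hβ1) (integral_abs_rescale_mul φ hℓ hβ0.le).le
  refine ⟨0, _, _, ?_, rg.mono ?_, rh.mono ?_, fun u => ?_⟩
  · rw [abs_zero]
    exact mul_nonneg (mollifyConst_nonneg φ α β) hℓδ
  · refine mul_le_mul_of_nonneg_right ?_ hℓδ
    unfold mollifyConst
    linarith
  · refine mul_le_mul_of_nonneg_right ?_ hℓδ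
    unfold mollifyConst
    linarith
  · have hm := hr.conv hw hgc hg.periodic hhc hh.periodic u
    have sg := (hg.smear hα0 hw).continuous hα0
    have sh := (hh.smear hβ0 hw).continuous hβ0
    have e : (mollify φ ℓ hℓ f - f).1 u = (WhiteNoiseTorus.conv (rescale φ ℓ) hw f).1 u - f.1 u :=
      rfl
    rw [e, hm, hr u, h1]
    simp only [sub_mul]
    rw [integral_sub (integrableOn_mul_testFun sg _)
      (integrableOn_mul_testFun hgc _),
      integral_sub (integrableOn_mul_testFun sh _)
      (integrableOn_mul_testFun hhc _)]
    ring

/-! ### Trigonometric fields built from a distribution -/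

/-- The test function `y ↦ ∑ k ∈ S, a k cos (2π k·(x - y) + φ)`. -/
noncomputable def fieldTest (S : Finset (ℤ × ℤ)) (a : ℤ × ℤ → ℝ) (φ : ℝ) (x : ℝ × ℝ) : TestFun :=
  ∑ k ∈ S, a k • trig k (-(phase k x + φ))

/-- The field `x ↦ f(y ↦ ∑ k ∈ S, a k cos (2π k·(x - y) + φ))`, a Fourier multiplier of `f`. -/
noncomputable def field (f : PeriodicDistribution) (S : Finset (ℤ × ℤ)) (a : ℤ × ℤ → ℝ) (φ : ℝ)
    (x : ℝ × ℝ) : ℝ :=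
  ∑ k ∈ S, a k * f.1 (trig k (-(phase k x + φ)))

lemma apply_fieldTest (f : PeriodicDistribution) (S : Finset (ℤ × ℤ)) (a : ℤ × ℤ → ℝ) (φ : ℝ)
    (x : ℝ × ℝ) : f.1 (fieldTest S a φ x) = field f S a φ x := by
  simp [fieldTest, field, map_sum]

lemma apply_trig (f : PeriodicDistribution) (k : ℤ × ℤ) (φ : ℝ) :
    f.1 (trig k φ) = Real.cos φ * f.1 (trig k 0) + Real.sin φ * f.1 (trig k (Real.pi / 2)) := by
  rw [trig_eq k φ, map_add, map_smul, map_smul, smul_eq_mul, smul_eq_mul]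

lemma apply_trig_neg (f : PeriodicDistribution) (k : ℤ × ℤ) (θ : ℝ) :
    f.1 (trig k (-θ)) = Real.cos θ * f.1 (trig k 0)
      + Real.cos (θ + Real.pi / 2) * f.1 (trig k (Real.pi / 2)) := by
  rw [apply_trig, Real.cos_neg, Real.sin_neg, Real.cos_add_pi_div_two]

lemma field_eq (f : PeriodicDistribution) (S : Finset (ℤ × ℤ)) (a : ℤ × ℤ → ℝ) (φ : ℝ)
    (x : ℝ × ℝ) : field f S a φ x = ∑ k ∈ S, a k * (Real.cos (phase k x + φ) * f.1 (trig k 0)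
      + Real.cos (phase k x + (φ + Real.pi / 2)) * f.1 (trig k (Real.pi / 2))) := by
  unfold field
  refine Finset.sum_congr rfl fun k _ => ?_
  rw [apply_trig_neg, add_assoc]

lemma field_mul_coef (f : PeriodicDistribution) (S : Finset (ℤ × ℤ)) (c : ℝ) (a : ℤ × ℤ → ℝ)
    (φ : ℝ) (x : ℝ × ℝ) : field f S (fun k => c * a k) φ x = c * field f S a φ x := by
  simp only [field, Finset.mul_sum, mul_assoc]

lemma field_congr (f : PeriodicDistribution) {S : Finset (ℤ × ℤ)} {a b : ℤ × ℤ → ℝ}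
    (h : ∀ k ∈ S, a k = b k) (φ : ℝ) (x : ℝ × ℝ) : field f S a φ x = field f S b φ x :=
  Finset.sum_congr rfl fun k hk => by rw [h k hk]

lemma isPeriodic_field (f : PeriodicDistribution) (S : Finset (ℤ × ℤ)) (a : ℤ × ℤ → ℝ) (φ : ℝ) :
    IsPeriodic (field f S a φ) := by
  constructor
  · intro x
    rw [field_eq, field_eq]
    refine Finset.sum_congr rfl fun k _ => ?_
    have h : ∀ θ, Real.cos (phase k (x + (1, 0)) + θ) = Real.cos (phase k x + θ) :=
      fun θ => (isPeriodic_cos_phase k θ).1 x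
    rw [h, h]
  · intro x
    rw [field_eq, field_eq]
    refine Finset.sum_congr rfl fun k _ => ?_
    have h : ∀ θ, Real.cos (phase k (x + (0, 1)) + θ) = Real.cos (phase k x + θ) :=
      fun θ => (isPeriodic_cos_phase k θ).2 x
    rw [h, h]

lemma continuous_field (f : PeriodicDistribution) (S : Finset (ℤ × ℤ)) (a : ℤ × ℤ → ℝ) (φ : ℝ) :
    Continuous (field f S a φ) := by
  have : field f S a φ = fun x => ∑ k ∈ S, a k * (Real.cos (phase k x + φ) * f.1 (trig k 0)
      + Real.cos (phase k x + (φ + Real.pi / 2)) * f.1 (trig k (Real.pi / 2))) :=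
    funext fun x => field_eq f S a φ x
  rw [this]
  exact continuous_finsetSum _ fun k _ => continuous_const.mul
    (((continuous_cos_phase k _).mul continuous_const).add
      ((continuous_cos_phase k _).mul continuous_const))

/-- Testing with the mode `l` sees the terms `k = l` and `k = -l` of the field, each with weight one
half. For symmetric `S` they combine when the parity of the multiplier matches the phase: even with
`0`, odd with `-π/2`. -/
lemma integral_field_mul_trig (f : PeriodicDistribution) (S : Finset (ℤ × ℤ)) (a : ℤ × ℤ → ℝ)
    (φ : ℝ) (l : ℤ × ℤ) (ψ : ℝ) :
    ∫ x in unitCell, field f S a φ x * (trig l ψ : ℝ × ℝ → ℝ) x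
      = (if l ∈ S then a l * f.1 (trig l (ψ - φ)) / 2 else 0)
        + (if -l ∈ S then a (-l) * f.1 (trig l (ψ + φ)) / 2 else 0) := by
  have e : ∀ x, field f S a φ x * (trig l ψ : ℝ × ℝ → ℝ) x = ∑ k ∈ S,
      (a k * f.1 (trig k 0) * (Real.cos (phase k x + φ) * Real.cos (phase l x + ψ))
        + a k * f.1 (trig k (Real.pi / 2)) * (Real.cos (phase k x + (φ + Real.pi / 2)) *
          Real.cos (phase l x + ψ))) := fun x => by
    rw [field_eq, Finset.sum_mul]
    refine Finset.sum_congr rfl fun k _ => ?_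
    rw [trig_apply]
    ring
  have hi : ∀ (k : ℤ × ℤ) (c θ : ℝ), IntegrableOn (fun x => c *
      (Real.cos (phase k x + θ) * Real.cos (phase l x + ψ))) unitCell := fun k c θ =>
    integrableOn_unitCell (continuous_const.mul
      ((continuous_cos_phase k θ).mul (continuous_cos_phase l ψ)))
  simp only [e]
  rw [integral_finsetSum]
  swap
  · exact fun k _ => (hi k _ _).add (hi k _ _)
  have e2 : ∀ k ∈ S, ∫ x in unitCell,
      (a k * f.1 (trig k 0) * (Real.cos (phase k x + φ) * Real.cos (phase l x + ψ))
        + a k * f.1 (trig k (Real.pi / 2)) * (Real.cos (phase k x + (φ + Real.pi / 2)) *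
          Real.cos (phase l x + ψ)))
      = (if k = l then a l * f.1 (trig l (ψ - φ)) / 2 else 0)
        + (if k = -l then a (-l) * f.1 (trig l (ψ + φ)) / 2 else 0) := by
    intro k _
    rw [integral_add (hi k _ _) (hi k _ _), integral_const_mul, integral_const_mul,
      integral_cos_phase_mul, integral_cos_phase_mul]
    have h1 : k = l → a k * f.1 (trig k 0) * (Real.cos (φ - ψ) / 2)
        + a k * f.1 (trig k (Real.pi / 2)) * (Real.cos (φ + Real.pi / 2 - ψ) / 2)
        = a l * f.1 (trig l (ψ - φ)) / 2 := by
      rintro rfl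
      rw [show ψ - φ = -(φ - ψ) by ring, apply_trig_neg,
        show φ + Real.pi / 2 - ψ = φ - ψ + Real.pi / 2 by ring]
      ring
    have h2 : k = -l → a k * f.1 (trig k 0) * (Real.cos (φ + ψ) / 2)
        + a k * f.1 (trig k (Real.pi / 2)) * (Real.cos (φ + Real.pi / 2 + ψ) / 2)
        = a (-l) * f.1 (trig l (ψ + φ)) / 2 := by
      rintro rfl
      rw [show trig l (ψ + φ) = trig (-l) (-(φ + ψ)) by rw [trig_neg, neg_neg, add_comm],
        apply_trig_neg, show φ + Real.pi / 2 + ψ = φ + ψ + Real.pi / 2 by ring]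
      ring
    by_cases c1 : k = l <;> by_cases c2 : k = -l
    · simp only [if_pos c1, if_pos c2]
      rw [← h1 c1, ← h2 c2]
      ring
    · simp only [if_pos c1, if_neg c2]
      rw [← h1 c1]
      ring
    · simp only [if_neg c1, if_pos c2]
      rw [← h2 c2]
      ring
    · simp only [if_neg c1, if_neg c2]
      ring
  rw [Finset.sum_congr rfl e2, Finset.sum_add_distrib, Finset.sum_ite_eq', Finset.sum_ite_eq']

lemma integral_field_mul_trig_of_even (f : PeriodicDistribution) {S : Finset (ℤ × ℤ)}
    (hS : ∀ k, -k ∈ S ↔ k ∈ S) {a : ℤ × ℤ → ℝ} (ha : ∀ k, a (-k) = a k) (l : ℤ × ℤ) (ψ : ℝ) :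
    ∫ x in unitCell, field f S a 0 x * (trig l ψ : ℝ × ℝ → ℝ) x
      = if l ∈ S then a l * f.1 (trig l ψ) else 0 := by
  rw [integral_field_mul_trig]
  simp only [hS, ha, sub_zero, add_zero]
  split_ifs <;> ring

lemma integral_field_mul_trig_of_odd (f : PeriodicDistribution) {S : Finset (ℤ × ℤ)}
    (hS : ∀ k, -k ∈ S ↔ k ∈ S) {a : ℤ × ℤ → ℝ} (ha : ∀ k, a (-k) = -a k) (l : ℤ × ℤ) (ψ : ℝ) :
    ∫ x in unitCell, field f S a (-(Real.pi / 2)) x * (trig l ψ : ℝ × ℝ → ℝ) x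
      = if l ∈ S then a l * f.1 (trig l (ψ + Real.pi / 2)) else 0 := by
  rw [integral_field_mul_trig]
  simp only [hS, ha, sub_neg_eq_add]
  have e : f.1 (trig l (ψ + Real.pi / 2)) = -f.1 (trig l (ψ + -(Real.pi / 2))) := by
    rw [← map_neg, ← trig_add_pi]
    congr 2
    ring
  rw [e]
  split_ifs <;> ring

lemma integral_fieldTest_sq_le (S : Finset (ℤ × ℤ)) (a : ℤ × ℤ → ℝ) (φ : ℝ) (x : ℝ × ℝ) :
    ∫ y in unitCell, (fieldTest S a φ x : ℝ × ℝ → ℝ) y ^ 2 ≤ ∑ k ∈ S, a k ^ 2 := by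
  set ψ : ℤ × ℤ → ℝ := fun k => -(phase k x + φ)
  have e : ∀ y, (fieldTest S a φ x : ℝ × ℝ → ℝ) y ^ 2 = ∑ k ∈ S, ∑ l ∈ S, a k * a l *
      (Real.cos (phase k y + ψ k) * Real.cos (phase l y + ψ l)) := fun y => by
    have : (fieldTest S a φ x : ℝ × ℝ → ℝ) y = ∑ k ∈ S, a k * Real.cos (phase k y + ψ k) := by
      simp [fieldTest, Finset.sum_apply, trig_apply, ψ]
    rw [this, sq, Finset.sum_mul_sum]
    refine Finset.sum_congr rfl fun k _ => Finset.sum_congr rfl fun l _ => ?_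
    ring
  have hi : ∀ k l, IntegrableOn (fun y => a k * a l *
      (Real.cos (phase k y + ψ k) * Real.cos (phase l y + ψ l))) unitCell := fun k l =>
    integrableOn_unitCell (continuous_const.mul
      ((continuous_cos_phase k _).mul (continuous_cos_phase l _)))
  simp only [e]
  rw [integral_finsetSum _ fun k _ => integrable_finsetSum _ fun l _ => hi k l]
  -- The resonance `k = l` contributes `a l ^ 2 / 2`. The resonance `k = -l` has an uncontrolled
  -- cosine and is estimated by `|a k * a l| / 2 ≤ (a k ^ 2 + a l ^ 2) / 4`. Summation gives the
  -- total weight `1/2 + 1/4 + 1/4 = 1`.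
  have hle : ∀ k ∈ S, ∫ y in unitCell, ∑ l ∈ S, a k * a l *
      (Real.cos (phase k y + ψ k) * Real.cos (phase l y + ψ l))
      ≤ ∑ l ∈ S, ((if k = l then a l ^ 2 / 2 else 0) + ((if k = -l then a l ^ 2 / 4 else 0)
        + (if k = -l then a k ^ 2 / 4 else 0))) := by
    intro k _
    rw [integral_finsetSum _ fun l _ => hi k l]
    refine Finset.sum_le_sum fun l _ => ?_
    rw [integral_const_mul, integral_cos_phase_mul, mul_add]
    refine add_le_add ?_ ?_
    · split_ifs with h
      · rw [h, sub_self, Real.cos_zero]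
        linarith
      · simp
    · split_ifs with h
      · have h1 := abs_le.1 (Real.abs_cos_le_one (ψ k + ψ l))
        nlinarith [sq_nonneg (a k + a l), sq_nonneg (a k - a l)]
      · simp
  refine (Finset.sum_le_sum hle).trans ?_
  simp only [Finset.sum_add_distrib]
  have s1 : ∑ k ∈ S, ∑ l ∈ S, (if k = l then a l ^ 2 / 2 else 0) = ∑ k ∈ S, a k ^ 2 / 2 := by
    refine Finset.sum_congr rfl fun k hk => ?_
    rw [Finset.sum_ite_eq, if_pos hk]
  have s2 : ∑ k ∈ S, ∑ l ∈ S, (if k = -l then a l ^ 2 / 4 else 0) ≤ ∑ k ∈ S, a k ^ 2 / 4 := by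
    rw [Finset.sum_comm]
    refine Finset.sum_le_sum fun l _ => ?_
    rw [Finset.sum_ite_eq']
    split_ifs
    · exact le_rfl
    · positivity
  have s3 : ∑ k ∈ S, ∑ l ∈ S, (if k = -l then a k ^ 2 / 4 else 0) ≤ ∑ k ∈ S, a k ^ 2 / 4 := by
    refine Finset.sum_le_sum fun k _ => ?_
    simp only [eq_neg_iff_add_eq_zero, add_comm k]
    simp only [← eq_neg_iff_add_eq_zero]
    rw [Finset.sum_ite_eq']
    split_ifs
    · exact le_rfl
    · positivity
  have s4 : ∑ k ∈ S, a k ^ 2 = ∑ k ∈ S, a k ^ 2 / 2 + (∑ k ∈ S, a k ^ 2 / 4 + ∑ k ∈ S, a k ^ 2 / 4) := by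
    rw [← Finset.sum_add_distrib, ← Finset.sum_add_distrib]
    refine Finset.sum_congr rfl fun k _ => ?_
    ring
  rw [s4, s1]
  linarith

/-! ### Derivatives and Lipschitz bounds of the fields. -/

lemma hasDerivAt_field_fst (f : PeriodicDistribution) (S : Finset (ℤ × ℤ)) (a : ℤ × ℤ → ℝ) (φ : ℝ)
    (s t : ℝ) : HasDerivAt (fun s => field f S a φ (s, t))
      (field f S (fun k => 2 * Real.pi * k.1 * a k) (φ + Real.pi / 2) (s, t)) s := by
  simp only [field_eq]
  refine HasDerivAt.fun_sum fun k _ => ?_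
  have hp : ∀ θ, HasDerivAt (fun s => phase k (s, t) + θ) (2 * Real.pi * k.1) s := fun θ => by
    have := ((((hasDerivAt_id s).const_mul (k.1 : ℝ)).add_const ((k.2 : ℝ) * t)).const_mul
      (2 * Real.pi)).add_const θ
    simpa [phase] using this
  refine HasDerivAt.congr_deriv ((((hp φ).cos.mul_const (f.1 (trig k 0))).add
    ((hp (φ + Real.pi / 2)).cos.mul_const (f.1 (trig k (Real.pi / 2))))).const_mul (a k)) ?_
  simp only [← add_assoc, Real.cos_add_pi_div_two]
  ring

lemma hasDerivAt_field_snd (f : PeriodicDistribution) (S : Finset (ℤ × ℤ)) (a : ℤ × ℤ → ℝ) (φ : ℝ)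
    (s t : ℝ) : HasDerivAt (fun t => field f S a φ (s, t))
      (field f S (fun k => 2 * Real.pi * k.2 * a k) (φ + Real.pi / 2) (s, t)) t := by
  simp only [field_eq]
  refine HasDerivAt.fun_sum fun k _ => ?_
  have hp : ∀ θ, HasDerivAt (fun t => phase k (s, t) + θ) (2 * Real.pi * k.2) t := fun θ => by
    have := ((((hasDerivAt_id t).const_mul (k.2 : ℝ)).const_add ((k.1 : ℝ) * s)).const_mul
      (2 * Real.pi)).add_const θ
    simpa [phase] using this
  refine HasDerivAt.congr_deriv ((((hp φ).cos.mul_const (f.1 (trig k 0))).add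
    ((hp (φ + Real.pi / 2)).cos.mul_const (f.1 (trig k (Real.pi / 2))))).const_mul (a k)) ?_
  simp only [← add_assoc, Real.cos_add_pi_div_two]
  ring

lemma abs_field_sub_le (f : PeriodicDistribution) (S : Finset (ℤ × ℤ)) (a : ℤ × ℤ → ℝ) (φ : ℝ)
    {D₁ D₂ : ℝ}
    (h₁ : ∀ x, |field f S (fun k => 2 * Real.pi * k.1 * a k) (φ + Real.pi / 2) x| ≤ D₁)
    (h₂ : ∀ x, |field f S (fun k => 2 * Real.pi * k.2 * a k) (φ + Real.pi / 2) x| ≤ D₂)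
    (x y : ℝ × ℝ) :
    |field f S a φ y - field f S a φ x| ≤ D₁ * |y.1 - x.1| + D₂ * |y.2 - x.2| := by
  have b1 := convex_univ.norm_image_sub_le_of_norm_hasDerivWithin_le (𝕜 := ℝ)
    (f := fun s => field f S a φ (s, y.2)) (x := x.1) (y := y.1) (C := D₁)
    (fun s _ => (hasDerivAt_field_fst f S a φ s y.2).hasDerivWithinAt) (fun s _ => h₁ _)
    (mem_univ _) (mem_univ _)
  have b2 := convex_univ.norm_image_sub_le_of_norm_hasDerivWithin_le (𝕜 := ℝ)
    (f := fun t => field f S a φ (x.1, t)) (x := x.2) (y := y.2) (C := D₂)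
    (fun t _ => (hasDerivAt_field_snd f S a φ x.1 t).hasDerivWithinAt) (fun t _ => h₂ _)
    (mem_univ _) (mem_univ _)
  simp only [Real.norm_eq_abs] at b1 b2
  calc |field f S a φ y - field f S a φ x|
      = |(field f S a φ (y.1, y.2) - field f S a φ (x.1, y.2))
        + (field f S a φ (x.1, y.2) - field f S a φ (x.1, x.2))| := by simp
    _ ≤ _ := (abs_add_le _ _).trans (add_le_add b1 b2)

/-! ### Anisotropic dyadic shells -/

/-- The frequencies with `|k₁| < 4^j` and `|k₂| < 8^j`. -/
noncomputable def freqBox (j : ℕ) : Finset (ℤ × ℤ) := Finset.Ioo (-4 ^ j) (4 ^ j) ×ˢ Finset.Ioo (-8 ^ j) (8 ^ j)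

lemma mem_freqBox {j : ℕ} {k : ℤ × ℤ} : k ∈ freqBox j ↔ |k.1| < 4 ^ j ∧ |k.2| < 8 ^ j := by
  simp [freqBox, abs_lt]

lemma card_freqBox_le (j : ℕ) : ((freqBox j).card : ℝ) ≤ 4 * 32 ^ j := by
  have h : ∀ m : ℕ, ((Finset.Ioo (-(m : ℤ)) m).card) ≤ 2 * m := fun m => by
    rw [Int.card_Ioo]
    omega
  have h4 := h (4 ^ j)
  have h8 := h (8 ^ j)
  push_cast at h4 h8
  have : (freqBox j).card ≤ (2 * 4 ^ j) * (2 * 8 ^ j) := by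
    rw [freqBox, Finset.card_product]
    exact Nat.mul_le_mul h4 h8
  calc ((freqBox j).card : ℝ) ≤ ((2 * 4 ^ j) * (2 * 8 ^ j) : ℕ) := by exact_mod_cast this
    _ = 4 * (4 * 8) ^ j := by push_cast; rw [mul_pow]; ring
    _ = _ := by norm_num

lemma freqBox_mono {i j : ℕ} (h : i ≤ j) : freqBox i ⊆ freqBox j := by
  intro k hk
  rw [mem_freqBox] at hk ⊢
  exact ⟨hk.1.trans_le (pow_le_pow_right₀ (by norm_num) h),
    hk.2.trans_le (pow_le_pow_right₀ (by norm_num) h)⟩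

/-- The shell of frequencies of parabolic size about `4^j`. -/
noncomputable def shell (j : ℕ) : Finset (ℤ × ℤ) := freqBox (j + 1) \ freqBox j

lemma neg_mem_shell (j : ℕ) (k : ℤ × ℤ) : -k ∈ shell j ↔ k ∈ shell j := by
  simp [shell, mem_freqBox]

lemma card_shell_le (j : ℕ) : ((shell j).card : ℝ) ≤ 4 * 32 ^ (j + 1) :=
  le_trans (by exact_mod_cast Finset.card_le_card Finset.sdiff_subset) (card_freqBox_le (j + 1))

lemma zero_notMem_shell (j : ℕ) : (0 : ℤ × ℤ) ∉ shell j := by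
  simp [shell, mem_freqBox]

lemma shell_nonempty (j : ℕ) : (shell j).Nonempty := by
  refine ⟨(4 ^ j, 0), ?_⟩
  rw [shell, Finset.mem_sdiff, mem_freqBox, mem_freqBox]
  have : (0 : ℤ) < 4 ^ j := by positivity
  refine ⟨⟨?_, by simp⟩, fun h => ?_⟩
  · simp only [abs_of_pos this, pow_succ]
    omega
  · simp [abs_of_pos this] at h

lemma exists_mem_shell {k : ℤ × ℤ} (hk : k ≠ 0) : ∃ j, k ∈ shell j := by
  have hex : ∃ j, k ∈ freqBox j := by
    refine ⟨k.1.natAbs + k.2.natAbs, mem_freqBox.2 ⟨?_, ?_⟩⟩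
    · have : k.1.natAbs + k.2.natAbs < 4 ^ (k.1.natAbs + k.2.natAbs) := Nat.lt_pow_self (by norm_num)
      have h2 : ((k.1.natAbs + k.2.natAbs : ℕ) : ℤ) < 4 ^ (k.1.natAbs + k.2.natAbs) := by
        exact_mod_cast this
      push_cast [Int.natCast_natAbs] at h2
      linarith [abs_nonneg k.1, abs_nonneg k.2]
    · have : k.1.natAbs + k.2.natAbs < 8 ^ (k.1.natAbs + k.2.natAbs) := Nat.lt_pow_self (by norm_num)
      have h2 : ((k.1.natAbs + k.2.natAbs : ℕ) : ℤ) < 8 ^ (k.1.natAbs + k.2.natAbs) := by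
        exact_mod_cast this
      push_cast [Int.natCast_natAbs] at h2
      linarith [abs_nonneg k.1, abs_nonneg k.2]
  classical
  have hspec := Nat.find_spec hex
  -- The box of index `0` contains only the frequency `0`, so the first box that contains `k` has a
  -- predecessor that does not.
  have h0 : Nat.find hex ≠ 0 := by
    intro h
    rw [h, mem_freqBox] at hspec
    refine hk (Prod.ext ?_ ?_)
    · simpa using hspec.1
    · simpa using hspec.2
  obtain ⟨j, hj⟩ := Nat.exists_eq_succ_of_ne_zero h0
  refine ⟨j, Finset.mem_sdiff.2 ⟨?_, Nat.find_min hex (by omega)⟩⟩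
  rw [hj] at hspec
  exact hspec

lemma shell_unique {i j : ℕ} {k : ℤ × ℤ} (hi : k ∈ shell i) (hj : k ∈ shell j) : i = j := by
  by_contra h
  rcases lt_or_gt_of_ne h with h | h
  · exact (Finset.mem_sdiff.1 hj).2 (freqBox_mono h (Finset.mem_sdiff.1 hi).1)
  · exact (Finset.mem_sdiff.1 hi).2 (freqBox_mono h (Finset.mem_sdiff.1 hj).1)

lemma shell_bounds {j : ℕ} {k : ℤ × ℤ} (hk : k ∈ shell j) :
    1 + |(k.1 : ℝ)| ≤ 4 ^ (j + 1) ∧ 1 + |(k.2 : ℝ)| ≤ 8 ^ (j + 1) := by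
  have h := mem_freqBox.1 (Finset.mem_sdiff.1 hk).1
  have h1 : |k.1| + 1 ≤ 4 ^ (j + 1) := h.1
  have h2 : |k.2| + 1 ≤ 8 ^ (j + 1) := h.2
  constructor
  · rw [add_comm]; exact_mod_cast h1
  · rw [add_comm]; exact_mod_cast h2

/-! ### Supremum bounds from values on a grid -/

lemma IsPeriodic.apply_fract {F : Type*} {G : ℝ × ℝ → F} (hG : IsPeriodic G) (x : ℝ × ℝ) :
    G (Int.fract x.1, Int.fract x.2) = G x := by
  have h1 : G (Int.fract x.1, Int.fract x.2) = G (x.1, Int.fract x.2) := by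
    have := (hG.periodic_fst (Int.fract x.2)).sub_int_mul_eq (x := x.1) ⌊x.1⌋
    rwa [mul_one] at this
  have h2 := (hG.periodic_snd x.1).sub_int_mul_eq (x := x.2) ⌊x.2⌋
  rw [mul_one] at h2
  rw [h1]
  exact h2

/-- The number of grid points per unit length for the shell `j`. -/
def gridSize (j : ℕ) : ℕ := 8192 ^ (j + 1)

/-- The grid points for the shell `j`. -/
noncomputable def gridPoint (j : ℕ) (q : Fin (gridSize j) × Fin (gridSize j)) : ℝ × ℝ :=
  ((q.1 : ℕ) / (gridSize j : ℝ), (q.2 : ℕ) / (gridSize j : ℝ))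

lemma gridSize_pos (j : ℕ) : 0 < gridSize j := by
  unfold gridSize
  positivity

lemma exists_fin_near {N : ℕ} (hN : 0 < N) {s : ℝ} (h0 : 0 ≤ s) (h1 : s < 1) :
    ∃ n : Fin N, |s - (n : ℕ) / (N : ℝ)| ≤ 1 / N := by
  have hN' : (0 : ℝ) < N := by exact_mod_cast hN
  have hs : 0 ≤ s * N := by positivity
  have hlt : ⌊s * N⌋₊ < N := by
    rw [Nat.floor_lt hs]
    nlinarith
  refine ⟨⟨⌊s * N⌋₊, hlt⟩, ?_⟩
  have a1 := Nat.floor_le hs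
  have a2 := Nat.lt_floor_add_one (s * N)
  have e : s - (⌊s * N⌋₊ : ℝ) / N = (s * N - ⌊s * N⌋₊) / N := by field_simp
  simp only
  rw [e, abs_of_nonneg (div_nonneg (by linarith) hN'.le)]
  exact div_le_div_of_nonneg_right (by linarith) hN'.le

lemma abs_apply_trig_sub_le (f : PeriodicDistribution) (k : ℤ × ℤ) (θ θ' : ℝ) :
    |f.1 (trig k (-θ)) - f.1 (trig k (-θ'))|
      ≤ |θ - θ'| * (|f.1 (trig k 0)| + |f.1 (trig k (Real.pi / 2))|) := by
  have hcos : ∀ s t, |Real.cos s - Real.cos t| ≤ |s - t| := fun s t => by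
    have := convex_univ.norm_image_sub_le_of_norm_hasDerivWithin_le (𝕜 := ℝ)
      (f := Real.cos) (x := t) (y := s) (C := 1)
      (fun s _ => (Real.hasDerivAt_cos s).hasDerivWithinAt)
      (fun s _ => by simpa using Real.abs_sin_le_one s) (mem_univ _) (mem_univ _)
    simpa using this
  rw [apply_trig_neg, apply_trig_neg]
  have h1 := hcos θ θ'
  have h2 := hcos (θ + Real.pi / 2) (θ' + Real.pi / 2)
  rw [add_sub_add_right_eq_sub] at h2
  calc _ = |(Real.cos θ - Real.cos θ') * f.1 (trig k 0) + (Real.cos (θ + Real.pi / 2)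
        - Real.cos (θ' + Real.pi / 2)) * f.1 (trig k (Real.pi / 2))| := by ring_nf
    _ ≤ |θ - θ'| * |f.1 (trig k 0)| + |θ - θ'| * |f.1 (trig k (Real.pi / 2))| := by
      refine (abs_add_le _ _).trans ?_
      rw [abs_mul, abs_mul]
      gcongr
    _ = _ := by ring

/-- The Fourier coefficients of `f` grow at most like `B (1 + |k₁|) (1 + |k₂|)`. -/
def CoefBound (B : ℝ) (f : PeriodicDistribution) : Prop :=
  ∀ k : ℤ × ℤ, |f.1 (trig k 0)| ≤ B * ((1 + |(k.1 : ℝ)|) * (1 + |(k.2 : ℝ)|)) ∧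
    |f.1 (trig k (Real.pi / 2))| ≤ B * ((1 + |(k.1 : ℝ)|) * (1 + |(k.2 : ℝ)|))

/-- Between grid points the field is estimated term by term, with only the polynomial bound on the
Fourier coefficients. The grid is chosen fine enough to absorb the loss. -/
lemma abs_field_le_of_grid {f : PeriodicDistribution} {B : ℝ} (hB : 0 ≤ B) (hf : CoefBound B f)
    {j : ℕ} {a : ℤ × ℤ → ℝ} {A : ℝ} (ha : ∀ k ∈ shell j, |a k| ≤ A) (φ : ℝ) {D : ℝ}
    (hD : ∀ q, |field f (shell j) a φ (gridPoint j q)| ≤ D) (x : ℝ × ℝ) :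
    |field f (shell j) a φ x| ≤ D + 32 * Real.pi * (A * B) := by
  have hN := gridSize_pos j
  have hN' : (0 : ℝ) < gridSize j := by exact_mod_cast hN
  rw [← (isPeriodic_field f (shell j) a φ).apply_fract x]
  set y : ℝ × ℝ := (Int.fract x.1, Int.fract x.2)
  obtain ⟨n, hn⟩ := exists_fin_near hN (Int.fract_nonneg x.1) (Int.fract_lt_one x.1)
  obtain ⟨m, hm⟩ := exists_fin_near hN (Int.fract_nonneg x.2) (Int.fract_lt_one x.2)
  set z := gridPoint j (n, m) with hz
  have hdiff : |field f (shell j) a φ y - field f (shell j) a φ z| ≤ 32 * Real.pi * (A * B) := by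
    unfold field
    rw [← Finset.sum_sub_distrib]
    refine (Finset.abs_sum_le_sum_abs _ _).trans ?_
    have hterm : ∀ k ∈ shell j, |a k * f.1 (trig k (-(phase k y + φ)))
        - a k * f.1 (trig k (-(phase k z + φ)))|
        ≤ A * ((2 * Real.pi * (2 * 8 ^ (j + 1) * (1 / gridSize j))) *
          (2 * (B * (4 ^ (j + 1) * 8 ^ (j + 1))))) := by
      intro k hk
      have hA : 0 ≤ A := (abs_nonneg _).trans (ha k hk)
      obtain ⟨b1, b2⟩ := shell_bounds hk
      rw [← mul_sub, abs_mul]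
      refine mul_le_mul (ha k hk) ((abs_apply_trig_sub_le f k _ _).trans ?_) (abs_nonneg _) hA
      have hc : B * ((1 + |(k.1 : ℝ)|) * (1 + |(k.2 : ℝ)|)) ≤ B * (4 ^ (j + 1) * 8 ^ (j + 1)) := by
        gcongr
      have h48 : (4 : ℝ) ^ (j + 1) ≤ 8 ^ (j + 1) := by gcongr; norm_num
      refine mul_le_mul ?_ ?_ (by positivity) (by positivity)
      · have e : phase k y + φ - (phase k z + φ)
            = 2 * Real.pi * (k.1 * (y.1 - z.1) + k.2 * (y.2 - z.2)) := by
          simp only [phase]; ring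
        rw [e, abs_mul, abs_of_pos Real.two_pi_pos]
        refine mul_le_mul_of_nonneg_left ((abs_add_le _ _).trans ?_) Real.two_pi_pos.le
        rw [abs_mul, abs_mul]
        calc |(k.1 : ℝ)| * |y.1 - z.1| + |(k.2 : ℝ)| * |y.2 - z.2|
            ≤ 8 ^ (j + 1) * (1 / gridSize j) + 8 ^ (j + 1) * (1 / gridSize j) := by
              refine add_le_add (mul_le_mul (by linarith) hn (abs_nonneg _) (by positivity))
                (mul_le_mul (by linarith) hm (abs_nonneg _) (by positivity))
          _ = _ := by ring
      · linarith [(hf k).1, (hf k).2]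
    refine (Finset.sum_le_card_nsmul _ _ _ hterm).trans ?_
    rw [nsmul_eq_mul]
    obtain ⟨k, hk⟩ := shell_nonempty j
    have hA : 0 ≤ A := (abs_nonneg _).trans (ha k hk)
    calc _ ≤ (4 * 32 ^ (j + 1)) * (A * ((2 * Real.pi * (2 * 8 ^ (j + 1) * (1 / gridSize j))) *
        (2 * (B * (4 ^ (j + 1) * 8 ^ (j + 1)))))) := by
          refine mul_le_mul_of_nonneg_right (card_shell_le j) (by positivity)
      -- Origin of the grid size `8192 = 32 * 8 * 4 * 8`: the number of modes, the speed of the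
      -- phase and the two factors of coefficient growth.
      _ = 32 * Real.pi * (A * B) * ((32 * (8 * (4 * 8))) ^ (j + 1) / gridSize j) := by
          rw [mul_pow, mul_pow, mul_pow]; ring
      _ = _ := by
          have : ((32 : ℝ) * (8 * (4 * 8))) ^ (j + 1) = gridSize j := by
            rw [gridSize]; norm_num
          rw [this, div_self hN'.ne', mul_one]
  have h1 := hD (n, m)
  calc |field f (shell j) a φ y|
      = |field f (shell j) a φ z + (field f (shell j) a φ y - field f (shell j) a φ z)| := by ring_nf
    _ ≤ D + 32 * Real.pi * (A * B) := (abs_add_le _ _).trans (add_le_add h1 hdiff)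

/-! ### Sums of blocks with geometrically decaying size -/

lemma hasSum_four_rpow {s : ℝ} (hs : 0 < s) :
    HasSum (fun j : ℕ => (4 : ℝ) ^ (-s * j)) (1 - (4 : ℝ) ^ (-s))⁻¹ := by
  have h : (fun j : ℕ => (4 : ℝ) ^ (-s * j)) = fun j : ℕ => ((4 : ℝ) ^ (-s)) ^ j := by
    funext j
    rw [Real.rpow_mul (by norm_num), Real.rpow_natCast]
  rw [h]
  exact hasSum_geometric_of_lt_one (Real.rpow_nonneg (by norm_num) _)
    (Real.rpow_lt_one_of_one_lt_of_neg (by norm_num) (by linarith))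

lemma eight_pow_eq (j : ℕ) : (8 : ℝ) ^ j = (4 : ℝ) ^ (3 / 2 * (j : ℝ)) := by
  rw [Real.rpow_mul (by norm_num), Real.rpow_natCast]
  congr 1
  rw [show (4 : ℝ) = 2 ^ (2 : ℝ) by norm_num, ← Real.rpow_mul (by norm_num)]
  norm_num

lemma sixteen_pow_eq (j : ℕ) : (16 : ℝ) ^ j = (4 : ℝ) ^ (2 * (j : ℝ)) := by
  rw [Real.rpow_mul (by norm_num), Real.rpow_natCast]
  norm_num

lemma abs_sub_le_anisoDist_rpow (x y : ℝ × ℝ) :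
    |y.1 - x.1| ≤ anisoDist y x ∧ |y.2 - x.2| ≤ anisoDist y x ^ (3 / 2 : ℝ) := by
  have h2 : 0 ≤ |y.2 - x.2| ^ (2 / 3 : ℝ) := Real.rpow_nonneg (abs_nonneg _) _
  refine ⟨le_add_of_nonneg_right h2, ?_⟩
  calc |y.2 - x.2| = (|y.2 - x.2| ^ (2 / 3 : ℝ)) ^ (3 / 2 : ℝ) := by
        rw [← Real.rpow_mul (abs_nonneg _)]; norm_num
    _ ≤ _ := Real.rpow_le_rpow h2 (le_add_of_nonneg_left (abs_nonneg _)) (by norm_num)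

/-- The relevant variable is `t = 4^j d`. For `t ≤ 1` the Lipschitz bound gives `t + t^(3/2) ≤ 2
t^α`; for `t ≥ 1` the supremum bound suffices. -/
lemma abs_sub_le_of_block {F : ℝ × ℝ → ℝ} {D α : ℝ} (hα : 0 ≤ α) (hα1 : α ≤ 1) (j : ℕ)
    (h0 : ∀ x, |F x| ≤ D)
    (h1 : ∀ x y, |F y - F x| ≤ D * (4 ^ j * |y.1 - x.1| + 8 ^ j * |y.2 - x.2|)) (x y : ℝ × ℝ) :
    |F y - F x| ≤ 2 * D * ((4 : ℝ) ^ (α * j) * anisoDist y x ^ α) := by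
  have hD : 0 ≤ D := (abs_nonneg _).trans (h0 x)
  obtain ⟨d1, d2⟩ := abs_sub_le_anisoDist_rpow x y
  have hd := anisoDist_nonneg y x
  set d := anisoDist y x
  have e : (4 : ℝ) ^ (α * j) * d ^ α = (4 ^ j * d) ^ α := by
    rw [Real.mul_rpow (by positivity) hd, mul_comm α, Real.rpow_mul (by norm_num),
      Real.rpow_natCast]
  rw [e]
  set t := 4 ^ j * d with ht
  have ht0 : 0 ≤ t := by positivity
  rcases le_total t 1 with h | h
  · refine (h1 x y).trans ?_
    have b1 : 4 ^ j * |y.1 - x.1| ≤ t ^ α := by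
      calc 4 ^ j * |y.1 - x.1| ≤ t := by rw [ht]; gcongr
        _ = t ^ (1 : ℝ) := (Real.rpow_one t).symm
        _ ≤ t ^ α := Real.rpow_le_rpow_of_exponent_ge' ht0 h hα hα1
    have b2 : 8 ^ j * |y.2 - x.2| ≤ t ^ α := by
      calc 8 ^ j * |y.2 - x.2| ≤ 8 ^ j * d ^ (3 / 2 : ℝ) := by gcongr
        _ = t ^ (3 / 2 : ℝ) := by
          rw [ht, Real.mul_rpow (by positivity) hd, eight_pow_eq, mul_comm (3 / 2 : ℝ),
            Real.rpow_mul (by norm_num), Real.rpow_natCast]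
        _ ≤ t ^ α := Real.rpow_le_rpow_of_exponent_ge' ht0 h hα (by linarith)
    calc _ ≤ D * (t ^ α + t ^ α) := by gcongr
      _ = _ := by ring
  · have b : 1 ≤ t ^ α := Real.one_le_rpow h hα
    calc |F y - F x| ≤ |F y| + |F x| := abs_sub _ _
      _ ≤ 2 * D * 1 := by linarith [h0 x, h0 y]
      _ ≤ _ := by gcongr

lemma summable_of_block {F : ℕ → ℝ × ℝ → ℝ} {D γ : ℝ} (hγ : 0 < γ)
    (h0 : ∀ j x, |F j x| ≤ D * (4 : ℝ) ^ (-γ * j)) (x : ℝ × ℝ) : Summable fun j => F j x :=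
  Summable.of_norm_bounded ((hasSum_four_rpow hγ).summable.mul_left D) fun j => h0 j x

/-- A block of size `4^(-γj)` contributes `4^(-(γ-α)j)` to the `α`-seminorm, which is summable for
`α < γ`. -/
lemma holderBound_tsum_of_block {F : ℕ → ℝ × ℝ → ℝ} {D α γ : ℝ} (hα : 0 ≤ α) (hα1 : α ≤ 1)
    (hγ : α < γ) (hF : ∀ j, IsPeriodic (F j)) (h0 : ∀ j x, |F j x| ≤ D * (4 : ℝ) ^ (-γ * j))
    (h1 : ∀ j x y, |F j y - F j x|
      ≤ D * (4 : ℝ) ^ (-γ * j) * (4 ^ j * |y.1 - x.1| + 8 ^ j * |y.2 - x.2|)) :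
    HolderBound α (2 * D * (1 - (4 : ℝ) ^ (-(γ - α)))⁻¹) (fun x => ∑' j, F j x) := by
  refine ⟨⟨fun x => ?_, fun x => ?_⟩, fun x y => ?_⟩
  · simp only [(hF _).1 x]
  · simp only [(hF _).2 x]
  · have hs := summable_of_block (hα.trans_lt hγ) h0
    rw [← (hs y).tsum_sub (hs x)]
    have hsum := ((hasSum_four_rpow (sub_pos.2 hγ)).mul_left (2 * D)).mul_right
      (anisoDist y x ^ α)
    rw [← Real.norm_eq_abs]
    have hbd : HasSum (fun j : ℕ => 2 * D * (4 : ℝ) ^ (-(γ - α) * (j : ℝ)) * anisoDist y x ^ α)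
        (2 * D * (1 - (4 : ℝ) ^ (-(γ - α)))⁻¹ * anisoDist y x ^ α) := hsum
    refine tsum_of_norm_bounded hbd fun j => ?_
    refine (abs_sub_le_of_block hα hα1 j (h0 j) (h1 j) x y).trans (le_of_eq ?_)
    rw [show -(γ - α) * (j : ℝ) = -γ * j + α * j by ring, Real.rpow_add (by norm_num)]
    ring

lemma hasSum_integral_mul_testFun {F : ℕ → ℝ × ℝ → ℝ} {D γ : ℝ} (hγ : 0 < γ)
    (hF : ∀ j, Continuous (F j)) (h0 : ∀ j x, |F j x| ≤ D * (4 : ℝ) ^ (-γ * j)) (v : TestFun) :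
    HasSum (fun j => ∫ x in unitCell, F j x * (v : ℝ × ℝ → ℝ) x)
      (∫ x in unitCell, (∑' j, F j x) * (v : ℝ × ℝ → ℝ) x) := by
  obtain ⟨b, hb⟩ := (testFun_periodic v).exists_bound (testFun_continuous v)
  have hb0 : 0 ≤ b := (norm_nonneg _).trans (hb 0)
  have hi : ∀ j, Integrable (fun x => F j x * (v : ℝ × ℝ → ℝ) x) (volume.restrict unitCell) :=
    fun j => integrableOn_mul_testFun (hF j) v
  have := hasSum_integral_of_summable_integral_norm hi ?_
  · simpa only [tsum_mul_right] using this
  · refine Summable.of_nonneg_of_le (fun j => integral_nonneg fun x => norm_nonneg _)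
      (fun j => ?_) (((hasSum_four_rpow hγ).summable.mul_left D).mul_right b)
    have h2 : ∫ x in unitCell, ‖F j x * (v : ℝ × ℝ → ℝ) x‖
        ≤ ∫ x in unitCell, (D * (4 : ℝ) ^ (-γ * j) * b) := by
      refine integral_mono (hi j).norm (integrable_const _) fun x => ?_
      simp only
      rw [norm_mul]
      exact mul_le_mul (h0 j x) (hb x) (norm_nonneg _) ((abs_nonneg _).trans (h0 j x))
    simpa using h2

/-! ### The distribution attached to a representation -/

lemma abs_setIntegral_mul_le {g : ℝ × ℝ → ℝ} {b : ℝ} (hb : ∀ x, ‖g x‖ ≤ b) {v : ℝ × ℝ → ℝ} {B : ℝ}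
    (hv : ∀ x, |v x| ≤ B) : |∫ x in unitCell, g x * v x| ≤ b * B := by
  have hb0 : 0 ≤ b := (norm_nonneg _).trans (hb 0)
  have := norm_setIntegral_le_of_norm_le_const (μ := (volume : Measure (ℝ × ℝ))) (s := unitCell)
    (f := fun x => g x * v x) (C := b * B) (by simp [volume_unitCell]) fun x _ => by
      rw [norm_mul]
      exact mul_le_mul (hb x) (hv x) (norm_nonneg _) hb0
  simpa [measureReal_def, volume_unitCell] using this

/-- The periodic distribution `c + ∂₁² g + ∂₂ h`. -/
noncomputable def repDist (c : ℝ) (g h : ℝ × ℝ → ℝ) (hg : Continuous g) (hgp : IsPeriodic g)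
    (hh : Continuous h) (hhp : IsPeriodic h) : PeriodicDistribution :=
  ⟨{ toFun := fun u => c * (∫ x in unitCell, (u : ℝ × ℝ → ℝ) x)
        + (∫ x in unitCell, g x * (pd1 (pd1 u) : ℝ × ℝ → ℝ) x)
        - (∫ x in unitCell, h x * (pd2 u : ℝ × ℝ → ℝ) x)
     map_add' := fun u v => by
        simp only [map_add, Submodule.coe_add, Pi.add_apply, mul_add]
        rw [integral_add (integrableOn_unitCell (testFun_continuous u))
          (integrableOn_unitCell (testFun_continuous v)),
          integral_add (integrableOn_mul_testFun hg _) (integrableOn_mul_testFun hg _),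
          integral_add (integrableOn_mul_testFun hh _) (integrableOn_mul_testFun hh _)]
        ring
     map_smul' := fun a u => by
        simp only [map_smul, Submodule.coe_smul, Pi.smul_apply, smul_eq_mul, mul_left_comm _ a,
          integral_const_mul, RingHom.id_apply]
        ring }, by
    obtain ⟨b, hb⟩ := hgp.exists_bound hg
    obtain ⟨b', hb'⟩ := hhp.exists_bound hh
    refine ⟨|c| + b + b', 2, fun u B hB => ?_⟩
    have h0 := hB 0 0 (by norm_num)
    have h1 := abs_setIntegral_mul_le hb (hB 2 0 (by norm_num))
    have h2 := abs_setIntegral_mul_le hb' (hB 0 1 (by norm_num))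
    have h3 := abs_setIntegral_mul_le (g := fun _ => c) (fun _ => le_rfl) h0
    rw [integral_const_mul] at h3
    simp only [Function.iterate_zero, id_eq, Function.iterate_succ, Function.comp_apply,
      Real.norm_eq_abs] at h1 h2 h3
    refine (abs_sub _ _).trans ?_
    have h4 := abs_add_le (c * ∫ x in unitCell, (u : ℝ × ℝ → ℝ) x)
      (∫ x in unitCell, g x * (pd1 (pd1 u) : ℝ × ℝ → ℝ) x)
    rw [add_mul, add_mul]
    linarith⟩

/-- Both sides are periodic distributions, so their difference vanishes once it vanishes on
trigonometric functions. -/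
lemma represents_of_trig {c : ℝ} {g h : ℝ × ℝ → ℝ} (hg : Continuous g) (hgp : IsPeriodic g)
    (hh : Continuous h) (hhp : IsPeriodic h) {f : PeriodicDistribution}
    (H : ∀ k φ, f.1 (trig k φ) = c * (∫ x in unitCell, (trig k φ : ℝ × ℝ → ℝ) x)
        + (∫ x in unitCell, g x * (pd1 (pd1 (trig k φ)) : ℝ × ℝ → ℝ) x)
        - (∫ x in unitCell, h x * (pd2 (trig k φ) : ℝ × ℝ → ℝ) x)) :
    Represents c g h f := by
  intro u
  have := eq_zero_of_trig (f - repDist c g h hg hgp hh hhp)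
    (fun k φ => sub_eq_zero.2 (H k φ)) u
  exact sub_eq_zero.1 this

/-! ### The multipliers for `g` and `h` -/

/-- The multiplier that produces `g` on the shell `j`. -/
noncomputable def gCoef (j : ℕ) (k : ℤ × ℤ) : ℝ :=
  if (4 : ℤ) ^ j ≤ |k.1| then -(1 / (2 * Real.pi * k.1) ^ 2) else 0

/-- The multiplier that produces `h` on the shell `j`. -/
noncomputable def hCoef (j : ℕ) (k : ℤ × ℤ) : ℝ :=
  if (4 : ℤ) ^ j ≤ |k.1| then 0 else 1 / (2 * Real.pi * k.2)

lemma gCoef_neg (j : ℕ) (k : ℤ × ℤ) : gCoef j (-k) = gCoef j k := by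
  simp [gCoef]

lemma hCoef_neg (j : ℕ) (k : ℤ × ℤ) : hCoef j (-k) = -hCoef j k := by
  unfold hCoef
  simp only [Prod.fst_neg, abs_neg, Prod.snd_neg, Int.cast_neg, mul_neg]
  split_ifs
  · simp
  · rw [div_neg]

lemma le_snd_of_mem_shell {j : ℕ} {k : ℤ × ℤ} (hk : k ∈ shell j) (h : ¬(4 : ℤ) ^ j ≤ |k.1|) :
    (8 : ℝ) ^ j ≤ |(k.2 : ℝ)| := by
  have h1 := (Finset.mem_sdiff.1 hk).2
  rw [mem_freqBox, not_and] at h1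
  have h2 := not_lt.1 (h1 (not_le.1 h))
  exact_mod_cast h2

/-- The symbol of `∂₁²` times the multiplier of `g`, plus the real factor of `∂₂` times that of `h`,
is one. On every frequency of the shell exactly one of the two multipliers is nonzero, and its
denominator is bounded away from zero. -/
lemma coef_identity {j : ℕ} {k : ℤ × ℤ} (hk : k ∈ shell j) :
    -(2 * Real.pi * k.1) ^ 2 * gCoef j k + 2 * Real.pi * k.2 * hCoef j k = 1 := by
  have hpi := Real.pi_pos
  by_cases h : (4 : ℤ) ^ j ≤ |k.1|
  · have h0 : (k.1 : ℝ) ≠ 0 := by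
      intro h1
      have h2 : k.1 = 0 := by exact_mod_cast h1
      rw [h2, abs_zero] at h
      exact absurd h (not_le.2 (by positivity))
    simp only [gCoef, hCoef, if_pos h]
    field_simp
    ring
  · have h1 := le_snd_of_mem_shell hk h
    have h0 : (k.2 : ℝ) ≠ 0 := by
      intro h2
      rw [h2, abs_zero] at h1
      exact absurd h1 (not_le.2 (by positivity))
    simp only [gCoef, hCoef, if_neg h]
    field_simp
    ring

/-- The multipliers for `g` (`false`) and `h` (`true`), normalised to size one. -/
noncomputable def baseCoef : Bool → ℕ → ℤ × ℤ → ℝ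
  | false, j, k => 16 ^ j * gCoef j k
  | true, j, k => 8 ^ j * hCoef j k

/-- The phases that belong to `baseCoef`. -/
noncomputable def basePhase : Bool → ℝ
  | false => 0
  | true => -(Real.pi / 2)

/-- The multipliers of the identity and of the partial derivatives, normalised on the shell `j`. -/
noncomputable def derivFactor : Fin 3 → ℕ → ℤ × ℤ → ℝ
  | 0, _, _ => 1
  | 1, j, k => 2 * Real.pi * k.1 / 4 ^ j
  | 2, j, k => 2 * Real.pi * k.2 / 8 ^ j

/-- The phases that belong to `derivFactor`. -/
noncomputable def derivPhase : Fin 3 → ℝ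
  | 0 => 0
  | 1 => Real.pi / 2
  | 2 => Real.pi / 2

/-- The product of `baseCoef` and `derivFactor`. -/
noncomputable def kindCoef (b : Bool) (i : Fin 3) (j : ℕ) (k : ℤ × ℤ) : ℝ :=
  baseCoef b j k * derivFactor i j k

/-- The sum of `basePhase` and `derivPhase`. -/
noncomputable def kindPhase (b : Bool) (i : Fin 3) : ℝ := basePhase b + derivPhase i

lemma abs_baseCoef_le (b : Bool) {j : ℕ} {k : ℤ × ℤ} (hk : k ∈ shell j) : |baseCoef b j k| ≤ 1 := by
  have hpi := Real.pi_gt_three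
  have hpi2 : 1 ≤ 2 * Real.pi := by linarith
  by_cases h : (4 : ℤ) ^ j ≤ |k.1|
  · have h1 : (4 : ℝ) ^ j ≤ |(k.1 : ℝ)| := by exact_mod_cast h
    cases b
    · have h2 : (4 : ℝ) ^ j ≤ |2 * Real.pi * k.1| := by
        rw [abs_mul, abs_of_pos Real.two_pi_pos]
        nlinarith [abs_nonneg (k.1 : ℝ)]
      have h3 : (16 : ℝ) ^ j ≤ (2 * Real.pi * k.1) ^ 2 := by
        rw [← sq_abs (2 * Real.pi * (k.1 : ℝ)), show (16 : ℝ) = 4 ^ 2 by norm_num, ← pow_mul,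
          mul_comm, pow_mul]
        gcongr
      have h4 : (0 : ℝ) < 16 ^ j := by positivity
      simp only [baseCoef, gCoef, if_pos h]
      rw [abs_mul, abs_neg, abs_of_pos h4, abs_of_nonneg (by positivity), mul_one_div]
      exact div_le_one_of_le₀ h3 (by positivity)
    · simp [baseCoef, hCoef, h]
  · cases b
    · simp [baseCoef, gCoef, h]
    · have h1 := le_snd_of_mem_shell hk h
      have h2 : (8 : ℝ) ^ j ≤ |2 * Real.pi * k.2| := by
        rw [abs_mul, abs_of_pos Real.two_pi_pos]
        nlinarith [abs_nonneg (k.2 : ℝ)]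
      simp only [baseCoef, hCoef, if_neg h]
      rw [abs_mul, abs_div, abs_one, abs_of_pos (by positivity : (0 : ℝ) < 8 ^ j), mul_one_div]
      exact div_le_one_of_le₀ h2 (abs_nonneg _)

lemma abs_derivFactor_le (i : Fin 3) {j : ℕ} {k : ℤ × ℤ} (hk : k ∈ shell j) :
    |derivFactor i j k| ≤ 16 * Real.pi := by
  have hpi := Real.pi_gt_three
  obtain ⟨b1, b2⟩ := shell_bounds hk
  rw [pow_succ] at b1 b2
  fin_cases i
  · simp only [derivFactor, abs_one]
    linarith
  · simp only [derivFactor]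
    rw [abs_div, abs_mul, abs_of_pos Real.two_pi_pos, abs_of_pos (by positivity : (0 : ℝ) < 4 ^ j),
      div_le_iff₀ (by positivity)]
    nlinarith [pow_pos (by norm_num : (0 : ℝ) < 4) j]
  · simp only [derivFactor]
    rw [abs_div, abs_mul, abs_of_pos Real.two_pi_pos, abs_of_pos (by positivity : (0 : ℝ) < 8 ^ j),
      div_le_iff₀ (by positivity)]
    nlinarith [pow_pos (by norm_num : (0 : ℝ) < 8) j]

lemma abs_kindCoef_le (b : Bool) (i : Fin 3) {j : ℕ} {k : ℤ × ℤ} (hk : k ∈ shell j) :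
    |kindCoef b i j k| ≤ 16 * Real.pi := by
  rw [kindCoef, abs_mul]
  have h1 := abs_baseCoef_le b hk
  have h2 := abs_derivFactor_le i hk
  nlinarith [abs_nonneg (baseCoef b j k), abs_nonneg (derivFactor i j k)]

/-- The fields on the shell `j` whose suprema control the contribution of that shell to `g`, `h`. -/
noncomputable def kindField (f : PeriodicDistribution) (b : Bool) (i : Fin 3) (j : ℕ) :
    ℝ × ℝ → ℝ := field f (shell j) (kindCoef b i j) (kindPhase b i)

/-- The admissible growth of the fields on the grids. -/
noncomputable def gridWeight (ε : ℝ) (j : ℕ) : ℝ := (4 : ℝ) ^ ((5 / 4 + ε / 2) * j)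

lemma one_le_gridWeight {ε : ℝ} (hε : 0 ≤ ε) (j : ℕ) : 1 ≤ gridWeight ε j :=
  Real.one_le_rpow (by norm_num) (by positivity)

/-- The fields on all shells are bounded by `B * gridWeight ε j` on the grids. -/
def GridBound (ε B : ℝ) (f : PeriodicDistribution) : Prop :=
  ∀ b i j q, |kindField f b i j (gridPoint j q)| ≤ B * gridWeight ε j

/-- The constant that relates suprema to suprema over grids. -/
noncomputable def supConst : ℝ := 1 + 512 * Real.pi ^ 2

/-- The term `512 π²` in `supConst` is `32π` from the grid estimate times the multiplier bound
`16π`. -/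
lemma abs_kindField_le {f : PeriodicDistribution} {ε B : ℝ} (hε : 0 ≤ ε) (hB : 0 ≤ B)
    (hf : CoefBound B f) (hg : GridBound ε B f) (b : Bool) (i : Fin 3) (j : ℕ) (x : ℝ × ℝ) :
    |kindField f b i j x| ≤ supConst * B * gridWeight ε j := by
  have h := abs_field_le_of_grid hB hf (fun k hk => abs_kindCoef_le b i hk) (kindPhase b i)
    (hg b i j) x
  refine h.trans ?_
  have h1 := mul_le_mul_of_nonneg_left (one_le_gridWeight hε j)
    (by positivity : 0 ≤ 512 * Real.pi ^ 2 * B)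
  unfold supConst
  linarith

/-- The partial derivatives of the field of kind `0` are `4^j` and `8^j` times the fields of kinds
`1` and `2`, which are controlled as well. This is why derivative kinds are included among the
Gaussians. -/
lemma abs_kindField_sub_le {f : PeriodicDistribution} {ε B : ℝ} (hε : 0 ≤ ε) (hB : 0 ≤ B)
    (hf : CoefBound B f) (hg : GridBound ε B f) (b : Bool) (j : ℕ) (x y : ℝ × ℝ) :
    |kindField f b 0 j y - kindField f b 0 j x|
      ≤ supConst * B * gridWeight ε j * (4 ^ j * |y.1 - x.1| + 8 ^ j * |y.2 - x.2|) := by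
  have h1 : ∀ x, |field f (shell j) (fun k => 2 * Real.pi * k.1 * kindCoef b 0 j k)
      (kindPhase b 0 + Real.pi / 2) x| ≤ 4 ^ j * (supConst * B * gridWeight ε j) := fun x => by
    have e : field f (shell j) (fun k => 2 * Real.pi * k.1 * kindCoef b 0 j k)
        (kindPhase b 0 + Real.pi / 2) x = 4 ^ j * kindField f b 1 j x := by
      rw [kindField, ← field_mul_coef, show kindPhase b 0 + Real.pi / 2 = kindPhase b 1 by
        simp [kindPhase, derivPhase]]
      refine field_congr f (fun k _ => ?_) _ _
      simp only [kindCoef, derivFactor]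
      field_simp
    rw [e, abs_mul, abs_of_pos (by positivity)]
    exact mul_le_mul_of_nonneg_left (abs_kindField_le hε hB hf hg b 1 j x) (by positivity)
  have h2 : ∀ x, |field f (shell j) (fun k => 2 * Real.pi * k.2 * kindCoef b 0 j k)
      (kindPhase b 0 + Real.pi / 2) x| ≤ 8 ^ j * (supConst * B * gridWeight ε j) := fun x => by
    have e : field f (shell j) (fun k => 2 * Real.pi * k.2 * kindCoef b 0 j k)
        (kindPhase b 0 + Real.pi / 2) x = 8 ^ j * kindField f b 2 j x := by
      rw [kindField, ← field_mul_coef, show kindPhase b 0 + Real.pi / 2 = kindPhase b 2 by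
        simp [kindPhase, derivPhase]]
      refine field_congr f (fun k _ => ?_) _ _
      simp only [kindCoef, derivFactor]
      field_simp
    rw [e, abs_mul, abs_of_pos (by positivity)]
    exact mul_le_mul_of_nonneg_left (abs_kindField_le hε hB hf hg b 2 j x) (by positivity)
  refine (abs_field_sub_le f (shell j) (kindCoef b 0 j) (kindPhase b 0) h1 h2 x y).trans
    (le_of_eq ?_)
  ring

lemma kindField_false_zero (f : PeriodicDistribution) (j : ℕ) (x : ℝ × ℝ) :
    field f (shell j) (gCoef j) 0 x = (4 : ℝ) ^ (-2 * (j : ℝ)) * kindField f false 0 j x := by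
  rw [kindField, ← field_mul_coef]
  simp only [kindPhase, basePhase, derivPhase, add_zero]
  refine field_congr f (fun k _ => ?_) _ _
  simp only [kindCoef, baseCoef, derivFactor, mul_one]
  rw [sixteen_pow_eq, ← mul_assoc, ← Real.rpow_add (by norm_num)]
  simp

lemma kindField_true_zero (f : PeriodicDistribution) (j : ℕ) (x : ℝ × ℝ) :
    field f (shell j) (hCoef j) (-(Real.pi / 2)) x
      = (4 : ℝ) ^ (-(3 / 2) * (j : ℝ)) * kindField f true 0 j x := by
  rw [kindField, ← field_mul_coef]
  simp only [kindPhase, basePhase, derivPhase, add_zero]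
  refine field_congr f (fun k _ => ?_) _ _
  simp only [kindCoef, baseCoef, derivFactor, mul_one]
  rw [eight_pow_eq, ← mul_assoc, ← Real.rpow_add (by norm_num)]
  simp

lemma block_bounds {f : PeriodicDistribution} {ε B : ℝ} (hε : 0 ≤ ε) (hB : 0 ≤ B)
    (hf : CoefBound B f) (hg : GridBound ε B f) (b : Bool) {s γ : ℝ} (hs : s - (5 / 4 + ε / 2) = γ)
    {F : ℕ → ℝ × ℝ → ℝ} (hF : ∀ j x, F j x = (4 : ℝ) ^ (-s * (j : ℝ)) * kindField f b 0 j x) :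
    (∀ j x, |F j x| ≤ supConst * B * (4 : ℝ) ^ (-γ * j)) ∧
    ∀ j x y, |F j y - F j x| ≤ supConst * B * (4 : ℝ) ^ (-γ * j) *
      (4 ^ j * |y.1 - x.1| + 8 ^ j * |y.2 - x.2|) := by
  have e : ∀ j : ℕ, (4 : ℝ) ^ (-γ * (j : ℝ)) = (4 : ℝ) ^ (-s * (j : ℝ)) * gridWeight ε j := fun j => by
    rw [gridWeight, ← Real.rpow_add (by norm_num), ← hs]
    congr 1
    ring
  have hp : ∀ j : ℕ, (0 : ℝ) < (4 : ℝ) ^ (-s * (j : ℝ)) := fun j => Real.rpow_pos_of_pos (by norm_num) _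
  constructor
  · intro j x
    rw [hF, abs_mul, abs_of_pos (hp j), e]
    have := mul_le_mul_of_nonneg_left (abs_kindField_le hε hB hf hg b 0 j x) (hp j).le
    linarith
  · intro j x y
    rw [hF, hF, ← mul_sub, abs_mul, abs_of_pos (hp j), e]
    have := mul_le_mul_of_nonneg_left (abs_kindField_sub_le hε hB hf hg b j x y) (hp j).le
    linarith

lemma tsum_shell {l : ℤ × ℤ} {j : ℕ} (hj : l ∈ shell j) (F : ℕ → ℝ) :
    ∑' i, (if l ∈ shell i then F i else 0) = F j := by
  rw [tsum_eq_single j fun i hi => if_neg fun h => hi (shell_unique h hj), if_pos hj]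

/-- The constant in the bound of the representation. -/
noncomputable def repConst (ε : ℝ) : ℝ := 2 * supConst * (1 - (4 : ℝ) ^ (-(ε / 2)))⁻¹

lemma one_le_repConst {ε : ℝ} (hε : 0 < ε) : 1 ≤ repConst ε := by
  have h1 : (4 : ℝ) ^ (-(ε / 2)) < 1 :=
    Real.rpow_lt_one_of_one_lt_of_neg (by norm_num) (by linarith)
  have h2 : 0 < (4 : ℝ) ^ (-(ε / 2)) := Real.rpow_pos_of_pos (by norm_num) _
  have h3 : 1 ≤ (1 - (4 : ℝ) ^ (-(ε / 2)))⁻¹ := (one_le_inv₀ (by linarith)).2 (by linarith)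
  have h4 : 1 ≤ supConst := by unfold supConst; nlinarith [sq_nonneg Real.pi]
  unfold repConst
  nlinarith

/-- A distribution with the above bounds on its Fourier coefficients and fields is of negative
Hölder regularity. -/
lemma hasRep_of_bounds {f : PeriodicDistribution} {ε B : ℝ} (hε : 0 < ε) (hε4 : ε < 1 / 4)
    (hB : 0 ≤ B) (hf : CoefBound B f) (hgrid : GridBound ε B f) :
    HasRep (3 / 4 - ε) (1 / 4 - ε) (repConst ε * B) f := by
  -- Inverting `∂₁²` gains `4^(-2j)` and inverting `∂₂` gains `4^(-3j/2)`. Subtracting the growth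
  -- exponent `5/4 + ε/2` leaves the decay rates `3/4 - ε/2` and `1/4 - ε/2`.
  obtain ⟨g0, g1⟩ := block_bounds hε.le hB hf hgrid false (s := 2) (γ := 3 / 4 - ε / 2) (by ring)
    (F := fun j x => field f (shell j) (gCoef j) 0 x) (kindField_false_zero f)
  obtain ⟨h0, h1⟩ := block_bounds hε.le hB hf hgrid true (s := 3 / 2) (γ := 1 / 4 - ε / 2) (by ring)
    (F := fun j x => field f (shell j) (hCoef j) (-(Real.pi / 2)) x) (kindField_true_zero f)
  have hG := holderBound_tsum_of_block (α := 3 / 4 - ε) (by linarith) (by linarith) (by linarith)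
    (fun j => isPeriodic_field f (shell j) (gCoef j) 0) g0 g1
  have hH := holderBound_tsum_of_block (α := 1 / 4 - ε) (by linarith) (by linarith) (by linarith)
    (fun j => isPeriodic_field f (shell j) (hCoef j) (-(Real.pi / 2))) h0 h1
  have e1 : 2 * (supConst * B) * (1 - (4 : ℝ) ^ (-(3 / 4 - ε / 2 - (3 / 4 - ε))))⁻¹
      = repConst ε * B := by
    rw [repConst, show -(3 / 4 - ε / 2 - (3 / 4 - ε)) = -(ε / 2) by ring]
    ring
  have e2 : 2 * (supConst * B) * (1 - (4 : ℝ) ^ (-(1 / 4 - ε / 2 - (1 / 4 - ε))))⁻¹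
      = repConst ε * B := by
    rw [repConst, show -(1 / 4 - ε / 2 - (1 / 4 - ε)) = -(ε / 2) by ring]
    ring
  rw [e1] at hG
  rw [e2] at hH
  -- The constant is the mean of `f`, since `trig 0 0` is the function one.
  refine ⟨f.1 (trig 0 0), _, _, ?_, hG, hH, represents_of_trig (hG.continuous (by linarith))
    hG.periodic (hH.continuous (by linarith)) hH.periodic fun l ψ => ?_⟩
  · have := (hf 0).1
    simp only [Prod.fst_zero, Prod.snd_zero, Int.cast_zero, abs_zero, add_zero, mul_one] at this
    exact this.trans (le_mul_of_one_le_left hB (one_le_repConst hε))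
  · have sg := (hasSum_integral_mul_testFun (by linarith)
      (fun j => continuous_field f (shell j) (gCoef j) 0) g0 (trig l ψ)).tsum_eq
    -- `∂₂` shifts the phase of the test function by `π/2` and the odd multiplier by another `π/2`.
    -- The total shift `π` gives a minus sign, which cancels the one from integration by parts.
    have sh := (hasSum_integral_mul_testFun (by linarith)
      (fun j => continuous_field f (shell j) (hCoef j) (-(Real.pi / 2))) h0
      (trig l (ψ + Real.pi / 2))).tsum_eq
    simp only [integral_field_mul_trig_of_even f (neg_mem_shell _) (gCoef_neg _)] at sg
    simp only [integral_field_mul_trig_of_odd f (neg_mem_shell _) (hCoef_neg _)] at sh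
    rw [add_assoc, add_halves, trig_add_pi, map_neg] at sh
    have t1 : ∫ x in unitCell, (trig l ψ : ℝ × ℝ → ℝ) x = if l = 0 then Real.cos ψ else 0 :=
      integral_cos_phase l ψ
    rw [pd1_pd1_trig, pd2_trig, t1]
    simp only [Submodule.coe_smul, Pi.smul_apply, smul_eq_mul,
      mul_left_comm _ (-(2 * Real.pi * (l.1 : ℝ)) ^ 2), mul_left_comm _ (2 * Real.pi * (l.2 : ℝ)),
      integral_const_mul]
    rw [← sg, ← sh]
    by_cases hl : l = 0
    · subst hl
      have z : trig 0 (Real.pi / 2) = 0 := by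
        ext x
        simp [trig_apply, phase_zero_left]
      rw [apply_trig, z]
      simp [zero_notMem_shell, mul_comm]
    -- A nonzero frequency lies in exactly one shell, so both series reduce to a single term.
    · obtain ⟨j, hj⟩ := exists_mem_shell hl
      rw [tsum_shell hj (fun i => gCoef i l * f.1 (trig l ψ)),
        tsum_shell hj (fun i => hCoef i l * -f.1 (trig l ψ)), if_neg hl]
      have := coef_identity hj
      linear_combination (-f.1 (trig l ψ)) * this

/-! ### Moments of white noise -/

/-- The absolute moment of order `P` of the standard Gaussian. -/
noncomputable def gaussMoment (P : ℕ) : ℝ≥0∞ :=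
  ∫⁻ x, ENNReal.ofReal (|x| ^ P) ∂ProbabilityTheory.gaussianReal 0 1

lemma gaussMoment_ne_top (P : ℕ) : gaussMoment P ≠ ⊤ := by
  have h := (ProbabilityTheory.memLp_id_gaussianReal (μ := 0) (v := 1) (P : ℝ≥0)).integrable_norm_pow'
  simp only [id_eq, Real.norm_eq_abs] at h
  exact h.lintegral_lt_top.ne

lemma lintegral_abs_pow_gaussianReal (v : ℝ≥0) (P : ℕ) :
    ∫⁻ x, ENNReal.ofReal (|x| ^ P) ∂ProbabilityTheory.gaussianReal 0 v
      = ENNReal.ofReal (Real.sqrt v ^ P) * gaussMoment P := by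
  have h := ProbabilityTheory.gaussianReal_map_const_mul (μ := 0) (v := 1) (Real.sqrt v)
  have e : NNReal.mk (Real.sqrt v ^ 2) (sq_nonneg _) * 1 = v := by
    ext
    simp only [mul_one, NNReal.coe_mk]
    exact Real.sq_sqrt v.2
  rw [mul_zero, e] at h
  rw [← h, lintegral_map (by fun_prop) (by fun_prop), gaussMoment, ← lintegral_const_mul _
    (by fun_prop)]
  refine lintegral_congr fun x => ?_
  rw [abs_mul, mul_pow, abs_of_nonneg (Real.sqrt_nonneg _), ENNReal.ofReal_mul (by positivity)]

lemma IsWhiteNoise.lintegral_abs_pow {Ω : Type*} [MeasurableSpace Ω] {μ : Measure Ω}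
    {ξ : Ω → PeriodicDistribution} (hξ : IsWhiteNoise μ ξ) (u : TestFun) (P : ℕ) :
    ∫⁻ θ, ENNReal.ofReal (|(ξ θ).1 u| ^ P) ∂μ
      = ENNReal.ofReal (Real.sqrt (∫ x in unitCell, (u : ℝ × ℝ → ℝ) x ^ 2) ^ P) *
        gaussMoment P := by
  have hm := (hξ u).aemeasurable
  have h := lintegral_map' (μ := μ) (f := fun x : ℝ => ENNReal.ofReal (|x| ^ P))
    (by fun_prop) hm
  rw [← h, (hξ u).map_eq, lintegral_abs_pow_gaussianReal, Real.coe_toNNReal _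
    (integral_nonneg fun _ => sq_nonneg _)]

/-- The weighted sum `∑ i, (|f(u i)| / w i)^P`. -/
noncomputable def weightedSum {ι : Type*} (u : ι → TestFun) (w : ι → ℝ) (P : ℕ)
    (f : PeriodicDistribution) : ℝ≥0∞ :=
  ∑' i, ENNReal.ofReal ((|f.1 (u i)| / w i) ^ P)

/-- A supremum of infinitely many Gaussians is controlled by one random variable: each summand is at
most the whole sum. -/
lemma abs_apply_le_of_weightedSum {ι : Type*} {u : ι → TestFun} {w : ι → ℝ} (hw : ∀ i, 0 < w i)
    {P : ℕ} (hP : P ≠ 0) {f : PeriodicDistribution} {S : ℝ≥0∞} (hS : S ≠ ⊤)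
    (h : weightedSum u w P f ≤ S) (i : ι) :
    |f.1 (u i)| ≤ S.toReal ^ (1 / (P : ℝ)) * w i := by
  rw [← div_le_iff₀ (hw i)]
  have h0 : 0 ≤ |f.1 (u i)| / w i := div_nonneg (abs_nonneg _) (hw i).le
  have h1 : ENNReal.ofReal ((|f.1 (u i)| / w i) ^ P) ≤ S := (ENNReal.le_tsum i).trans h
  have h2 := (ENNReal.ofReal_le_iff_le_toReal hS).1 h1
  calc |f.1 (u i)| / w i = ((|f.1 (u i)| / w i) ^ P) ^ (1 / (P : ℝ)) := by
        rw [one_div, Real.pow_rpow_inv_natCast h0 hP]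
    _ ≤ _ := Real.rpow_le_rpow (by positivity) h2 (by positivity)

lemma IsWhiteNoise.aemeasurable_weightedSum {Ω : Type*} [MeasurableSpace Ω] {μ : Measure Ω}
    {ξ : Ω → PeriodicDistribution} (hξ : IsWhiteNoise μ ξ) {ι : Type*} [Countable ι]
    (u : ι → TestFun) (w : ι → ℝ) (P : ℕ) :
    AEMeasurable (fun θ => weightedSum u w P (ξ θ)) μ := by
  unfold weightedSum
  refine AEMeasurable.tsum fun i => ?_
  have hm := (hξ (u i)).aemeasurable
  fun_prop

/-- Only the law of each `ξ(u i)` enters, by scaling from the standard Gaussian; no joint law or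
independence is needed. -/
lemma IsWhiteNoise.lintegral_weightedSum_le {Ω : Type*} [MeasurableSpace Ω] {μ : Measure Ω}
    {ξ : Ω → PeriodicDistribution} (hξ : IsWhiteNoise μ ξ) {ι : Type*} [Countable ι]
    {u : ι → TestFun} {w s : ι → ℝ} (hw : ∀ i, 0 < w i) (hs : ∀ i, 0 ≤ s i)
    (hu : ∀ i, ∫ x in unitCell, (u i : ℝ × ℝ → ℝ) x ^ 2 ≤ s i ^ 2) (P : ℕ) :
    ∫⁻ θ, weightedSum u w P (ξ θ) ∂μ
      ≤ (∑' i, ENNReal.ofReal ((s i / w i) ^ P)) * gaussMoment P := by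
  unfold weightedSum
  rw [lintegral_tsum, ← ENNReal.tsum_mul_right]
  · refine ENNReal.tsum_le_tsum fun i => ?_
    have e : ∀ θ, ENNReal.ofReal ((|(ξ θ).1 (u i)| / w i) ^ P)
        = ENNReal.ofReal ((1 / w i) ^ P) * ENNReal.ofReal (|(ξ θ).1 (u i)| ^ P) := fun θ => by
      rw [← ENNReal.ofReal_mul (by have := hw i; positivity), ← mul_pow]
      congr 2
      ring
    simp only [e]
    rw [lintegral_const_mul' _ _ ENNReal.ofReal_ne_top, hξ.lintegral_abs_pow, ← mul_assoc,
      ← ENNReal.ofReal_mul (by have := hw i; positivity), ← mul_pow]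
    gcongr
    · have := hw i
      positivity
    · rw [one_div_mul_eq_div]
      exact div_le_div_of_nonneg_right (Real.sqrt_le_iff.2 ⟨hs i, hu i⟩) (hw i).le
  · intro i
    have hm := (hξ (u i)).aemeasurable
    fun_prop

/-! ### The two families of test functions -/

/-- The test functions for the Fourier coefficients. -/
noncomputable def coefTest (i : (ℤ × ℤ) × Bool) : TestFun :=
  trig i.1 (if i.2 then Real.pi / 2 else 0)

/-- The weights for the Fourier coefficients. -/
noncomputable def coefWeight (i : (ℤ × ℤ) × Bool) : ℝ :=
  (1 + |(i.1.1 : ℝ)|) * (1 + |(i.1.2 : ℝ)|)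

lemma one_le_coefWeight (i : (ℤ × ℤ) × Bool) : 1 ≤ coefWeight i :=
  one_le_mul_of_one_le_of_one_le (by simp) (by simp)

lemma integral_trig_sq_le (k : ℤ × ℤ) (φ : ℝ) :
    ∫ x in unitCell, (trig k φ : ℝ × ℝ → ℝ) x ^ 2 ≤ 1 ^ 2 := by
  have h : ∫ x in unitCell, (trig k φ : ℝ × ℝ → ℝ) x ^ 2 ≤ ∫ x in unitCell, (1 : ℝ) := by
    refine integral_mono (integrableOn_unitCell ((testFun_continuous _).pow 2))
      (integrable_const _) fun x => ?_
    simp only [trig_apply]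
    exact Real.cos_sq_le_one _
  simpa using h

lemma summable_one_div_one_add_abs_sq : Summable fun n : ℤ => (1 / (1 + |(n : ℝ)|)) ^ 2 := by
  have h : Summable fun n : ℕ => (1 / (1 + (n : ℝ))) ^ 2 := by
    have := (summable_nat_add_iff 1).2 (Real.summable_one_div_nat_pow.2 (by norm_num : 1 < 2))
    refine this.congr fun n => ?_
    push_cast
    rw [div_pow, one_pow, add_comm]
  refine Summable.of_nat_of_neg ?_ ?_
  · refine h.congr fun n => ?_
    simp
  · refine h.congr fun n => ?_
    simp

lemma tsum_coefWeight_ne_top {P : ℕ} (hP : 2 ≤ P) :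
    ∑' i, ENNReal.ofReal ((1 / coefWeight i) ^ P) ≠ ⊤ := by
  have h2 : Summable fun k : ℤ × ℤ =>
      (1 / (1 + |(k.1 : ℝ)|)) ^ 2 * (1 / (1 + |(k.2 : ℝ)|)) ^ 2 :=
    summable_one_div_one_add_abs_sq.mul_of_nonneg summable_one_div_one_add_abs_sq
      (fun _ => sq_nonneg _) (fun _ => sq_nonneg _)
  have h3 : Summable fun i : (ℤ × ℤ) × Bool =>
      ((1 / (1 + |(i.1.1 : ℝ)|)) ^ 2 * (1 / (1 + |(i.1.2 : ℝ)|)) ^ 2) * 1 :=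
    h2.mul_of_nonneg (g := fun _ : Bool => (1 : ℝ)) (Summable.of_finite)
      (fun _ => by positivity) (fun _ => zero_le_one)
  have h4 : Summable fun i => (1 / coefWeight i) ^ P := by
    refine Summable.of_nonneg_of_le (fun i => ?_) (fun i => ?_) h3
    · have := one_le_coefWeight i
      positivity
    · have h1 := one_le_coefWeight i
      calc (1 / coefWeight i) ^ P ≤ (1 / coefWeight i) ^ 2 :=
            pow_le_pow_of_le_one (by positivity) (div_le_one_of_le₀ h1 (by positivity)) hP
        _ = _ := by
          rw [coefWeight, mul_one, ← mul_pow, div_mul_div_comm, one_mul]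
  exact h4.tsum_ofReal_ne_top

/-- The index set of the fields at the grid points. -/
abbrev GridIndex : Type :=
  Σ j : ℕ, (Bool × Fin 3) × (Fin (gridSize j) × Fin (gridSize j))

/-- The test functions for the fields at the grid points. -/
noncomputable def gridTest (i : GridIndex) : TestFun :=
  fieldTest (shell i.1) (kindCoef i.2.1.1 i.2.1.2 i.1) (kindPhase i.2.1.1 i.2.1.2)
    (gridPoint i.1 i.2.2)

lemma apply_gridTest (f : PeriodicDistribution) (b : Bool) (i : Fin 3) (j : ℕ)
    (q : Fin (gridSize j) × Fin (gridSize j)) :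
    f.1 (gridTest ⟨j, (b, i), q⟩) = kindField f b i j (gridPoint j q) :=
  apply_fieldTest f (shell j) (kindCoef b i j) (kindPhase b i) (gridPoint j q)

/-- The standard deviation of white noise tested with `gridTest`, up to a constant. -/
noncomputable def gridStd (j : ℕ) : ℝ := 32 * Real.pi * Real.sqrt 32 * (4 : ℝ) ^ (5 / 4 * (j : ℝ))

/-- The variance is at most the squared multiplier bound times the number of modes, and `32 =
4^(5/2)` turns the latter into the exponent `5/4` of the standard deviation. -/
lemma gridStd_sq (j : ℕ) : gridStd j ^ 2 = (16 * Real.pi) ^ 2 * (4 * 32 ^ (j + 1)) := by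
  have h : ((4 : ℝ) ^ (5 / 4 * (j : ℝ))) ^ 2 = 32 ^ j := by
    rw [← Real.rpow_natCast, ← Real.rpow_mul (by norm_num), ← Real.rpow_natCast (32 : ℝ) j,
      show (32 : ℝ) = 4 ^ (5 / 2 : ℝ) by
        rw [show (4 : ℝ) = 2 ^ (2 : ℝ) by norm_num, ← Real.rpow_mul (by norm_num)]
        norm_num, ← Real.rpow_mul (by norm_num)]
    congr 1
    push_cast
    ring
  unfold gridStd
  rw [mul_pow, mul_pow, Real.sq_sqrt (by norm_num), h, pow_succ]
  ring

lemma integral_gridTest_sq_le (i : GridIndex) :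
    ∫ x in unitCell, (gridTest i : ℝ × ℝ → ℝ) x ^ 2 ≤ gridStd i.1 ^ 2 := by
  refine (integral_fieldTest_sq_le _ _ _ _).trans ?_
  rw [gridStd_sq]
  have h : ∀ k ∈ shell i.1, kindCoef i.2.1.1 i.2.1.2 i.1 k ^ 2 ≤ (16 * Real.pi) ^ 2 := fun k hk => by
    rw [← sq_abs]
    exact pow_le_pow_left₀ (abs_nonneg _) (abs_kindCoef_le _ _ hk) 2
  refine (Finset.sum_le_card_nsmul _ _ _ h).trans ?_
  rw [nsmul_eq_mul, mul_comm]
  exact mul_le_mul_of_nonneg_left (card_shell_le i.1) (sq_nonneg _)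

/-- The shell `j` carries six kinds at `gridSize j ^ 2 = 4^(13 (j+1))` points, against a gain of
`4^(-εPj/2)` per term. The sum converges when `εP > 26`, which `28` ensures. -/
lemma tsum_gridWeight_ne_top {ε : ℝ} {P : ℕ} (hP : 28 ≤ ε * P) :
    ∑' i : GridIndex, ENNReal.ofReal ((gridStd i.1 / gridWeight ε i.1) ^ P) ≠ ⊤ := by
  have e : ∀ j : ℕ, (gridStd j / gridWeight ε j) ^ P
      = (32 * Real.pi * Real.sqrt 32) ^ P * (4 : ℝ) ^ (-(ε * P / 2) * (j : ℝ)) := fun j => by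
    rw [gridStd, gridWeight, mul_div_assoc, ← Real.rpow_sub (by norm_num), mul_pow,
      ← Real.rpow_natCast (_ ^ _), ← Real.rpow_mul (by norm_num)]
    congr 2
    ring
  have hs : Summable fun j : ℕ => (6 * (gridSize j : ℝ) ^ 2) * (gridStd j / gridWeight ε j) ^ P := by
    have hg := ((hasSum_four_rpow (by linarith : 0 < ε * P / 2 - 13)).summable.mul_left
      (6 * 4 ^ 13 * (32 * Real.pi * Real.sqrt 32) ^ P))
    refine hg.congr fun j => ?_
    have h13 : (gridSize j : ℝ) ^ 2 = 4 ^ 13 * (4 : ℝ) ^ (13 * (j : ℝ)) := by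
      rw [Real.rpow_mul (by norm_num), Real.rpow_natCast, gridSize]
      push_cast
      rw [← pow_mul, mul_comm (j + 1), pow_mul, pow_succ]
      norm_num
      ring
    rw [e, h13, show -(ε * P / 2 - 13) * (j : ℝ) = 13 * j + -(ε * P / 2) * j by ring,
      Real.rpow_add (by norm_num)]
    ring
  have h := hs.tsum_ofReal_ne_top
  rw [ENNReal.tsum_sigma']
  convert h using 3 with j
  rw [tsum_fintype]
  simp only
  rw [Finset.sum_const, nsmul_eq_mul, ENNReal.ofReal_mul (by positivity)]
  congr 1
  rw [Finset.card_univ]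
  simp only [Fintype.card_prod, Fintype.card_bool, Fintype.card_fin]
  rw [show (6 * (gridSize j : ℝ) ^ 2) = ((2 * 3 * (gridSize j * gridSize j) : ℕ) : ℝ) by
    push_cast; ring, ENNReal.ofReal_natCast]

/-- White noise has negative Hölder regularity, with all moments bounded. -/
lemma exists_moment_bound {ε : ℝ} (hε : 0 < ε) (hε4 : ε < 1 / 4) {P : ℕ} (hP : 2 ≤ P)
    (hPε : 28 ≤ ε * P) :
    ∃ K : ℝ≥0, ∀ (Ω : Type*) [MeasurableSpace Ω] (μ : Measure Ω)
      (ξ : Ω → PeriodicDistribution), IsWhiteNoise μ ξ →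
      ∃ S : Ω → ℝ≥0∞, AEMeasurable S μ ∧ ∫⁻ θ, S θ ∂μ ≤ K ∧ ∀ θ, S θ ≠ ⊤ →
        HasRep (3 / 4 - ε) (1 / 4 - ε) (repConst ε * (S θ).toReal ^ (1 / (P : ℝ))) (ξ θ) := by
  have hP0 : P ≠ 0 := by omega
  have hw1 : ∀ i, 0 < coefWeight i := fun i => one_pos.trans_le (one_le_coefWeight i)
  have hw2 : ∀ i : GridIndex, 0 < gridWeight ε i.1 := fun i =>
    one_pos.trans_le (one_le_gridWeight hε.le i.1)
  set K₁ := (∑' i, ENNReal.ofReal ((1 / coefWeight i) ^ P)) * gaussMoment P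
  set K₂ := (∑' i : GridIndex, ENNReal.ofReal ((gridStd i.1 / gridWeight ε i.1) ^ P)) *
    gaussMoment P
  have hK : K₁ + K₂ ≠ ⊤ := ENNReal.add_ne_top.2
    ⟨ENNReal.mul_ne_top (tsum_coefWeight_ne_top hP) (gaussMoment_ne_top P),
      ENNReal.mul_ne_top (tsum_gridWeight_ne_top hPε) (gaussMoment_ne_top P)⟩
  -- The constant involves only `ε`, `P` and Gaussian moments, hence is fixed before the probability
  -- space.
  refine ⟨(K₁ + K₂).toNNReal, fun Ω _ μ ξ hξ => ?_⟩
  refine ⟨fun θ => weightedSum coefTest coefWeight P (ξ θ)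
    + weightedSum gridTest (fun i => gridWeight ε i.1) P (ξ θ),
    (hξ.aemeasurable_weightedSum _ _ _).add (hξ.aemeasurable_weightedSum _ _ _), ?_,
    fun θ hS => ?_⟩
  · rw [lintegral_add_left' (hξ.aemeasurable_weightedSum _ _ _), ENNReal.coe_toNNReal hK]
    refine add_le_add ?_ ?_
    · exact hξ.lintegral_weightedSum_le (u := coefTest) (w := coefWeight) (s := fun _ => 1) hw1
        (fun _ => zero_le_one) (fun i => integral_trig_sq_le i.1 _) P
    · refine hξ.lintegral_weightedSum_le (u := gridTest) (w := fun i => gridWeight ε i.1)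
        (s := fun i => gridStd i.1) hw2 (fun i => ?_)
        integral_gridTest_sq_le P
      have := Real.pi_pos
      unfold gridStd
      positivity
  · refine hasRep_of_bounds hε hε4 (by positivity) (fun k => ⟨?_, ?_⟩) fun b i j q => ?_
    · have := abs_apply_le_of_weightedSum hw1 hP0 hS (le_add_of_nonneg_right zero_le) (k, false)
      simpa [coefTest, coefWeight] using this
    · have := abs_apply_le_of_weightedSum hw1 hP0 hS (le_add_of_nonneg_right zero_le) (k, true)
      simpa [coefTest, coefWeight] using this
    · have := abs_apply_le_of_weightedSum hw2 hP0 hS (le_add_of_nonneg_left zero_le)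
        ⟨j, (b, i), q⟩
      rwa [apply_gridTest] at this

/-! ### Expectations -/

lemma expect_le_lintegral {Ω : Type*} [MeasurableSpace Ω] {μ : Measure Ω} {F M : Ω → ℝ≥0∞}
    (hM : AEMeasurable M μ) (h : ∀ᵐ θ ∂μ, F θ ≤ M θ) : expect μ F ≤ ∫⁻ θ, M θ ∂μ := by
  rw [lintegral_congr_ae hM.ae_eq_mk]
  refine iInf_le_of_le (hM.mk M) (iInf_le_of_le hM.measurable_mk (iInf_le_of_le ?_ le_rfl))
  filter_upwards [h, hM.ae_eq_mk] with θ h1 h2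
  rwa [← h2]

/-- For `p ≤ P` one has `s^(p/P) ≤ 1 + s`, so the first moment of `S` controls the `p`-th moment of
`S^(1/P)`. The set `S = ∞` is null. -/
lemma expect_le_of_moment {Ω : Type*} [MeasurableSpace Ω] {μ : Measure Ω} [IsProbabilityMeasure μ]
    {F S : Ω → ℝ≥0∞} {A p : ℝ} {P : ℕ} {K : ℝ≥0} (hA : 0 ≤ A) (hp : 0 < p) (hpP : p ≤ P)
    (hS : AEMeasurable S μ) (hK : ∫⁻ θ, S θ ∂μ ≤ K)
    (hF : ∀ θ, S θ ≠ ⊤ → F θ ≤ ENNReal.ofReal ((A * (S θ).toReal ^ (1 / (P : ℝ))) ^ p)) :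
    expect μ F ≤ ENNReal.ofReal (A ^ p) * (1 + K) := by
  have hP : (0 : ℝ) < P := hp.trans_le hpP
  have hfin : ∀ᵐ θ ∂μ, S θ < ⊤ := ae_lt_top' hS (hK.trans_lt ENNReal.coe_lt_top).ne
  refine (expect_le_lintegral (M := fun θ => ENNReal.ofReal (A ^ p) * (1 + S θ))
    ((hS.const_add 1).const_mul _) ?_).trans ?_
  · filter_upwards [hfin] with θ h
    refine (hF θ h.ne).trans ?_
    have h0 : 0 ≤ (S θ).toReal := ENNReal.toReal_nonneg
    rw [Real.mul_rpow hA (Real.rpow_nonneg h0 _), ← Real.rpow_mul h0,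
      ENNReal.ofReal_mul (Real.rpow_nonneg hA _)]
    refine mul_le_mul_right ?_ _
    have h1 := rpow_le_one_add h0 (by positivity : 0 ≤ 1 / (P : ℝ) * p)
      (by rw [one_div_mul_eq_div]; exact div_le_one_of_le₀ hpP hP.le)
    refine (ENNReal.ofReal_le_ofReal h1).trans ?_
    rw [ENNReal.ofReal_add zero_le_one h0, ENNReal.ofReal_one, ENNReal.ofReal_toReal h.ne]
  · rw [lintegral_const_mul' _ _ ENNReal.ofReal_ne_top, lintegral_add_left measurable_const]
    simp only [lintegral_const, measure_univ, mul_one]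
    gcongr

end WhiteNoiseTorus

/-! ### The main theorem. -/

open WhiteNoiseTorus in
theorem lemma1 (φ : 𝓢(ℝ × ℝ, ℝ)) (hφ_symm : ∀ x, φ (-x) = φ x) (hφ_int : ∫ x, φ x = 1)
    (p : ℝ) (hp : 1 ≤ p) (ε : ℝ) (hε_pos : 0 < ε) (hε_lt : ε < 1 / 4) :
    ∃ C : ℝ≥0, ∀ (Ω : Type*) [MeasurableSpace Ω] (μ : Measure Ω) [IsProbabilityMeasure μ]
      (ξ : Ω → PeriodicDistribution), IsWhiteNoise μ ξ →
      expect μ (fun θ => ⨆ (ℓ : ℝ) (hℓ : 0 < ℓ) (_ : ℓ ≤ 1),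
          holderNeg (-(5 / 4) - ε) (proj (mollify φ ℓ hℓ (ξ θ))) ^ p) ≤ C ∧
      ∀ ℓ₀ : ℝ, 0 < ℓ₀ → ℓ₀ ≤ 1 →
        expect μ (fun θ => ⨆ (ℓ : ℝ) (hℓ : 0 < ℓ) (_ : ℓ ≤ ℓ₀),
            holderNeg (-(5 / 4) - ε) (mollify φ ℓ hℓ (ξ θ) - ξ θ) ^ p) ^ (1 / p)
          ≤ C * ENNReal.ofReal (ℓ₀ ^ (ε / 2)) := by
  have hp0 : 0 < p := one_pos.trans_le hp
  -- `P ≥ p` serves the moment comparison and `P ≥ 2` the Fourier coefficients. The bound `56 / ε`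
  -- makes the grid condition `28 ≤ ε' P` hold also for `ε' = ε/2`.
  obtain ⟨P, hP⟩ := exists_nat_ge (max (max p 2) (56 / ε))
  have hPp : p ≤ P := (le_max_left _ _).trans ((le_max_left _ _).trans hP)
  have hP2 : 2 ≤ P := by
    exact_mod_cast (le_max_right p 2).trans ((le_max_left _ _).trans hP)
  have hPε : 56 ≤ ε * P := by
    have := (div_le_iff₀ hε_pos).1 ((le_max_right _ _).trans hP)
    linarith
  have hε2 : 0 < ε / 2 := by linarith
  obtain ⟨K₁, hK₁⟩ := exists_moment_bound hε_pos hε_lt hP2 (by linarith)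
  obtain ⟨K₂, hK₂⟩ := exists_moment_bound hε2 (by linarith) hP2 (by linarith)
  have hI : 0 ≤ ∫ y, |φ y| := integral_nonneg fun _ => abs_nonneg _
  have hr₁ : 0 ≤ repConst ε := zero_le_one.trans (one_le_repConst hε_pos)
  have hr₂ : 0 ≤ repConst (ε / 2) := zero_le_one.trans (one_le_repConst hε2)
  set A₁ := 3 * (2 * ((∫ y, |φ y|) * repConst ε)) with hA₁
  set A₂ := 3 * (mollifyConst φ (3 / 4 - ε / 2) (1 / 4 - ε / 2) * repConst (ε / 2)) with hA₂
  have hA₁0 : 0 ≤ A₁ := by positivity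
  have hm := mollifyConst_nonneg φ (3 / 4 - ε / 2) (1 / 4 - ε / 2)
  have hA₂0 : 0 ≤ A₂ := by positivity
  -- The first estimate keeps the power `p`; in the second the `p`-th root has been taken. A sum
  -- dominates both constants.
  refine ⟨(A₁ ^ p).toNNReal * (1 + K₁) + A₂.toNNReal * (1 + K₂), fun Ω _ μ _ ξ hξ => ⟨?_, ?_⟩⟩
  · obtain ⟨S, hS, hSK, hrep⟩ := hK₁ Ω μ ξ hξ
    refine (expect_le_of_moment hA₁0 hp0 hPp hS hSK fun θ hθ => ?_).trans ?_
    · refine iSup_le fun ℓ => iSup_le fun hℓ => iSup_le fun _ => ?_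
      have hb : 0 ≤ (S θ).toReal ^ (1 / (P : ℝ)) := by positivity
      have h := ((hrep θ hθ).proj_mollify (by linarith) (by linarith) (by positivity) φ hℓ).holderNeg_le
        hε_pos (by positivity)
      rw [← ENNReal.ofReal_rpow_of_nonneg (by positivity) hp0.le]
      refine ENNReal.rpow_le_rpow (h.trans (ENNReal.ofReal_le_ofReal (le_of_eq ?_))) hp0.le
      rw [hA₁]
      ring
    · push_cast
      exact le_add_of_nonneg_right zero_le
  · intro ℓ₀ hℓ₀ _
    obtain ⟨S, hS, hSK, hrep⟩ := hK₂ Ω μ ξ hξ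
    have hpow : 0 ≤ ℓ₀ ^ (ε / 2) := Real.rpow_nonneg hℓ₀.le _
    have hmain := expect_le_of_moment (A := A₂ * ℓ₀ ^ (ε / 2))
      (F := fun θ => ⨆ (ℓ : ℝ) (hℓ : 0 < ℓ) (_ : ℓ ≤ ℓ₀),
            holderNeg (-(5 / 4) - ε) (mollify φ ℓ hℓ (ξ θ) - ξ θ) ^ p)
      (by positivity) hp0 hPp hS hSK fun θ hθ => ?_
    · refine (ENNReal.rpow_le_rpow hmain (by positivity)).trans ?_
      rw [ENNReal.mul_rpow_of_nonneg _ _ (by positivity),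
        ENNReal.ofReal_rpow_of_nonneg (by positivity) (by positivity), ← Real.rpow_mul
        (by positivity), mul_one_div_cancel hp0.ne', Real.rpow_one, ENNReal.ofReal_mul hA₂0]
      -- The root can be dropped because the base is at least one and `p ≥ 1`.
      have hK : ((1 : ℝ≥0∞) + K₂) ^ (1 / p) ≤ 1 + K₂ := by
        have h1 : (1 : ℝ≥0∞) ≤ 1 + K₂ := le_add_of_nonneg_right zero_le
        calc ((1 : ℝ≥0∞) + K₂) ^ (1 / p) ≤ (1 + K₂) ^ (1 : ℝ) :=
              ENNReal.rpow_le_rpow_of_exponent_le h1 (div_le_one_of_le₀ hp hp0.le)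
          _ = _ := ENNReal.rpow_one _
      push_cast
      calc _ ≤ ENNReal.ofReal A₂ * ENNReal.ofReal (ℓ₀ ^ (ε / 2)) * (1 + K₂) := by gcongr
        _ = (ENNReal.ofReal A₂ * (1 + K₂)) * ENNReal.ofReal (ℓ₀ ^ (ε / 2)) := by ring
        _ ≤ _ := by
          gcongr
          exact le_add_of_nonneg_left zero_le
    · refine iSup_le fun ℓ => iSup_le fun hℓ => iSup_le fun hle => ?_
      have hb : 0 ≤ (S θ).toReal ^ (1 / (P : ℝ)) := by positivity
      -- The representation with `ε/2` is degraded by `δ = ε/2`, which lands on the exponents for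
      -- `ε`. The condition `δ < 1/4 - ε/2` is exactly `ε < 1/4`.
      have h := (hrep θ hθ).mollify_sub (δ := ε / 2) hε2.le (by linarith) (by linarith)
        (by linarith) (by linarith) (by positivity) φ hφ_int hℓ
      rw [show 3 / 4 - ε / 2 - ε / 2 = 3 / 4 - ε by ring,
        show 1 / 4 - ε / 2 - ε / 2 = 1 / 4 - ε by ring] at h
      have h2 := h.holderNeg_le hε_pos (by positivity)
      rw [← ENNReal.ofReal_rpow_of_nonneg (by positivity) hp0.le]
      refine ENNReal.rpow_le_rpow (h2.trans (ENNReal.ofReal_le_ofReal ?_)) hp0.le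
      have hℓp : ℓ ^ (ε / 2) ≤ ℓ₀ ^ (ε / 2) := Real.rpow_le_rpow hℓ.le hle hε2.le
      calc _ ≤ 3 * (mollifyConst φ (3 / 4 - ε / 2) (1 / 4 - ε / 2) *
            (ℓ₀ ^ (ε / 2) * (repConst (ε / 2) * (S θ).toReal ^ (1 / (P : ℝ))))) := by gcongr
        _ = _ := by rw [hA₂]; ring
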